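/- **Setting.** Let $K\ge 2$, $T\ge 1$, $M\ge1$. Let $G$ be a directed graph on the set of arms $[K]$ in which every arm has a self-loop (so $G$ is strongly observable); write $a\to b$ for an edge, $N^{in}(a)=\{b: b\to a\}$, $p(N^{in}(a))=\sum_{b\to a}p(b)$, and let $\alpha$ be the independence number of $G$ (the largest number of arms with no edge, in either direction, between two distinct ones). An oblivious adversary fixes losses $\ell_{t,c}(a)\in[0,1]$ ($t\in[T]$, $c\in[M]$, $a\in[K]$) in advance. In round $t$ a context $c_t$ is drawn i.i.d. from a distribution $\nu$ on $[M]$ unknown to the learner; the learner sees $c_t$, plays $A_t\in[K]$, suffers $\ell_{t,c_t}(A_t)$, and observes $\ell_{t,c}(a)$ for all contexts $c$ and all $a$ with $A_t\to a$. The expected regret against $\pi:[M]\to[K]$ is $\mathrm{Reg}(\pi)=\mathbb E\big[\sum_{t=1}^T \ell_{t,c_t}(A_t)-\ell_{t,c_t}(\pi(c_t))\big]$. **Parameters.** $\iota=2\log(8KT^2)$; $L=\sqrt{\iota\alpha T/\log K}$, rounded to a positive even integer (any positive even integer at distance less than $2$ from this number); $\gamma=16\iota/L$; $\eta=\gamma/(2(2L\gamma+\iota))$.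 **Algorithm.** Rounds are divided into epochs of $L$ consecutive rounds, epoch $e$ consisting of rounds $(e-1)L+1,\dots,eL$, and each epoch into consecutive pairs of rounds; the procedure is stopped after round $T$. Put $s_{1,c}(a)=s_{2,c}(a)=1/K$ and $\widehat\ell_{t,c}=0$ for all $t\le L$. For a pair $(t,t+1)$ let $$p_{t,c}=p_{t+1,c}=\operatorname*{argmin}_{p\in\Delta([K])}\Big\langle p,\sum_{s<t}\widehat\ell_{s,c}\Big\rangle+\frac1\eta\sum_a p(a)\log p(a).$$ For $e\ge 1$ the snapshot is $s_{e+2,c}=p_{eL,c}$. * *Epoch 1:* play $A_t\sim s_{1,c_t}$; set $\widehat w_2(a)=\frac1{2L}\sum_{t\le L}s_{2,c_t}(N^{in}(a))$. * *Epoch $e\ge2$:* for each pair $(t,t+1)$ and $t'\in\{t,t+1\}$, let $q_{t',c}=p_{t,c}$ if $p_{t,c}(a)\ge s_{e,c}(a)/2$ for all $a\in[K]$, and $q_{t',c}=s_{e,c}$ otherwise; observe $c_{t'}$ and play $A_{t'}\sim q_{t',c_{t'}}$. Then let $(t_f,t_\ell)$ be a uniformly random ordering of $(t,t+1)$, draw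 independent Bernoulli variables $S_a$, $a\in[K]$, with success probabilities $\frac{s_{e,c_{t_\ell}}(N^{in}(a))}{2q_{t_\ell,c_{t_\ell}}(N^{in}(a))}$, and set, for all $c$ and $a$, $\widehat\ell_{t_f,c}(a)=0$ and $$\widehat\ell_{t_\ell,c}(a)=\frac{2\,\ell_{t_\ell,c}(a)}{\widehat w_e(a)+\frac32\gamma}\,\mathbb I\big(A_{t_\ell}\to a,\ S_a=1\big).$$ At the end of epoch $e$ put $\widehat w_{e+1}(a)=\frac{2}{L}\sum_{t_f}\frac{s_{e+1,c_{t_f}}(N^{in}(a))}{2}$, the sum being over the $L/2$ rounds $t_f$ of epoch $e$. **Theorem.** There are absolute constants $C>0$ and $k\in\mathbb N$ such that, for all $K,T,G,L$ as above, with $B=C\log^k(KT)$, $$\frac{\sqrt{\alpha T}}{B}\le L\le B\sqrt{\alpha T},\qquad \frac1{B\sqrt{\alpha T}}\le\gamma\le\frac{B}{\sqrt{\alpha T}},\qquad \frac1{B\sqrt{\alpha T}}\le\eta\le\frac{B}{\sqrt{\alpha T}},$$ and, for all $M$, $\nu$, $\ell$ and every policy $\pi:[M]\to[K]$, the algorithm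 satisfies $$\mathrm{Reg}(\pi)\le C\,\log^k(KT)\,\sqrt{\alpha T},$$ that is, $\mathrm{Reg}(\pi)=\widetilde O(\sqrt{\alpha T})$ with constants that do not depend on the number of contexts $M$. -/

import Mathlib

namespace CrossLearning

open scoped ENNReal

/-! ### Finite randomness -/

/-- The distribution on `Fin n` given by a point of the probability simplex. -/
noncomputable def simplexPMF {n : ℕ} (p : stdSimplex ℝ (Fin n)) : PMF (Fin n) :=
  PMF.ofFintype (fun i => ENNReal.ofReal (p.1 i)) (by
    rw [← ENNReal.ofReal_sum_of_nonneg (fun i _ => p.2.1 i), p.2.2, ENNReal.ofReal_one])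

/-- Independent Bernoulli variables, the `a`-th one being `true` with probability `ρ a`. -/
noncomputable def bernoulliVec {n : ℕ} (ρ : Fin n → unitInterval) : PMF (Fin n → Bool) :=
  PMF.ofFintype
    (fun S => ∏ a, ENNReal.ofReal (if S a = true then (ρ a : ℝ) else 1 - (ρ a : ℝ))) (by
    have h := (Finset.prod_univ_sum (fun _ : Fin n => (Finset.univ : Finset Bool))
      (fun a b => ENNReal.ofReal (if b = true then (ρ a : ℝ) else 1 - (ρ a : ℝ)))).symm
    rw [Fintype.piFinset_univ] at h
    rw [h]
    refine Finset.prod_eq_one fun a _ => ?_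
    rw [Fintype.sum_bool, ← ENNReal.ofReal_add] <;>
      simp [(ρ a).2.1, (ρ a).2.2])

/-! ### Entropy-regularized follow the regularized leader -/

/-- The FTRL objective `⟨p, Λ⟩ + η⁻¹ F(p)`, where `F(p) = ∑ p_a log p_a`. -/
noncomputable def ftrlObjective {K : ℕ} (η : ℝ) (Λ : Fin K → ℝ) (p : Fin K → ℝ) : ℝ :=
  ∑ a, p a * Λ a + η⁻¹ * ∑ a, p a * Real.log (p a)

theorem exists_ftrl_minimizer {K : ℕ} [NeZero K] (η : ℝ) (Λ : Fin K → ℝ) :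
    ∃ p : stdSimplex ℝ (Fin K),
      IsMinOn (ftrlObjective η Λ) (stdSimplex ℝ (Fin K)) p.1 := by
  have hc : Continuous (ftrlObjective η Λ) := by
    unfold ftrlObjective
    refine Continuous.add (by fun_prop) (Continuous.mul continuous_const ?_)
    exact continuous_finsetSum _ fun a _ => Real.continuous_mul_log.comp (continuous_apply a)
  obtain ⟨p, hp, hmin⟩ := (isCompact_stdSimplex ℝ (Fin K)).exists_isMinOn
    ⟨_, (stdSimplex.barycenter : stdSimplex ℝ (Fin K)).2⟩ hc.continuousOn
  exact ⟨⟨p, hp⟩, hmin⟩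

/-- The minimizer is unique, so that `ftrl` below is the argmin. -/
theorem ftrl_minimizer_unique {K : ℕ} {η : ℝ} (hη : 0 < η) (Λ : Fin K → ℝ)
    {p q : stdSimplex ℝ (Fin K)}
    (hp : IsMinOn (ftrlObjective η Λ) (stdSimplex ℝ (Fin K)) p.1)
    (hq : IsMinOn (ftrlObjective η Λ) (stdSimplex ℝ (Fin K)) q.1) : p = q := by
  have hs : StrictConvexOn ℝ (stdSimplex ℝ (Fin K)) (ftrlObjective η Λ) := by
    refine ⟨convex_stdSimplex ℝ (Fin K), fun x hx y hy hxy s t hs ht hst => ?_⟩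
    have key : ∑ a, (s * x a + t * y a) * Real.log (s * x a + t * y a)
        < ∑ a, (s * (x a * Real.log (x a)) + t * (y a * Real.log (y a))) := by
      obtain ⟨a, ha⟩ := Function.ne_iff.mp hxy
      refine Finset.sum_lt_sum (fun b _ => ?_) ⟨a, Finset.mem_univ a, ?_⟩
      · have := Real.strictConvexOn_mul_log.convexOn.2
          (Set.mem_Ici.2 (hx.1 b)) (Set.mem_Ici.2 (hy.1 b)) hs.le ht.le hst
        simpa [smul_eq_mul] using this
      · have := Real.strictConvexOn_mul_log.2
          (Set.mem_Ici.2 (hx.1 a)) (Set.mem_Ici.2 (hy.1 a)) ha hs ht hst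
        simpa [smul_eq_mul] using this
    have hη' : 0 < η⁻¹ := inv_pos.2 hη
    have h1 := mul_lt_mul_of_pos_left key hη'
    simp only [ftrlObjective, Pi.add_apply, Pi.smul_apply, smul_eq_mul]
    have h2 : ∑ a, (s * x a + t * y a) * Λ a
        = s * ∑ a, x a * Λ a + t * ∑ a, y a * Λ a := by
      rw [Finset.mul_sum, Finset.mul_sum, ← Finset.sum_add_distrib]
      exact Finset.sum_congr rfl fun a _ => by ring
    have h3 : ∑ a, (s * (x a * Real.log (x a)) + t * (y a * Real.log (y a)))
        = s * ∑ a, x a * Real.log (x a) + t * ∑ a, y a * Real.log (y a) := by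
      rw [Finset.mul_sum, Finset.mul_sum, ← Finset.sum_add_distrib]
    rw [h3] at h1
    rw [h2]
    linarith
  exact Subtype.ext (hs.eq_of_isMinOn hp hq p.2 q.2)

/-- `argmin_{p ∈ Δ([K])} ⟨p, Λ⟩ + η⁻¹ F(p)`. -/
noncomputable def ftrl {K : ℕ} [NeZero K] (η : ℝ) (Λ : Fin K → ℝ) : stdSimplex ℝ (Fin K) :=
  Classical.choose (exists_ftrl_minimizer η Λ)

/-! ### The feedback graph -/

open scoped Classical in
/-- `p(N^in(a)) = ∑_{b → a} p(b)`. -/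
noncomputable def inMass {K : ℕ} (G : Digraph (Fin K)) (p : stdSimplex ℝ (Fin K)) (a : Fin K) : ℝ :=
  ∑ b with G.Adj b a, p.1 b

/-- The independence number: the largest size of a set of arms with no edge, in either direction,
between two distinct members. -/
noncomputable def independenceNumber {K : ℕ} (G : Digraph (Fin K)) : ℕ :=
  G.toSimpleGraphInclusive.indepNum

/-! ### The algorithm

Rounds are numbered `0, 1, 2, …` and grouped into the consecutive pairs `{2j, 2j+1}`; an epoch
consists of `L` rounds (`L` even), that is, of `L / 2` pairs. -/

/-- The variables of the algorithm at the start of a pair of rounds of epoch `e`. -/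
structure State (K M : ℕ) where
  /-- the cumulative loss estimates `∑_s ℓ̂_{s,c}(a)` -/
  cum : Fin M → Fin K → ℝ
  /-- the snapshot `s_e` -/
  sCur : Fin M → stdSimplex ℝ (Fin K)
  /-- the snapshot `s_{e+1}` -/
  sNext : Fin M → stdSimplex ℝ (Fin K)
  /-- the importance `ŵ_e` (not used in the first epoch) -/
  wCur : Fin K → ℝ
  /-- the part of `ŵ_{e+1}` accumulated so far -/
  wNext : Fin K → ℝ

/-- What happens in a pair of rounds. -/
structure PairRecord (K M : ℕ) where
  /-- the two contexts -/
  ctx : Fin 2 → Fin M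
  /-- the two arms played -/
  arm : Fin 2 → Fin K
  /-- which of the two rounds is `t_ℓ`; the other one is `t_f` -/
  lossIdx : Fin 2
  /-- the acceptance variables `S_a` -/
  accept : Fin K → Bool

noncomputable instance (K M : ℕ) : Fintype (PairRecord K M) :=
  Fintype.ofEquiv ((Fin 2 → Fin M) × (Fin 2 → Fin K) × Fin 2 × (Fin K → Bool))
    { toFun := fun x => ⟨x.1, x.2.1, x.2.2.1, x.2.2.2⟩
      invFun := fun r => (r.ctx, r.arm, r.lossIdx, r.accept)
      left_inv := fun _ => rfl
      right_inv := fun _ => rfl }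

section Algorithm

variable {K M : ℕ} [NeZero K]

noncomputable def initState (K M : ℕ) [NeZero K] : State K M where
  cum := fun _ _ => 0
  sCur := fun _ => stdSimplex.barycenter
  sNext := fun _ => stdSimplex.barycenter
  wCur := fun _ => 0
  wNext := fun _ => 0

/-- The FTRL distribution `p_{t,c}`, common to the two rounds of a pair. -/
noncomputable def ftrlDist (η : ℝ) (σ : State K M) (c : Fin M) : stdSimplex ℝ (Fin K) :=
  ftrl η (σ.cum c)

open scoped Classical in
/-- The playing distribution in the `j`-th pair of rounds: the snapshot `s_1` in the first epoch,
and `q_{t,c}` afterwards. -/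
noncomputable def playDist (L : ℕ) (η : ℝ) (j : ℕ) (σ : State K M) (c : Fin M) :
    stdSimplex ℝ (Fin K) :=
  if L / 2 ≤ j ∧ ∀ a, (σ.sCur c).1 a / 2 ≤ (ftrlDist η σ c).1 a then ftrlDist η σ c
  else σ.sCur c

theorem accept_ratio_mem (G : Digraph (Fin K)) (L : ℕ) (η : ℝ) (j : ℕ) (σ : State K M)
    (c : Fin M) (a : Fin K) :
    inMass G (σ.sCur c) a / (2 * inMass G (playDist L η j σ c) a) ∈ Set.Icc (0 : ℝ) 1 := by
  have hnn : ∀ p : stdSimplex ℝ (Fin K), 0 ≤ inMass G p a := fun p =>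
    Finset.sum_nonneg fun b _ => p.2.1 b
  refine ⟨div_nonneg (hnn _) (mul_nonneg zero_le_two (hnn _)),
    div_le_one_of_le₀ ?_ (mul_nonneg zero_le_two (hnn _))⟩
  unfold playDist
  split_ifs with h
  · unfold inMass
    rw [Finset.mul_sum]
    exact Finset.sum_le_sum fun b _ => by linarith [h.2 b]
  · linarith [hnn (σ.sCur c)]

/-- The acceptance probability `s_{e,c}(N^in(a)) / (2 q_{t,c}(N^in(a)))`. -/
noncomputable def acceptProb (G : Digraph (Fin K)) (L : ℕ) (η : ℝ) (j : ℕ) (σ : State K M)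
    (c : Fin M) (a : Fin K) : unitInterval :=
  ⟨inMass G (σ.sCur c) a / (2 * inMass G (playDist L η j σ c) a),
    accept_ratio_mem G L η j σ c a⟩

/-- The law of the `j`-th pair of rounds, given the state at its start: in each of the two rounds
a fresh context is drawn from `ν` and an arm from the playing distribution; then a fair coin selects
the loss round, and the variables `S_a` are drawn. (In the first epoch the algorithm does not use
the coin and the `S_a`.) -/
noncomputable def pairLaw (G : Digraph (Fin K)) (L : ℕ) (η : ℝ) (ν : PMF (Fin M)) (j : ℕ)
    (σ : State K M) : PMF (PairRecord K M) :=
  ν.bind fun c₀ =>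
  (simplexPMF (playDist L η j σ c₀)).bind fun a₀ =>
  ν.bind fun c₁ =>
  (simplexPMF (playDist L η j σ c₁)).bind fun a₁ =>
  (PMF.uniformOfFintype (Fin 2)).bind fun i =>
  (bernoulliVec (acceptProb G L η j σ (![c₀, c₁] i))).map fun S =>
    ⟨![c₀, c₁], ![a₀, a₁], i, S⟩

open scoped Classical in
/-- The loss estimate `ℓ̂_{t,c}(a)` of the loss round `t = t_ℓ` of the `j`-th pair. -/
noncomputable def lossEstimate (G : Digraph (Fin K)) (γ : ℝ) (ℓ : ℕ → Fin M → Fin K → ℝ) (j : ℕ)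
    (σ : State K M) (r : PairRecord K M) (c : Fin M) (a : Fin K) : ℝ :=
  if G.Adj (r.arm r.lossIdx) a ∧ r.accept a = true then
    2 * ℓ (2 * j + r.lossIdx) c a / (σ.wCur a + 3 / 2 * γ)
  else 0

/-- The contribution of the `j`-th pair to the next importance `ŵ_{e+1}(a)`: in the first epoch both
rounds contribute, later on only the frequency round `t_f`. -/
noncomputable def freqIncrement (G : Digraph (Fin K)) (L : ℕ) (j : ℕ) (σ : State K M)
    (r : PairRecord K M) (a : Fin K) : ℝ :=
  if j < L / 2 then ∑ i, inMass G (σ.sNext (r.ctx i)) a / (2 * (L : ℝ))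
  else inMass G (σ.sNext (r.ctx (1 - r.lossIdx))) a / (2 * ((L : ℝ) / 2))

/-- The update of the variables after the `j`-th pair, including the change of epoch when this pair
is the last one of its epoch. -/
noncomputable def step (G : Digraph (Fin K)) (L : ℕ) (γ η : ℝ) (ℓ : ℕ → Fin M → Fin K → ℝ) (j : ℕ)
    (σ : State K M) (r : PairRecord K M) : State K M :=
  let cum' : Fin M → Fin K → ℝ := fun c a =>
    if j < L / 2 then σ.cum c a else σ.cum c a + lossEstimate G γ ℓ j σ r c a
  let w' : Fin K → ℝ := fun a => σ.wNext a + freqIncrement G L j σ r a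
  if (j + 1) % (L / 2) = 0 then
    { cum := cum', sCur := σ.sNext, sNext := ftrlDist η σ, wCur := w', wNext := fun _ => 0 }
  else
    { cum := cum', sCur := σ.sCur, sNext := σ.sNext, wCur := σ.wCur, wNext := w' }

/-- The state after `n` pairs of rounds, as a function of what happened in them. -/
noncomputable def stateAfter (G : Digraph (Fin K)) (L : ℕ) (γ η : ℝ) (ℓ : ℕ → Fin M → Fin K → ℝ) :
    (n : ℕ) → (Fin n → PairRecord K M) → State K M
  | 0, _ => initState K M
  | n + 1, h =>
    step G L γ η ℓ n (stateAfter G L γ η ℓ n fun i => h i.castSucc) (h (Fin.last n))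

/-- The law of the first `n` pairs of rounds. -/
noncomputable def historyLaw (G : Digraph (Fin K)) (L : ℕ) (γ η : ℝ) (ν : PMF (Fin M))
    (ℓ : ℕ → Fin M → Fin K → ℝ) : (n : ℕ) → PMF (Fin n → PairRecord K M)
  | 0 => PMF.pure Fin.elim0
  | n + 1 => (historyLaw G L γ η ν ℓ n).bind fun h =>
      (pairLaw G L η ν n (stateAfter G L γ η ℓ n h)).map fun r =>
        Fin.snoc (α := fun _ => PairRecord K M) h r

/-- The realized regret over the first `T` rounds against the policy `π`; round `t` is the
`(t % 2)`-th round of the `(t / 2)`-th pair. -/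
noncomputable def realizedRegret (ℓ : ℕ → Fin M → Fin K → ℝ) (π : Fin M → Fin K) (T : ℕ)
    (h : Fin ((T + 1) / 2) → PairRecord K M) : ℝ :=
  ∑ t : Fin T,
    let r := h ⟨(t : ℕ) / 2, by omega⟩
    let i : Fin 2 := ⟨(t : ℕ) % 2, Nat.mod_lt _ two_pos⟩
    (ℓ t (r.ctx i) (r.arm i) - ℓ t (r.ctx i) (π (r.ctx i)))

/-- The expected regret over `T` rounds against the policy `π`. -/
noncomputable def expectedRegret (G : Digraph (Fin K)) (L : ℕ) (γ η : ℝ) (ν : PMF (Fin M))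
    (ℓ : ℕ → Fin M → Fin K → ℝ) (π : Fin M → Fin K) (T : ℕ) : ℝ :=
  ∑ h : Fin ((T + 1) / 2) → PairRecord K M,
    (historyLaw G L γ η ν ℓ ((T + 1) / 2) h).toReal * realizedRegret ℓ π T h

end Algorithm

/-! ### The parameters -/

/-- `ι = 2 log(8 K T²)`. -/
noncomputable def iota (K T : ℕ) : ℝ := 2 * Real.log (8 * K * (T : ℝ) ^ 2)

/-- `√(ι α T / log K)`, which the epoch length equals up to rounding to an even integer. -/
noncomputable def idealEpochLength {K : ℕ} (G : Digraph (Fin K)) (T : ℕ) : ℝ :=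
  Real.sqrt (iota K T * independenceNumber G * T / Real.log K)

/-- `γ = 16 ι / L`. -/
noncomputable def gammaParam (K T L : ℕ) : ℝ := 16 * iota K T / L

/-- `η = γ / (2 (2 L γ + ι))`. -/
noncomputable def etaParam (K T L : ℕ) : ℝ :=
  gammaParam K T L / (2 * (2 * L * gammaParam K T L + iota K T))

end CrossLearning

/-!
# Regret of cross-learning with graph feedback and unknown context distribution

Everything is computed through the Markov chain of the algorithm's states: `Game.chain` is the
expectation of a function of the state after some pairs of rounds, and all probabilistic facts are
inductions on the number of pairs.

Fix an epoch, with snapshot `s`, importances `w(a) = ½ 𝔼_c s_c(N^in(a))`, their estimate `ŵ` and the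
error `x = ŵ - w`. The acceptance variables make the probability that `a` is observed and accepted
equal to `w(a)` whatever the playing distribution is (`Game.pairExp_mul_hit`). Hence a loss estimate
has conditional mean `ρ` times the loss of the pair, with `ρ = w / (ŵ + 3γ/2)`, and second moment at
most `4w / (ŵ + 3γ/2)²`. The regret of a pair splits accordingly (`Game.pairRegret_le`):

* The regret for the loss estimates is bounded by the potential of exponential weights, which is the
  closed form of FTRL (`ftrl_eq_expWeights`). The second-order term reduces to
  `∑_a 𝔼_c s_c(a) / (w(a) + γ)`, which is `O(α log (1/γ))`: weights `p` on the vertices of a digraph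
  admit a vertex with `p(N^in(a)) ≥ p(V) / (2α)`, and removing such vertices one by one gives a
  telescoping logarithm (`sum_div_inMass_le_log`).
* The bias `𝔼 (ρ - 1)` at the comparator is not positive up to a failure probability, since `ŵ` is
  unbiased and the margin `3γ/2` outweighs its variance (`Game.mean_bias_sub_one_le`).
* The bias at the played arms is at most `3γ/2 / y + (w/y) (x/y)` with `y = w + 3γ/2`. The first
  term is again of the form above. The second is linear in the mean-zero error `x`, which is of
  order `√(w/L)`, so a bound by absolute values would be too weak. However, the FTRL distribution is
  close to the one computed from the losses at the start of the epoch plus the *true* losses since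
  then. That distribution is independent of `x`, because `ŵ` is computed from rounds that do not
  influence the loss estimates (`Game.mean_predicted_drift_eq_zero`). The difference of the two
  distributions is itself of the order of the relative error of `ŵ` plus the fluctuations of the
  loss estimates, so that only products of two small quantities remain (`Game.mean_drift_le`).

All this holds on the event that `ŵ` is not much smaller than `w` and that the loss estimates grow by
at most a fraction of `1/η` per epoch. Then the FTRL distribution stays within a factor of two of the
snapshot, so it is the one that is played. Exponential moments show that this event fails with
probability `O(K exp (-ι))` (`Game.mean_not_good_le`), which is small enough for the trivial bounds to
suffice on its complement.
-/

namespace CrossLearning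

set_option linter.unusedSectionVars false

/-! ### Weighted independence bounds -/

open scoped Classical in
/-- Weighted Caro–Wei: the arms chosen greedily by least weight of the closed neighbourhood form
an independent set, and each chosen neighbourhood contributes at most `1` to the sum. -/
theorem exists_indepSet_sum_div_le {V : Type*} [Fintype V] (Γ : SimpleGraph V) (p : V → ℝ)
    (hp : ∀ i, 0 ≤ p i) (s : Finset V) :
    ∃ t ⊆ s, Γ.IsIndepSet (t : Set V) ∧
      ∑ i ∈ s, p i / (∑ j ∈ s with j = i ∨ Γ.Adj i j, p j) ≤ (t.card : ℝ) := by
  induction s using Finset.strongInduction with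
  | H s ih =>
    rcases s.eq_empty_or_nonempty with rfl | hs
    · exact ⟨∅, subset_rfl, by simp, by simp⟩
    set d : Finset V → V → ℝ := fun s i => ∑ j ∈ s with j = i ∨ Γ.Adj i j, p j with hd
    have hd0 : ∀ s i, 0 ≤ d s i := fun s i => Finset.sum_nonneg fun j _ => hp j
    have hself : ∀ s, ∀ i ∈ s, p i ≤ d s i := fun s i hi =>
      Finset.single_le_sum (f := p) (fun j _ => hp j)
        (Finset.mem_filter.2 ⟨hi, Or.inl rfl⟩)
    obtain ⟨i, his, hmin⟩ := s.exists_min_image (d s) hs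
    set N := s.filter (fun j => j = i ∨ Γ.Adj i j) with hN
    have hiN : i ∈ N := Finset.mem_filter.2 ⟨his, Or.inl rfl⟩
    have hss : s \ N ⊂ s := Finset.sdiff_ssubset (Finset.filter_subset _ _) ⟨i, hiN⟩
    obtain ⟨t, hts, hti, hsum⟩ := ih _ hss
    have hit : i ∉ t := fun h => (Finset.mem_sdiff.1 (hts h)).2 hiN
    refine ⟨insert i t, ?_, ?_, ?_⟩
    · exact Finset.insert_subset his (hts.trans hss.subset)
    · rw [Finset.coe_insert, SimpleGraph.isIndepSet_iff, Set.pairwise_insert]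
      have hna : ∀ b ∈ t, ¬Γ.Adj i b := fun b hb hadj => by
        have hb' := Finset.mem_sdiff.1 (hts hb)
        exact hb'.2 (Finset.mem_filter.2 ⟨hb'.1, Or.inr hadj⟩)
      exact ⟨hti, fun b hb _ => ⟨hna b hb, fun h => hna b hb h.symm⟩⟩
    · rw [Finset.card_insert_of_notMem hit, ← Finset.sum_sdiff (Finset.filter_subset _ s : N ⊆ s)]
      push_cast
      refine add_le_add ?_ ?_
      · refine le_trans (Finset.sum_le_sum fun j hj => ?_) hsum
        change p j / d s j ≤ p j / d (s \ N) j
        rcases (hd0 (s \ N) j).eq_or_lt with h | h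
        · have : p j = 0 := le_antisymm ((hself _ j hj).trans h.symm.le) (hp j)
          simp [this]
        · refine div_le_div_of_nonneg_left (hp j) h ?_
          exact Finset.sum_le_sum_of_subset_of_nonneg
            (Finset.filter_subset_filter _ Finset.sdiff_subset) fun k _ _ => hp k
      · change ∑ j ∈ N, p j / d s j ≤ 1
        rcases (hd0 s i).eq_or_lt with h | h
        · have h0 : ∀ j ∈ N, p j = 0 :=
            (Finset.sum_eq_zero_iff_of_nonneg fun j _ => hp j).1 h.symm
          rw [Finset.sum_eq_zero fun j hj => by rw [h0 j hj, zero_div]]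
          exact zero_le_one
        · calc ∑ j ∈ N, p j / d s j ≤ ∑ j ∈ N, p j / d s i := Finset.sum_le_sum fun j hj =>
                div_le_div_of_nonneg_left (hp j) h (hmin j (Finset.mem_filter.1 hj).1)
            _ = 1 := by rw [← Finset.sum_div]; exact div_self h.ne'

open scoped Classical in
/-- In a reflexive digraph some vertex receives at least a `1 / (2α)` fraction of the weight. -/
theorem exists_large_inMass {K : ℕ} (G : Digraph (Fin K)) (hG : ∀ a, G.Adj a a) (p : Fin K → ℝ)
    (hp : ∀ i, 0 ≤ p i) (s : Finset (Fin K)) (hs : s.Nonempty) :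
    ∃ i ∈ s, ∑ j ∈ s, p j ≤
      2 * (independenceNumber G : ℝ) * ∑ j ∈ s with G.Adj j i, p j := by
  by_contra! hcon
  set Γ := G.toSimpleGraphInclusive
  set α : ℝ := (independenceNumber G : ℝ) with hα
  set P := ∑ j ∈ s, p j with hP
  set m : Fin K → ℝ := fun i => ∑ j ∈ s with G.Adj j i, p j with hm
  set d : Fin K → ℝ := fun i => ∑ j ∈ s with j = i ∨ Γ.Adj i j, p j with hd
  have hm0 : ∀ i, 0 ≤ m i := fun i => Finset.sum_nonneg fun j _ => hp j
  have hd0 : ∀ i, 0 ≤ d i := fun i => Finset.sum_nonneg fun j _ => hp j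
  have hself : ∀ i ∈ s, p i ≤ d i := fun i hi =>
    Finset.single_le_sum (f := p) (fun j _ => hp j) (Finset.mem_filter.2 ⟨hi, Or.inl rfl⟩)
  have hα0 : 0 ≤ α := Nat.cast_nonneg _
  obtain ⟨t, -, ht, hsum⟩ := exists_indepSet_sum_div_le Γ p hp s
  replace hsum : ∑ i ∈ s, p i / d i ≤ (t.card : ℝ) := by convert hsum
  have htα : (t.card : ℝ) ≤ α := by
    rw [hα]
    exact_mod_cast ht.card_le_indepNum
  have hturan : P ^ 2 ≤ α * ∑ i ∈ s, p i * d i := by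
    refine (Finset.sum_sq_le_sum_mul_sum_of_sq_le_mul s (f := fun i => p i / d i)
      (g := fun i => p i * d i) (fun i _ => div_nonneg (hp i) (hd0 i))
      (fun i _ => mul_nonneg (hp i) (hd0 i)) fun i hi => ?_).trans ?_
    · rcases (hd0 i).eq_or_lt with h | h
      · have : p i = 0 := le_antisymm ((hself i hi).trans h.symm.le) (hp i)
        simp [this]
      · refine le_of_eq ?_
        field_simp
    · exact mul_le_mul_of_nonneg_right (hsum.trans htα)
        (Finset.sum_nonneg fun i _ => mul_nonneg (hp i) (hd0 i))
  have hdm : ∑ i ∈ s, p i * d i ≤ 2 * ∑ i ∈ s, p i * m i := by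
    have h1 : ∀ i ∈ s, d i ≤ m i + ∑ j ∈ s with G.Adj i j, p j := by
      intro i hi
      simp only [hd, hm, Finset.sum_filter, ← Finset.sum_add_distrib]
      refine Finset.sum_le_sum fun j _ => ?_
      have hpj := hp j
      by_cases hij : j = i ∨ Γ.Adj i j
      · have : G.Adj j i ∨ G.Adj i j := by
          rcases hij with rfl | h
          · exact Or.inl (hG _)
          · exact h.2.symm
        rw [if_pos hij]
        rcases this with h | h <;> rw [if_pos h] <;> split_ifs <;> linarith
      · rw [if_neg hij]
        split_ifs <;> linarith
    have h2 : ∑ i ∈ s, p i * ∑ j ∈ s with G.Adj i j, p j = ∑ i ∈ s, p i * m i := by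
      simp only [hm, Finset.sum_filter, Finset.mul_sum]
      rw [Finset.sum_comm]
      refine Finset.sum_congr rfl fun i _ => Finset.sum_congr rfl fun j _ => ?_
      split_ifs <;> ring
    calc ∑ i ∈ s, p i * d i
        ≤ ∑ i ∈ s, (p i * m i + p i * ∑ j ∈ s with G.Adj i j, p j) :=
          Finset.sum_le_sum fun i hi => by
            rw [← mul_add]; exact mul_le_mul_of_nonneg_left (h1 i hi) (hp i)
      _ = 2 * ∑ i ∈ s, p i * m i := by rw [Finset.sum_add_distrib, h2]; ring
  have hPpos : 0 < P := by
    obtain ⟨i, hi⟩ := hs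
    exact lt_of_le_of_lt (mul_nonneg (mul_nonneg zero_le_two hα0) (hm0 i)) (hcon i hi)
  obtain ⟨i₀, hi₀, hpi₀⟩ : ∃ i ∈ s, 0 < p i := by
    by_contra! h
    exact absurd (Finset.sum_nonpos h) (not_le.2 hPpos)
  have hlt : ∑ i ∈ s, p i * (2 * α * m i) < ∑ i ∈ s, p i * P :=
    Finset.sum_lt_sum (fun i hi => mul_le_mul_of_nonneg_left (hcon i hi).le (hp i))
      ⟨i₀, hi₀, mul_lt_mul_of_pos_left (hcon i₀ hi₀) hpi₀⟩
  rw [← Finset.sum_mul, ← hP] at hlt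
  have h3 : ∑ i ∈ s, p i * (2 * α * m i) = α * (2 * ∑ i ∈ s, p i * m i) := by
    simp only [Finset.mul_sum]
    exact Finset.sum_congr rfl fun i _ => by ring
  have := mul_le_mul_of_nonneg_left hdm hα0
  nlinarith

theorem one_le_independenceNumber {K : ℕ} [NeZero K] (G : Digraph (Fin K)) :
    1 ≤ independenceNumber G := by
  have h : G.toSimpleGraphInclusive.IsIndepSet (({0} : Finset (Fin K)) : Set (Fin K)) := by
    simp [SimpleGraph.isIndepSet_iff]
  exact h.card_le_indepNum

open scoped Classical in
/-- Removing a vertex that receives much weight changes the weight `P` to `P - p_i` and costs at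
most `2α p_i / (P + 2αg)`; these costs telescope to a logarithm. -/
theorem sum_div_inMass_le_log {K : ℕ} [NeZero K] (G : Digraph (Fin K)) (hG : ∀ a, G.Adj a a)
    (p : Fin K → ℝ) (hp : ∀ i, 0 ≤ p i) {g : ℝ} (hg : 0 < g)
    (s : Finset (Fin K)) :
    ∑ i ∈ s, p i / ((∑ j ∈ s with G.Adj j i, p j) + g) ≤
      2 * (independenceNumber G : ℝ) * Real.log ((∑ j ∈ s, p j + 2 * independenceNumber G * g) /
        (2 * independenceNumber G * g)) := by
  set α : ℝ := (independenceNumber G : ℝ) with hα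
  have hα1 : 1 ≤ α := by rw [hα]; exact_mod_cast one_le_independenceNumber G
  have hc : 0 < 2 * α * g := by positivity
  induction s using Finset.strongInduction with
  | H s ih =>
    rcases s.eq_empty_or_nonempty with rfl | hs
    · simp [div_self hc.ne']
    obtain ⟨i, his, hi⟩ := exists_large_inMass G hG p hp s hs
    rw [← hα] at hi
    have ih' := ih _ (Finset.erase_ssubset his)
    set P' := ∑ j ∈ s.erase i, p j with hP'
    have hP'0 : 0 ≤ P' := Finset.sum_nonneg fun j _ => hp j
    have hP : ∑ j ∈ s, p j = p i + P' := (Finset.add_sum_erase s p his).symm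
    rw [← Finset.add_sum_erase s _ his]
    rw [hP] at hi ⊢
    have hpi := hp i
    have h1 : ∑ k ∈ s.erase i, p k / ((∑ j ∈ s with G.Adj j k, p j) + g) ≤
        ∑ k ∈ s.erase i, p k / ((∑ j ∈ s.erase i with G.Adj j k, p j) + g) := by
      refine Finset.sum_le_sum fun k _ => div_le_div_of_nonneg_left (hp k) ?_ ?_
      · have : 0 ≤ ∑ j ∈ s.erase i with G.Adj j k, p j := Finset.sum_nonneg fun j _ => hp j
        linarith
      · gcongr
        · exact fun j _ _ => hp j
        · exact Finset.erase_subset i s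
    have h2 : p i / ((∑ j ∈ s with G.Adj j i, p j) + g) ≤
        2 * α * (p i / (p i + P' + 2 * α * g)) := by
      have h3 : 0 < p i + P' + 2 * α * g := by positivity
      have h4 : 0 ≤ ∑ j ∈ s with G.Adj j i, p j := Finset.sum_nonneg fun j _ => hp j
      rw [← mul_div_assoc, div_le_div_iff₀ (by linarith) h3]
      nlinarith
    have h5 : p i / (p i + P' + 2 * α * g) ≤
        Real.log ((p i + P' + 2 * α * g) / (P' + 2 * α * g)) := by
      have h6 : 0 < P' + 2 * α * g := by positivity
      have h7 : 0 < p i + P' + 2 * α * g := by positivity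
      refine le_trans (le_of_eq ?_) (Real.one_sub_inv_le_log_of_pos (div_pos h7 h6))
      rw [inv_div]
      field_simp
      ring
    have h8 : Real.log ((p i + P' + 2 * α * g) / (2 * α * g)) =
        Real.log ((p i + P' + 2 * α * g) / (P' + 2 * α * g)) +
          Real.log ((P' + 2 * α * g) / (2 * α * g)) := by
      rw [← Real.log_mul (by positivity) (by positivity)]
      congr 1
      field_simp
    rw [h8, mul_add]
    have h9 := mul_le_mul_of_nonneg_left h5 (by positivity : (0 : ℝ) ≤ 2 * α)
    linarith

/-! ### Exponential weights -/

section ExponentialWeights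

variable {K : ℕ} [NeZero K] {η : ℝ}

/-- The partition function of the exponential weights with cumulative losses `Λ`. -/
noncomputable def partitionFn (η : ℝ) (Λ : Fin K → ℝ) : ℝ := ∑ a, Real.exp (-(η * Λ a))

theorem partitionFn_pos (η : ℝ) (Λ : Fin K → ℝ) : 0 < partitionFn η Λ :=
  Finset.sum_pos (fun _ _ => Real.exp_pos _) Finset.univ_nonempty

/-- The exponential weights as a point of the simplex. -/
noncomputable def expWeights (η : ℝ) (Λ : Fin K → ℝ) : stdSimplex ℝ (Fin K) :=
  ⟨fun a => Real.exp (-(η * Λ a)) / partitionFn η Λ,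
    fun _ => div_nonneg (Real.exp_pos _).le (partitionFn_pos η Λ).le, by
      rw [← Finset.sum_div]; exact div_self (partitionFn_pos η Λ).ne'⟩

theorem mul_log_sub_mul_log_ge {x y : ℝ} (hx : 0 ≤ x) (hy : 0 < y) :
    x - y ≤ x * Real.log x - x * Real.log y := by
  rcases hx.eq_or_lt with rfl | hx
  · simp [hy.le]
  · have h := Real.one_sub_inv_le_log_of_pos (div_pos hx hy)
    rw [Real.log_div hx.ne' hy.ne', inv_div] at h
    have h2 := mul_le_mul_of_nonneg_left h hx.le
    have h3 : x * (1 - y / x) = x - y := by field_simp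
    linarith

/-- The FTRL distribution with entropic regularization is given by exponential weights (Gibbs
variational principle). -/
theorem ftrl_eq_expWeights (hη : 0 < η) (Λ : Fin K → ℝ) : ftrl η Λ = expWeights η Λ := by
  refine ftrl_minimizer_unique hη Λ (Classical.choose_spec (exists_ftrl_minimizer η Λ)) ?_
  have hZ := partitionFn_pos η Λ
  have hlog : ∀ a, Real.log ((expWeights η Λ).1 a) = -(η * Λ a) - Real.log (partitionFn η Λ) :=
    fun a => by
      change Real.log (Real.exp (-(η * Λ a)) / partitionFn η Λ) = _
      rw [Real.log_div (Real.exp_pos _).ne' hZ.ne', Real.log_exp]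
  have hpos : ∀ a, 0 < (expWeights η Λ).1 a := fun a => div_pos (Real.exp_pos _) hZ
  -- the objective is `η⁻¹` times the relative entropy to the exponential weights, up to a constant
  have hobj : ∀ p ∈ stdSimplex ℝ (Fin K), ftrlObjective η Λ p =
      η⁻¹ * ∑ a, (p a * Real.log (p a) - p a * Real.log ((expWeights η Λ).1 a)) -
        η⁻¹ * Real.log (partitionFn η Λ) := by
    intro p hp
    have h1 : ∑ a, (p a * Real.log (p a) - p a * Real.log ((expWeights η Λ).1 a)) =
        ∑ a, p a * Real.log (p a) + η * ∑ a, p a * Λ a + Real.log (partitionFn η Λ) := by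
      have h2 : Real.log (partitionFn η Λ) = ∑ a, p a * Real.log (partitionFn η Λ) := by
        rw [← Finset.sum_mul, hp.2, one_mul]
      rw [h2, Finset.mul_sum, ← Finset.sum_add_distrib, ← Finset.sum_add_distrib]
      refine Finset.sum_congr rfl fun a _ => ?_
      rw [hlog]
      ring
    rw [h1, ftrlObjective]
    field_simp
    ring
  intro p hp
  rw [Set.mem_ofPred_eq, hobj p hp, hobj _ (expWeights η Λ).2]
  simp only [sub_self, Finset.sum_const_zero, mul_zero]
  have h3 : 0 ≤ ∑ a, (p a * Real.log (p a) - p a * Real.log ((expWeights η Λ).1 a)) := by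
    calc (0 : ℝ) = ∑ a, (p a - (expWeights η Λ).1 a) := by
          rw [Finset.sum_sub_distrib, hp.2, (expWeights η Λ).2.2, sub_self]
      _ ≤ _ := Finset.sum_le_sum fun a _ => mul_log_sub_mul_log_ge (hp.1 a) (hpos a)
  have := mul_nonneg (inv_pos.2 hη).le h3
  linarith

theorem expWeights_apply (Λ : Fin K → ℝ) (a : Fin K) :
    (expWeights η Λ).1 a = Real.exp (-(η * Λ a)) / partitionFn η Λ := rfl

theorem expWeights_zero : expWeights η (0 : Fin K → ℝ) = stdSimplex.barycenter := by
  refine Subtype.ext (funext fun a => ?_)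
  simp [expWeights_apply, partitionFn, stdSimplex.barycenter]

theorem expWeights_nonneg (Λ : Fin K → ℝ) (a : Fin K) : 0 ≤ (expWeights η Λ).1 a :=
  (expWeights η Λ).2.1 a

theorem expWeights_sum (Λ : Fin K → ℝ) : ∑ a, (expWeights η Λ).1 a = 1 := (expWeights η Λ).2.2

/-- Additional losses of total size at most `log 2 / η` change the weights by a factor of at most
two in either direction. -/
theorem expWeights_half_le_and_le_two {Λ Λ' : Fin K → ℝ} (h0 : ∀ a, 0 ≤ η * (Λ' a - Λ a))
    (h1 : ∀ a, η * (Λ' a - Λ a) ≤ Real.log 2) (a : Fin K) :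
    (expWeights η Λ).1 a / 2 ≤ (expWeights η Λ').1 a ∧
      (expWeights η Λ').1 a ≤ 2 * (expWeights η Λ).1 a := by
  have hlow : ∀ b, Real.exp (-(η * Λ b)) / 2 ≤ Real.exp (-(η * Λ' b)) := fun b => by
    have : Real.exp (-(η * Λ b)) / 2 = Real.exp (-(η * Λ b) - Real.log 2) := by
      rw [Real.exp_sub, Real.exp_log two_pos]
    rw [this, Real.exp_le_exp]
    linarith [h1 b, mul_sub η (Λ' b) (Λ b)]
  have hup : ∀ b, Real.exp (-(η * Λ' b)) ≤ Real.exp (-(η * Λ b)) := fun b => by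
    rw [Real.exp_le_exp]
    linarith [h0 b, mul_sub η (Λ' b) (Λ b)]
  have hZ := partitionFn_pos η Λ
  have hZ' := partitionFn_pos η Λ'
  have hZlow : partitionFn η Λ / 2 ≤ partitionFn η Λ' := by
    unfold partitionFn
    rw [Finset.sum_div]
    exact Finset.sum_le_sum fun b _ => hlow b
  have hZup : partitionFn η Λ' ≤ partitionFn η Λ := Finset.sum_le_sum fun b _ => hup b
  rw [expWeights_apply, expWeights_apply]
  have he := Real.exp_pos (-(η * Λ a))
  constructor
  · calc Real.exp (-(η * Λ a)) / partitionFn η Λ / 2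
        = Real.exp (-(η * Λ a)) / 2 / partitionFn η Λ := by ring
      _ ≤ Real.exp (-(η * Λ' a)) / partitionFn η Λ' :=
        div_le_div₀ (Real.exp_pos _).le (hlow a) hZ' hZup
  · calc Real.exp (-(η * Λ' a)) / partitionFn η Λ'
        ≤ Real.exp (-(η * Λ a)) / (partitionFn η Λ / 2) :=
        div_le_div₀ he.le (hup a) (by positivity) hZlow
      _ = _ := by field_simp

/-- First-order stability of the exponential weights under a perturbation `d / η` of the
losses. -/
theorem abs_expWeights_sub_le {Λ Λ' : Fin K → ℝ} {d : Fin K → ℝ}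
    (hd : ∀ a, |η * (Λ' a - Λ a)| = d a) (hd1 : ∀ a, d a ≤ 8 / 25) (a : Fin K) :
    |(expWeights η Λ').1 a - (expWeights η Λ).1 a| ≤
        4 * (expWeights η Λ).1 a * (d a + ∑ b, (expWeights η Λ).1 b * d b) ∧
      (expWeights η Λ).1 a ≤ 2 * (expWeights η Λ').1 a := by
  set p := (expWeights η Λ).1 with hp
  have hp0 : ∀ b, 0 ≤ p b := (expWeights η Λ).2.1
  have hp1 : ∑ b, p b = 1 := (expWeights η Λ).2.2
  set z : Fin K → ℝ := fun b => Real.exp (-(η * (Λ' b - Λ b))) with hz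
  set r : ℝ := ∑ b, p b * z b with hr
  have hZ := partitionFn_pos η Λ
  have hZ' := partitionFn_pos η Λ'
  have hexp : ∀ b, Real.exp (-(η * Λ' b)) = z b * Real.exp (-(η * Λ b)) := fun b => by
    rw [hz, ← Real.exp_add]; congr 1; ring
  have hrZ : r = partitionFn η Λ' / partitionFn η Λ := by
    rw [hr, eq_div_iff hZ.ne', Finset.sum_mul]
    refine Finset.sum_congr rfl fun b _ => ?_
    rw [hexp b, hp, expWeights_apply]
    field_simp
  have hq : (expWeights η Λ').1 a = p a * z a / r := by
    rw [hrZ, expWeights_apply, hexp, hp, expWeights_apply]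
    field_simp
  have hd0 : ∀ b, 0 ≤ d b := fun b => by rw [← hd b]; exact abs_nonneg _
  have hz1 : ∀ b, |z b - 1| ≤ 2 * d b := fun b => by
    have h := Real.abs_exp_sub_one_le (x := -(η * (Λ' b - Λ b)))
      (by rw [abs_neg, hd b]; linarith [hd1 b])
    rwa [abs_neg, hd b] at h
  have hzlow : ∀ b, Real.exp (-(8 / 25)) ≤ z b := fun b => by
    rw [hz, Real.exp_le_exp]
    have := le_abs_self (η * (Λ' b - Λ b))
    rw [hd b] at this
    linarith [hd1 b]
  have hzup : ∀ b, z b ≤ Real.exp (8 / 25) := fun b => by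
    rw [hz, Real.exp_le_exp]
    have := neg_abs_le (η * (Λ' b - Λ b))
    rw [hd b] at this
    linarith [hd1 b]
  have hrlow : Real.exp (-(8 / 25)) ≤ r := by
    calc Real.exp (-(8 / 25)) = ∑ b, p b * Real.exp (-(8 / 25)) := by
          rw [← Finset.sum_mul, hp1, one_mul]
      _ ≤ r := Finset.sum_le_sum fun b _ => mul_le_mul_of_nonneg_left (hzlow b) (hp0 b)
  have hrup : r ≤ Real.exp (8 / 25) := by
    calc r ≤ ∑ b, p b * Real.exp (8 / 25) :=
          Finset.sum_le_sum fun b _ => mul_le_mul_of_nonneg_left (hzup b) (hp0 b)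
      _ = _ := by rw [← Finset.sum_mul, hp1, one_mul]
  have hhalf : (1 : ℝ) / 2 ≤ Real.exp (-(8 / 25)) := by
    have := Real.add_one_le_exp (-(8 / 25) : ℝ)
    norm_num at this ⊢
    linarith
  have hr0 : 0 < r := by linarith
  have hr1 : |r - 1| ≤ 2 * ∑ b, p b * d b := by
    have : r - 1 = ∑ b, p b * (z b - 1) := by
      simp only [mul_sub, mul_one, Finset.sum_sub_distrib, hp1, hr]
    rw [this, Finset.mul_sum]
    refine (Finset.abs_sum_le_sum_abs _ _).trans (Finset.sum_le_sum fun b _ => ?_)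
    rw [abs_mul, abs_of_nonneg (hp0 b)]
    have := mul_le_mul_of_nonneg_left (hz1 b) (hp0 b)
    linarith
  rw [hq]
  constructor
  · have h1 : p a * z a / r - p a = p a * ((z a - 1) - (r - 1)) / r := by
      field_simp; ring
    rw [h1, abs_div, abs_mul, abs_of_nonneg (hp0 a), abs_of_pos hr0, div_le_iff₀ hr0]
    have h2 : |(z a - 1) - (r - 1)| ≤ 2 * d a + 2 * ∑ b, p b * d b :=
      (abs_sub _ _).trans (add_le_add (hz1 a) hr1)
    have h3 : 0 ≤ d a + ∑ b, p b * d b :=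
      add_nonneg (hd0 a) (Finset.sum_nonneg fun b _ => mul_nonneg (hp0 b) (hd0 b))
    calc p a * |(z a - 1) - (r - 1)| ≤ p a * (2 * d a + 2 * ∑ b, p b * d b) :=
          mul_le_mul_of_nonneg_left h2 (hp0 a)
      _ = (4 * p a * (d a + ∑ b, p b * d b)) * (1 / 2) := by ring
      _ ≤ _ := mul_le_mul_of_nonneg_left (by linarith)
          (mul_nonneg (mul_nonneg (by norm_num) (hp0 a)) h3)
  · rw [← mul_div_assoc, le_div_iff₀ hr0]
    have h4 : r ≤ 2 * z a := by
      refine hrup.trans ?_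
      have h5 : Real.exp (8 / 25) ≤ 2 * Real.exp (-(8 / 25)) := by
        have h6 : (2 : ℝ) = Real.exp (Real.log 2) := (Real.exp_log two_pos).symm
        rw [h6, ← Real.exp_add, Real.exp_le_exp]
        linarith [Real.log_two_gt_d9]
      linarith [hzlow a]
    calc p a * r ≤ p a * (2 * z a) := mul_le_mul_of_nonneg_left h4 (hp0 a)
      _ = _ := by ring

/-- The potential `-η⁻¹ log ∑ exp (-η Λ)` of the exponential weights. -/
noncomputable def potential (η : ℝ) (Λ : Fin K → ℝ) : ℝ := -(η⁻¹ * Real.log (partitionFn η Λ))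

theorem potential_le (hη : 0 < η) (Λ : Fin K → ℝ) (a : Fin K) : potential η Λ ≤ Λ a := by
  have h1 : Real.exp (-(η * Λ a)) ≤ partitionFn η Λ :=
    Finset.single_le_sum (f := fun b => Real.exp (-(η * Λ b)))
      (fun b _ => (Real.exp_pos _).le) (Finset.mem_univ a)
  have h2 := Real.log_le_log (Real.exp_pos _) h1
  rw [Real.log_exp] at h2
  have h3 := mul_le_mul_of_nonneg_left h2 (inv_pos.2 hη).le
  have h4 : η⁻¹ * -(η * Λ a) = -Λ a := by field_simp
  unfold potential
  linarith

theorem potential_zero : potential η (0 : Fin K → ℝ) = -(η⁻¹ * Real.log K) := by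
  simp [potential, partitionFn]

/-- The one-step regret inequality of exponential weights for nonnegative losses. -/
theorem inner_sub_le_potential_sub (hη : 0 < η) (Λ x : Fin K → ℝ) (hx : ∀ a, 0 ≤ x a) :
    ∑ a, (expWeights η Λ).1 a * x a - η / 2 * ∑ a, (expWeights η Λ).1 a * x a ^ 2 ≤
      potential η (fun a => Λ a + x a) - potential η Λ := by
  set p := (expWeights η Λ).1 with hp
  have hp0 : ∀ b, 0 ≤ p b := (expWeights η Λ).2.1
  have hp1 : ∑ b, p b = 1 := (expWeights η Λ).2.2
  have hZ := partitionFn_pos η Λ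
  have hZ' := partitionFn_pos η (fun a => Λ a + x a)
  have hrat : partitionFn η (fun a => Λ a + x a) / partitionFn η Λ =
      ∑ a, p a * Real.exp (-(η * x a)) := by
    rw [div_eq_iff hZ.ne', Finset.sum_mul, partitionFn]
    refine Finset.sum_congr rfl fun a _ => ?_
    rw [hp, expWeights_apply, mul_add, neg_add, Real.exp_add]
    field_simp
  have hexp : ∀ y : ℝ, 0 ≤ y → Real.exp (-y) ≤ 1 - y + y ^ 2 / 2 := fun y hy => by
    have h := Real.quadratic_le_exp_of_nonneg hy
    rw [Real.exp_neg, inv_le_comm₀ (Real.exp_pos _) (by nlinarith [sq_nonneg (y - 1)])]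
    refine le_trans ?_ h
    rw [inv_le_iff_one_le_mul₀ (by nlinarith [sq_nonneg (y - 1)])]
    nlinarith [pow_nonneg hy 4]
  have h1 : ∑ a, p a * Real.exp (-(η * x a)) ≤
      1 - η * ∑ a, p a * x a + η ^ 2 / 2 * ∑ a, p a * x a ^ 2 := by
    calc ∑ a, p a * Real.exp (-(η * x a))
        ≤ ∑ a, p a * (1 - η * x a + (η * x a) ^ 2 / 2) := Finset.sum_le_sum fun a _ =>
          mul_le_mul_of_nonneg_left (hexp _ (mul_nonneg hη.le (hx a))) (hp0 a)
      _ = ∑ a, p a - η * ∑ a, p a * x a + η ^ 2 / 2 * ∑ a, p a * x a ^ 2 := by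
          rw [Finset.mul_sum, Finset.mul_sum, ← Finset.sum_sub_distrib, ← Finset.sum_add_distrib]
          exact Finset.sum_congr rfl fun a _ => by ring
      _ = _ := by rw [hp1]
  have h2 : Real.log (partitionFn η (fun a => Λ a + x a)) - Real.log (partitionFn η Λ) ≤
      -(η * ∑ a, p a * x a) + η ^ 2 / 2 * ∑ a, p a * x a ^ 2 := by
    rw [← Real.log_div hZ'.ne' hZ.ne']
    have := Real.log_le_sub_one_of_pos (div_pos hZ' hZ)
    rw [hrat] at this ⊢
    linarith
  have h3 := mul_le_mul_of_nonneg_left h2 (inv_pos.2 hη).le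
  have h4 : η⁻¹ * (-(η * ∑ a, p a * x a) + η ^ 2 / 2 * ∑ a, p a * x a ^ 2) =
      -∑ a, p a * x a + η / 2 * ∑ a, p a * x a ^ 2 := by
    field_simp
  rw [h4, mul_sub] at h3
  unfold potential
  linarith

end ExponentialWeights

/-! ### Expectations under finitely supported laws -/

section Expectation

variable {α β : Type*} [Fintype α] [Fintype β]

/-- The expectation of a real function under a law on a finite type. -/
noncomputable def expect (μ : PMF α) (f : α → ℝ) : ℝ := ∑ x, (μ x).toReal * f x

theorem sum_toReal (μ : PMF α) : ∑ x, (μ x).toReal = 1 := by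
  rw [← ENNReal.toReal_sum fun x _ => μ.apply_ne_top x, ← tsum_fintype (L := .unconditional α),
    μ.tsum_coe, ENNReal.toReal_one]

theorem expect_const (μ : PMF α) (c : ℝ) : expect μ (fun _ => c) = c := by
  rw [expect, ← Finset.sum_mul, sum_toReal, one_mul]

theorem expect_add (μ : PMF α) (f g : α → ℝ) :
    expect μ (fun x => f x + g x) = expect μ f + expect μ g := by
  simp only [expect, mul_add, Finset.sum_add_distrib]

theorem expect_sub (μ : PMF α) (f g : α → ℝ) :
    expect μ (fun x => f x - g x) = expect μ f - expect μ g := by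
  simp only [expect, mul_sub, Finset.sum_sub_distrib]

theorem expect_mul_left (μ : PMF α) (c : ℝ) (f : α → ℝ) :
    expect μ (fun x => c * f x) = c * expect μ f := by
  simp only [expect, Finset.mul_sum]
  exact Finset.sum_congr rfl fun x _ => by ring

theorem expect_mul_right (μ : PMF α) (c : ℝ) (f : α → ℝ) :
    expect μ (fun x => f x * c) = expect μ f * c := by
  simp only [expect, Finset.sum_mul]
  exact Finset.sum_congr rfl fun x _ => by ring

theorem expect_sum {ι : Type*} (μ : PMF α) (s : Finset ι) (f : ι → α → ℝ) :
    expect μ (fun x => ∑ i ∈ s, f i x) = ∑ i ∈ s, expect μ (f i) := by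
  simp only [expect, Finset.mul_sum]
  exact Finset.sum_comm

theorem expect_mono (μ : PMF α) {f g : α → ℝ} (h : ∀ x, f x ≤ g x) : expect μ f ≤ expect μ g :=
  Finset.sum_le_sum fun x _ => mul_le_mul_of_nonneg_left (h x) ENNReal.toReal_nonneg

theorem expect_nonneg (μ : PMF α) {f : α → ℝ} (h : ∀ x, 0 ≤ f x) : 0 ≤ expect μ f :=
  Finset.sum_nonneg fun x _ => mul_nonneg ENNReal.toReal_nonneg (h x)

theorem expect_le_of_le (μ : PMF α) {f : α → ℝ} {c : ℝ} (h : ∀ x, f x ≤ c) : expect μ f ≤ c :=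
  (expect_mono μ h).trans (expect_const μ c).le

theorem expect_pure (a : α) (f : α → ℝ) : expect (PMF.pure a) f = f a := by
  classical
  rw [expect, Finset.sum_eq_single a]
  · simp
  · intro b _ hb
    simp [PMF.pure_apply, hb]
  · simp

theorem expect_bind (μ : PMF α) (κ : α → PMF β) (f : β → ℝ) :
    expect (μ.bind κ) f = expect μ fun x => expect (κ x) f := by
  have h : ∀ y, ((μ.bind κ) y).toReal = ∑ x, (μ x).toReal * (κ x y).toReal := fun y => by
    rw [PMF.bind_apply, tsum_fintype, ENNReal.toReal_sum fun x _ =>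
      ENNReal.mul_ne_top (μ.apply_ne_top x) ((κ x).apply_ne_top y)]
    exact Finset.sum_congr rfl fun x _ => ENNReal.toReal_mul
  simp only [expect, h, Finset.sum_mul, Finset.mul_sum]
  rw [Finset.sum_comm]
  exact Finset.sum_congr rfl fun x _ => Finset.sum_congr rfl fun y _ => by ring

theorem expect_map (μ : PMF α) (g : α → β) (f : β → ℝ) :
    expect (μ.map g) f = expect μ fun x => f (g x) := by
  rw [← PMF.bind_pure_comp, expect_bind]
  simp only [Function.comp, expect_pure]

theorem expect_comm (μ : PMF α) (ν : PMF β) (f : α → β → ℝ) :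
    expect μ (fun x => expect ν (f x)) = expect ν fun y => expect μ fun x => f x y := by
  simp only [expect, Finset.mul_sum]
  rw [Finset.sum_comm]
  exact Finset.sum_congr rfl fun y _ => Finset.sum_congr rfl fun x _ => by ring

theorem expect_simplexPMF {n : ℕ} (p : stdSimplex ℝ (Fin n)) (f : Fin n → ℝ) :
    expect (simplexPMF p) f = ∑ a, p.1 a * f a := by
  refine Finset.sum_congr rfl fun a _ => ?_
  rw [simplexPMF, PMF.ofFintype_apply, ENNReal.toReal_ofReal (p.2.1 a)]

theorem expect_uniform_two (f : Fin 2 → ℝ) :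
    expect (PMF.uniformOfFintype (Fin 2)) f = (f 0 + f 1) / 2 := by
  simp [expect]
  ring

theorem expect_bernoulliVec {n : ℕ} (ρ : Fin n → unitInterval) (a : Fin n) :
    expect (bernoulliVec ρ) (fun S => if S a = true then 1 else 0) = ρ a := by
  classical
  have hb : ∀ (b : Fin n) (x : Bool), 0 ≤ (if x = true then (ρ b : ℝ) else 1 - (ρ b : ℝ)) := by
    intro b x
    split_ifs
    · exact (ρ b).2.1
    · linarith [(ρ b).2.2]
  have h1 : ∀ S : Fin n → Bool, ((bernoulliVec ρ) S).toReal * (if S a = true then 1 else 0) =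
      ∏ b, ((if S b = true then (ρ b : ℝ) else 1 - (ρ b : ℝ)) *
        (if b = a then (if S b = true then 1 else 0) else 1)) := by
    intro S
    rw [Finset.prod_mul_distrib, Finset.prod_ite_eq' Finset.univ a, if_pos (Finset.mem_univ a),
      bernoulliVec, PMF.ofFintype_apply, ENNReal.toReal_prod]
    congr 1
    exact Finset.prod_congr rfl fun b _ => ENNReal.toReal_ofReal (hb b _)
  have h := (Finset.prod_univ_sum (fun _ : Fin n => (Finset.univ : Finset Bool))
      (fun b x => ((if x = true then (ρ b : ℝ) else 1 - (ρ b : ℝ)) *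
        (if b = a then (if x = true then 1 else 0) else 1))))
  rw [Fintype.piFinset_univ] at h
  rw [expect, Finset.sum_congr rfl fun S _ => h1 S, ← h, Finset.prod_eq_single a]
  · simp
  · intro b _ hba
    simp [hba]
  · simp

end Expectation

/-! ### One pair of rounds -/

/-- The data of a run of the algorithm, with epochs of `2 * H` rounds and all losses in `[0, 1]`.
Only the relations between `γ`, `η` and the epoch length that the analysis needs are kept. -/
structure Game (K M : ℕ) where
  /-- the feedback graph -/
  G : Digraph (Fin K)
  refl : ∀ a, G.Adj a a
  /-- the number of pairs of rounds in an epoch -/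
  H : ℕ
  H_pos : 0 < H
  /-- the implicit exploration parameter -/
  γ : ℝ
  /-- the learning rate -/
  η : ℝ
  /-- the logarithmic confidence parameter -/
  ι : ℝ
  one_le_ι : 1 ≤ ι
  γ_mul : γ * (2 * H) = 16 * ι
  η_mul : η * (2 * H) = 8 / 33
  /-- the law of the contexts -/
  ν : PMF (Fin M)
  /-- the losses -/
  ℓ : ℕ → Fin M → Fin K → ℝ
  ℓ_mem : ∀ t c a, ℓ t c a ∈ Set.Icc (0 : ℝ) 1

namespace Game

variable {K M : ℕ} [NeZero K] (S : Game K M)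

theorem H_cast_pos : (0 : ℝ) < S.H := Nat.cast_pos.2 S.H_pos

theorem γ_pos : 0 < S.γ := by
  have h := S.γ_mul
  have := S.one_le_ι
  have hH := S.H_cast_pos
  by_contra! hc
  nlinarith

theorem η_pos : 0 < S.η := by
  have h := S.η_mul
  have hH := S.H_cast_pos
  by_contra! hc
  nlinarith

/-- Expectation over the `j`-th pair of rounds, started in the state `σ`. -/
noncomputable def pairExp (j : ℕ) (σ : State K M) (f : PairRecord K M → ℝ) : ℝ :=
  expect (pairLaw S.G (2 * S.H) S.η S.ν j σ) f

/-- The playing distribution in the `j`-th pair of rounds. -/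
noncomputable def play (j : ℕ) (σ : State K M) (c : Fin M) : stdSimplex ℝ (Fin K) :=
  playDist (2 * S.H) S.η j σ c

/-- The expectation over what determines the loss estimate of a pair: the choice of the loss round,
its context and arm, and the acceptance variables. -/
noncomputable def lossExp (j : ℕ) (σ : State K M)
    (F : Fin 2 → Fin M → Fin K → (Fin K → Bool) → ℝ) : ℝ :=
  expect (PMF.uniformOfFintype (Fin 2)) fun i => expect S.ν fun c =>
    expect (simplexPMF (S.play j σ c)) fun a =>
      expect (bernoulliVec (acceptProb S.G (2 * S.H) S.η j σ c)) fun A => F i c a A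

/-- The context of the frequency round is independent of the data of the loss round. -/
theorem pairExp_eq_expect_lossExp (j : ℕ) (σ : State K M)
    (F : Fin 2 → Fin M → Fin K → (Fin K → Bool) → Fin M → ℝ) :
    S.pairExp j σ (fun r => F r.lossIdx (r.ctx r.lossIdx) (r.arm r.lossIdx) r.accept
        (r.ctx (1 - r.lossIdx))) =
      expect S.ν fun c' => S.lossExp j σ fun i c a A => F i c a A c' := by
  have e0 : (1 : Fin 2) - 0 = 1 := rfl
  have e1 : (1 : Fin 2) - 1 = 0 := rfl
  simp only [pairExp, pairLaw, lossExp, expect_bind, expect_map, expect_uniform_two,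
    Matrix.cons_val_zero, Matrix.cons_val_one, e0, e1, div_eq_mul_inv, expect_mul_right,
    expect_add, expect_const]
  congr 2
  simp only [expect_comm (simplexPMF _) S.ν]
  exact expect_comm S.ν S.ν _

theorem lossExp_const (j : ℕ) (σ : State K M) (x : ℝ) :
    S.lossExp j σ (fun _ _ _ _ => x) = x := by
  simp only [lossExp, expect_const]

theorem lossExp_mul_left (j : ℕ) (σ : State K M) (x : ℝ)
    (F : Fin 2 → Fin M → Fin K → (Fin K → Bool) → ℝ) :
    S.lossExp j σ (fun i c a A => x * F i c a A) = x * S.lossExp j σ F := by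
  simp only [lossExp, expect_mul_left]

theorem pairExp_const (j : ℕ) (σ : State K M) (x : ℝ) : S.pairExp j σ (fun _ => x) = x :=
  expect_const _ _

theorem pairExp_freq (j : ℕ) (σ : State K M) (φ : Fin M → ℝ) :
    S.pairExp j σ (fun r => φ (r.ctx (1 - r.lossIdx))) = expect S.ν φ := by
  rw [S.pairExp_eq_expect_lossExp j σ fun _ _ _ _ c' => φ c']
  simp only [lossExp_const]

theorem pairExp_ctx_arm (j : ℕ) (σ : State K M) (g : Fin 2 → Fin M → Fin K → ℝ) :
    S.pairExp j σ (fun r => ∑ i, g i (r.ctx i) (r.arm i)) =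
      ∑ i, expect S.ν fun c => ∑ a, (S.play j σ c).1 a * g i c a := by
  simp only [pairExp, pairLaw, expect_bind, expect_map, Fin.sum_univ_two, expect_const,
    Matrix.cons_val_zero, Matrix.cons_val_one, expect_add, expect_simplexPMF, play]

/-- The importance `½ 𝔼_c s_c(N^in(a))` of the arm `a` for the snapshot `s`. -/
noncomputable def importance (s : Fin M → stdSimplex ℝ (Fin K)) (a : Fin K) : ℝ :=
  expect S.ν (fun c => inMass S.G (s c) a) / 2

theorem inMass_nonneg (p : stdSimplex ℝ (Fin K)) (a : Fin K) : 0 ≤ inMass S.G p a :=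
  Finset.sum_nonneg fun b _ => p.2.1 b

theorem inMass_le_one (p : stdSimplex ℝ (Fin K)) (a : Fin K) : inMass S.G p a ≤ 1 := by
  classical
  rw [← p.2.2]
  exact Finset.sum_le_sum_of_subset_of_nonneg (Finset.filter_subset _ _) fun b _ _ => p.2.1 b

theorem importance_nonneg (s : Fin M → stdSimplex ℝ (Fin K)) (a : Fin K) :
    0 ≤ S.importance s a :=
  div_nonneg (expect_nonneg _ fun _ => S.inMass_nonneg _ _) zero_le_two

theorem importance_le_half (s : Fin M → stdSimplex ℝ (Fin K)) (a : Fin K) :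
    S.importance s a ≤ 1 / 2 := by
  unfold importance
  have := expect_le_of_le S.ν fun c => S.inMass_le_one (s c) a
  linarith

theorem half_snapshot_le_play (j : ℕ) (σ : State K M) (c : Fin M) (a : Fin K) :
    (σ.sCur c).1 a / 2 ≤ (S.play j σ c).1 a := by
  unfold play playDist
  split_ifs with h
  · exact h.2 a
  · linarith [(σ.sCur c).2.1 a]

open scoped Classical in
/-- The indicator that the loss of the arm `a` is observed and accepted in the loss round. -/
noncomputable def hit (r : PairRecord K M) (a : Fin K) : ℝ :=
  if S.G.Adj (r.arm r.lossIdx) a ∧ r.accept a = true then 1 else 0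

/-- The acceptance variables make the probability of a hit independent of the playing
distribution. -/
theorem pairExp_mul_hit (j : ℕ) (σ : State K M) (g : Fin 2 → ℝ) (a : Fin K) :
    S.pairExp j σ (fun r => g r.lossIdx * S.hit r a) =
      (g 0 + g 1) / 2 * S.importance σ.sCur a := by
  classical
  have h := S.pairExp_eq_expect_lossExp j σ fun i _ b A _ =>
    g i * (if S.G.Adj b a ∧ A a = true then 1 else 0)
  refine Eq.trans (congrArg _ (funext fun r => ?_)) (h.trans ?_)
  · simp only [hit]
  rw [expect_const]
  have hS : ∀ c b, expect (bernoulliVec (acceptProb S.G (2 * S.H) S.η j σ c))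
      (fun A => (if S.G.Adj b a ∧ A a = true then (1 : ℝ) else 0)) =
      if S.G.Adj b a then (acceptProb S.G (2 * S.H) S.η j σ c a : ℝ) else 0 := by
    intro c b
    by_cases hb : S.G.Adj b a
    · simp only [hb, true_and, if_true]
      exact expect_bernoulliVec _ a
    · simp only [hb, false_and, if_false, expect_const]
  have hq : ∀ c, expect (simplexPMF (S.play j σ c)) (fun b =>
      if S.G.Adj b a then (acceptProb S.G (2 * S.H) S.η j σ c a : ℝ) else 0) =
      inMass S.G (σ.sCur c) a * (1 / 2) := by
    intro c
    have h1 : ∑ b, (S.play j σ c).1 b *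
        (if S.G.Adj b a then (acceptProb S.G (2 * S.H) S.η j σ c a : ℝ) else 0) =
        inMass S.G (S.play j σ c) a * (acceptProb S.G (2 * S.H) S.η j σ c a : ℝ) := by
      rw [inMass, Finset.sum_mul, Finset.sum_filter]
      exact Finset.sum_congr rfl fun b _ => by split_ifs <;> simp
    rw [expect_simplexPMF, h1]
    change inMass S.G (S.play j σ c) a *
      (inMass S.G (σ.sCur c) a / (2 * inMass S.G (S.play j σ c) a)) = _
    rcases (S.inMass_nonneg (S.play j σ c) a).eq_or_lt with h0 | h0
    · -- an arm that is never observed has no weight under the snapshot either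
      have h2 : inMass S.G (σ.sCur c) a / 2 ≤ inMass S.G (S.play j σ c) a := by
        rw [inMass, inMass, Finset.sum_div]
        exact Finset.sum_le_sum fun b _ => S.half_snapshot_le_play j σ c b
      have h3 : inMass S.G (σ.sCur c) a = 0 :=
        le_antisymm (by linarith) (S.inMass_nonneg _ _)
      rw [h3]; simp
    · field_simp
  unfold lossExp
  simp only [expect_mul_left, hS, hq, expect_mul_right, expect_uniform_two, importance]
  ring

/-- The increment of the cumulative loss estimates; there is none in the first epoch. -/
noncomputable def lossInc (j : ℕ) (σ : State K M) (r : PairRecord K M) (c : Fin M) (a : Fin K) :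
    ℝ :=
  if j < S.H then 0 else lossEstimate S.G S.γ S.ℓ j σ r c a

/-- The increment of the importance estimate for the next epoch. -/
noncomputable def freqInc (j : ℕ) (σ : State K M) (r : PairRecord K M) (a : Fin K) : ℝ :=
  freqIncrement S.G (2 * S.H) j σ r a

theorem lossInc_eq_mul_hit {j : ℕ} (hj : S.H ≤ j) (σ : State K M) (r : PairRecord K M)
    (c : Fin M) (a : Fin K) :
    S.lossInc j σ r c a =
      2 * S.ℓ (2 * j + r.lossIdx) c a / (σ.wCur a + 3 / 2 * S.γ) * S.hit r a := by
  rw [lossInc, if_neg (not_lt.2 hj), lossEstimate, hit]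
  split_ifs <;> simp

theorem hit_nonneg (r : PairRecord K M) (a : Fin K) : 0 ≤ S.hit r a := by
  unfold hit; split_ifs <;> norm_num

theorem hit_le_one (r : PairRecord K M) (a : Fin K) : S.hit r a ≤ 1 := by
  unfold hit; split_ifs <;> norm_num

theorem hit_eq_zero_or_one (r : PairRecord K M) (a : Fin K) : S.hit r a = 0 ∨ S.hit r a = 1 := by
  unfold hit; split_ifs <;> simp

theorem pairExp_hit (j : ℕ) (σ : State K M) (a : Fin K) :
    S.pairExp j σ (fun r => S.hit r a) = S.importance σ.sCur a := by
  have := S.pairExp_mul_hit j σ (fun _ => 1) a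
  simpa using this

theorem lossInc_nonneg (j : ℕ) (σ : State K M) (hw : ∀ a, 0 ≤ σ.wCur a) (r : PairRecord K M)
    (c : Fin M) (a : Fin K) : 0 ≤ S.lossInc j σ r c a := by
  rcases lt_or_ge j S.H with h | h
  · rw [lossInc, if_pos h]
  · rw [S.lossInc_eq_mul_hit h]
    have h1 := (S.ℓ_mem (2 * j + r.lossIdx) c a).1
    have h2 := hw a
    have h3 := S.γ_pos
    have h4 := S.hit_nonneg r a
    positivity

theorem lossInc_le (j : ℕ) (σ : State K M) (hw : ∀ a, 0 ≤ σ.wCur a) (r : PairRecord K M)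
    (c : Fin M) (a : Fin K) :
    S.lossInc j σ r c a ≤ 2 / (σ.wCur a + 3 / 2 * S.γ) * S.hit r a := by
  have h2 := hw a
  have h3 := S.γ_pos
  have h4 := S.hit_nonneg r a
  have h5 : 0 < σ.wCur a + 3 / 2 * S.γ := by positivity
  rcases lt_or_ge j S.H with h | h
  · rw [lossInc, if_pos h]; positivity
  · rw [S.lossInc_eq_mul_hit h]
    have h1 := (S.ℓ_mem (2 * j + r.lossIdx) c a).2
    gcongr
    linarith

/-- The sum of the losses of the two rounds of a pair. -/
def pairLoss (j : ℕ) (c : Fin M) (a : Fin K) : ℝ := S.ℓ (2 * j) c a + S.ℓ (2 * j + 1) c a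

theorem pairLoss_nonneg (j : ℕ) (c : Fin M) (a : Fin K) : 0 ≤ S.pairLoss j c a :=
  add_nonneg (S.ℓ_mem _ _ _).1 (S.ℓ_mem _ _ _).1

theorem pairLoss_le_two (j : ℕ) (c : Fin M) (a : Fin K) : S.pairLoss j c a ≤ 2 := by
  have h1 := (S.ℓ_mem (2 * j) c a).2
  have h2 := (S.ℓ_mem (2 * j + 1) c a).2
  unfold pairLoss; linarith

/-- The ratio by which the loss estimates are biased. -/
noncomputable def bias (σ : State K M) (a : Fin K) : ℝ :=
  S.importance σ.sCur a / (σ.wCur a + 3 / 2 * S.γ)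

theorem pairExp_lossInc {j : ℕ} (hj : S.H ≤ j) (σ : State K M) (c : Fin M) (a : Fin K) :
    S.pairExp j σ (fun r => S.lossInc j σ r c a) = S.pairLoss j c a * S.bias σ a := by
  simp only [S.lossInc_eq_mul_hit hj]
  rw [S.pairExp_mul_hit j σ
    (fun i => 2 * S.ℓ (2 * j + (i : ℕ)) c a / (σ.wCur a + 3 / 2 * S.γ)) a]
  simp only [Fin.val_zero, Fin.val_one, add_zero, pairLoss, bias]
  ring

theorem pairExp_mono (j : ℕ) (σ : State K M) {f g : PairRecord K M → ℝ} (h : ∀ r, f r ≤ g r) :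
    S.pairExp j σ f ≤ S.pairExp j σ g := expect_mono _ h

/-- A bound on the second moment of the loss estimate given the state. -/
noncomputable def lossVar (σ : State K M) (a : Fin K) : ℝ :=
  4 * S.importance σ.sCur a / (σ.wCur a + 3 / 2 * S.γ) ^ 2

theorem pairExp_lossInc_sq_le (j : ℕ) (σ : State K M) (hw : ∀ a, 0 ≤ σ.wCur a) (c : Fin M)
    (a : Fin K) : S.pairExp j σ (fun r => S.lossInc j σ r c a ^ 2) ≤ S.lossVar σ a := by
  have h : ∀ r, S.lossInc j σ r c a ^ 2 ≤ 4 / (σ.wCur a + 3 / 2 * S.γ) ^ 2 * S.hit r a := by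
    intro r
    have h1 := pow_le_pow_left₀ (S.lossInc_nonneg j σ hw r c a) (S.lossInc_le j σ hw r c a) 2
    refine h1.trans (le_of_eq ?_)
    rcases S.hit_eq_zero_or_one r a with h0 | h0 <;> rw [h0]
    · ring
    · rw [mul_one, mul_one, div_pow]; norm_num
  refine (S.pairExp_mono j σ h).trans (le_of_eq ?_)
  have := S.pairExp_mul_hit j σ (fun _ => 4 / (σ.wCur a + 3 / 2 * S.γ) ^ 2) a
  rw [this, lossVar]
  ring

/-- The increments of the importance estimate and of the cumulative losses are independent. -/
theorem pairExp_freqInc_mul_lossInc (j : ℕ) (σ : State K M) (φ : (Fin K → ℝ) → ℝ)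
    (ψ : (Fin M → Fin K → ℝ) → ℝ) :
    S.pairExp j σ (fun r => φ (S.freqInc j σ r) * ψ (S.lossInc j σ r)) =
      S.pairExp j σ (fun r => φ (S.freqInc j σ r)) *
        S.pairExp j σ (fun r => ψ (S.lossInc j σ r)) := by
  classical
  rcases lt_or_ge j S.H with h | h
  · have : ∀ r, S.lossInc j σ r = 0 := fun r => by
      funext c a; rw [lossInc, if_pos h]; rfl
    simp only [this, pairExp, expect_mul_right, expect_const]
  · have hj : ¬ j < 2 * S.H / 2 := by
      rw [Nat.mul_div_cancel_left _ two_pos]; exact not_lt.2 h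
    set φ' : Fin M → ℝ := fun c' =>
      φ (fun a => inMass S.G (σ.sNext c') a / (2 * (((2 * S.H : ℕ) : ℝ) / 2))) with hφ'
    set ψ' : Fin 2 → Fin M → Fin K → (Fin K → Bool) → ℝ := fun i _ b A =>
      ψ (fun c a => if S.G.Adj b a ∧ A a = true then
        2 * S.ℓ (2 * j + i) c a / (σ.wCur a + 3 / 2 * S.γ) else 0) with hψ'
    have hφ : ∀ r : PairRecord K M, φ (S.freqInc j σ r) = φ' (r.ctx (1 - r.lossIdx)) := by
      intro r
      simp only [hφ']
      congr 1
      funext a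
      rw [freqInc, freqIncrement, if_neg hj]
    have hψ : ∀ r : PairRecord K M, ψ (S.lossInc j σ r) =
        ψ' r.lossIdx (r.ctx r.lossIdx) (r.arm r.lossIdx) r.accept := by
      intro r
      simp only [hψ']
      congr 1
      funext c a
      rw [lossInc, if_neg (not_lt.2 h), lossEstimate]
    simp only [hφ, hψ]
    rw [S.pairExp_eq_expect_lossExp j σ fun i c b A c' => φ' c' * ψ' i c b A,
      S.pairExp_eq_expect_lossExp j σ fun i c b A c' => ψ' i c b A, S.pairExp_freq]
    simp only [lossExp_mul_left, expect_mul_right, expect_const]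

theorem freqInc_nonneg (j : ℕ) (σ : State K M) (r : PairRecord K M) (a : Fin K) :
    0 ≤ S.freqInc j σ r a := by
  unfold freqInc freqIncrement
  split_ifs
  · exact Finset.sum_nonneg fun i _ => div_nonneg (S.inMass_nonneg _ _) (by positivity)
  · exact div_nonneg (S.inMass_nonneg _ _) (by positivity)

theorem freqInc_le (j : ℕ) (σ : State K M) (r : PairRecord K M) (a : Fin K) :
    S.freqInc j σ r a ≤ 1 / (2 * S.H) := by
  have hH := S.H_cast_pos
  unfold freqInc freqIncrement
  push_cast
  split_ifs
  · rw [Fin.sum_univ_two, ← add_div, div_le_div_iff₀ (by positivity) (by positivity)]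
    have h0 := S.inMass_le_one (σ.sNext (r.ctx 0)) a
    have h1 := S.inMass_le_one (σ.sNext (r.ctx 1)) a
    nlinarith
  · have h0 := S.inMass_le_one (σ.sNext (r.ctx (1 - r.lossIdx))) a
    rw [div_le_div_iff₀ (by positivity) (by positivity)]
    nlinarith

theorem pairExp_freqInc (j : ℕ) (σ : State K M) (a : Fin K) :
    S.pairExp j σ (fun r => S.freqInc j σ r a) = S.importance σ.sNext a / S.H := by
  have hH := S.H_cast_pos
  by_cases h : j < 2 * S.H / 2
  · simp only [freqInc, freqIncrement, if_pos h]
    rw [S.pairExp_ctx_arm j σ fun _ c _ => inMass S.G (σ.sNext c) a / (2 * ((2 * S.H : ℕ) : ℝ))]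
    have h1 : ∀ c, ∑ a, (S.play j σ c).1 a = 1 := fun c => (S.play j σ c).2.2
    simp only [← Finset.sum_mul, h1, one_mul, div_eq_mul_inv, expect_mul_right, importance,
      Fin.sum_univ_two]
    push_cast
    field_simp
    ring
  · simp only [freqInc, freqIncrement, if_neg h]
    rw [S.pairExp_freq j σ fun c =>
      inMass S.G (σ.sNext c) a / (2 * (((2 * S.H : ℕ) : ℝ) / 2))]
    simp only [div_eq_mul_inv, expect_mul_right, importance]
    push_cast
    field_simp

end Game

/-! ### The Markov chain of states -/

open scoped Classical in
/-- The real-valued indicator of a proposition. -/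
noncomputable def ind (p : Prop) : ℝ := if p then 1 else 0

theorem ind_nonneg (p : Prop) : 0 ≤ ind p := by unfold ind; split_ifs <;> norm_num

theorem ind_le_one (p : Prop) : ind p ≤ 1 := by unfold ind; split_ifs <;> norm_num

theorem ind_of {p : Prop} (h : p) : ind p = 1 := if_pos h

theorem ind_of_not {p : Prop} (h : ¬p) : ind p = 0 := if_neg h

theorem ind_mono {p q : Prop} (h : p → q) : ind p ≤ ind q := by
  by_cases hp : p
  · rw [ind_of hp, ind_of (h hp)]
  · rw [ind_of_not hp]; exact ind_nonneg q

theorem ind_exists_le {n : ℕ} (p : Fin n → Prop) : ind (∃ a, p a) ≤ ∑ a, ind (p a) := by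
  by_cases h : ∃ a, p a
  · obtain ⟨a, ha⟩ := h
    rw [ind_of ⟨a, ha⟩, ← ind_of ha]
    exact Finset.single_le_sum (f := fun a => ind (p a)) (fun b _ => ind_nonneg _)
      (Finset.mem_univ a)
  · rw [ind_of_not h]; exact Finset.sum_nonneg fun b _ => ind_nonneg _

namespace Game

variable {K M : ℕ} [NeZero K] (S : Game K M)

/-- The expectation of `f` after `m` further pairs of rounds, started in the state `σ` before the
`j`-th pair, when the state is updated by `T`. -/
noncomputable def chain (T : ℕ → State K M → PairRecord K M → State K M) :
    ℕ → ℕ → (State K M → ℝ) → State K M → ℝ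
  | _, 0, f, σ => f σ
  | j, m + 1, f, σ => S.pairExp j σ fun r => chain T (j + 1) m f (T j σ r)

section Chain

variable (T : ℕ → State K M → PairRecord K M → State K M)

theorem chain_zero (j : ℕ) (f : State K M → ℝ) (σ : State K M) : S.chain T j 0 f σ = f σ := rfl

theorem chain_succ (j m : ℕ) (f : State K M → ℝ) (σ : State K M) :
    S.chain T j (m + 1) f σ = S.pairExp j σ fun r => S.chain T (j + 1) m f (T j σ r) := rfl

theorem chain_add (j m m' : ℕ) (f : State K M → ℝ) (σ : State K M) :
    S.chain T j (m + m') f σ = S.chain T j m (fun τ => S.chain T (j + m) m' f τ) σ := by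
  induction m generalizing j σ with
  | zero => simp [chain_zero]
  | succ m ih =>
    rw [show m + 1 + m' = (m + m') + 1 by ring, chain_succ, chain_succ]
    congr 1
    funext r
    rw [ih, show j + 1 + m = j + (m + 1) by ring]

theorem chain_mono_of_invariant (I : ℕ → State K M → Prop)
    (hT : ∀ j σ r, I j σ → I (j + 1) (T j σ r)) (j m : ℕ) {f g : State K M → ℝ}
    (hfg : ∀ τ, I (j + m) τ → f τ ≤ g τ) (σ : State K M) (hσ : I j σ) :
    S.chain T j m f σ ≤ S.chain T j m g σ := by
  induction m generalizing j σ with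
  | zero => exact hfg σ hσ
  | succ m ih =>
    rw [chain_succ, chain_succ]
    refine S.pairExp_mono j σ fun r => ih (j + 1) (fun τ hτ => hfg τ ?_) _ (hT j σ r hσ)
    rwa [show j + (m + 1) = j + 1 + m by ring]

theorem chain_mono (j m : ℕ) {f g : State K M → ℝ} (hfg : ∀ τ, f τ ≤ g τ) (σ : State K M) :
    S.chain T j m f σ ≤ S.chain T j m g σ :=
  S.chain_mono_of_invariant T (fun _ _ => True) (fun _ _ _ _ => trivial) j m
    (fun τ _ => hfg τ) σ trivial

theorem chain_const (j m : ℕ) (x : ℝ) (σ : State K M) : S.chain T j m (fun _ => x) σ = x := by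
  induction m generalizing j σ with
  | zero => rfl
  | succ m ih => simp only [chain_succ, ih, pairExp_const]

theorem chain_add_fun (j m : ℕ) (f g : State K M → ℝ) (σ : State K M) :
    S.chain T j m (fun τ => f τ + g τ) σ = S.chain T j m f σ + S.chain T j m g σ := by
  induction m generalizing j σ with
  | zero => rfl
  | succ m ih => simp only [chain_succ, ih, pairExp, expect_add]

theorem chain_sub_fun (j m : ℕ) (f g : State K M → ℝ) (σ : State K M) :
    S.chain T j m (fun τ => f τ - g τ) σ = S.chain T j m f σ - S.chain T j m g σ := by
  induction m generalizing j σ with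
  | zero => rfl
  | succ m ih => simp only [chain_succ, ih, pairExp, expect_sub]

theorem chain_mul_left (j m : ℕ) (x : ℝ) (f : State K M → ℝ) (σ : State K M) :
    S.chain T j m (fun τ => x * f τ) σ = x * S.chain T j m f σ := by
  induction m generalizing j σ with
  | zero => rfl
  | succ m ih => simp only [chain_succ, ih, pairExp, expect_mul_left]

theorem chain_sum {κ : Type*} (s : Finset κ) (j m : ℕ) (f : κ → State K M → ℝ) (σ : State K M) :
    S.chain T j m (fun τ => ∑ i ∈ s, f i τ) σ = ∑ i ∈ s, S.chain T j m (f i) σ := by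
  induction m generalizing j σ with
  | zero => rfl
  | succ m ih => simp only [chain_succ, ih, pairExp, expect_sum]

theorem chain_expect (j m : ℕ) (f : Fin M → State K M → ℝ) (σ : State K M) :
    S.chain T j m (fun τ => expect S.ν fun c => f c τ) σ =
      expect S.ν fun c => S.chain T j m (f c) σ := by
  simp only [expect, chain_sum, chain_mul_left]

theorem chain_le_of_le (j m : ℕ) {f : State K M → ℝ} {x : ℝ} (h : ∀ τ, f τ ≤ x) (σ : State K M) :
    S.chain T j m f σ ≤ x :=
  (S.chain_mono T j m h σ).trans (S.chain_const T j m x σ).le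

theorem chain_nonneg (j m : ℕ) {f : State K M → ℝ} (h : ∀ τ, 0 ≤ f τ) (σ : State K M) :
    0 ≤ S.chain T j m f σ :=
  (S.chain_const T j m 0 σ).symm.le.trans (S.chain_mono T j m h σ)

theorem chain_ind_exists_le (j m : ℕ) (p : State K M → Fin K → Prop) (σ : State K M) {x : ℝ}
    (h : ∀ a, S.chain T j m (fun τ => ind (p τ a)) σ ≤ x) :
    S.chain T j m (fun τ => ind (∃ a, p τ a)) σ ≤ K * x := by
  refine (S.chain_mono T j m (fun τ => ind_exists_le (p τ)) σ).trans ?_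
  rw [chain_sum]
  refine (Finset.sum_le_sum fun a _ => h a).trans (le_of_eq ?_)
  simp

end Chain

/-- The update of the state by the algorithm. -/
noncomputable def next (j : ℕ) (σ : State K M) (r : PairRecord K M) : State K M :=
  step S.G (2 * S.H) S.γ S.η S.ℓ j σ r

/-- The update of the state within an epoch. -/
noncomputable def midStep (j : ℕ) (σ : State K M) (r : PairRecord K M) : State K M where
  cum := fun c a => σ.cum c a + S.lossInc j σ r c a
  sCur := σ.sCur
  sNext := σ.sNext
  wCur := σ.wCur
  wNext := fun a => σ.wNext a + S.freqInc j σ r a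

theorem next_eq (j : ℕ) (σ : State K M) (r : PairRecord K M) :
    S.next j σ r = if (j + 1) % S.H = 0 then
      { cum := (S.midStep j σ r).cum, sCur := σ.sNext, sNext := ftrlDist S.η σ,
        wCur := (S.midStep j σ r).wNext, wNext := fun _ => 0 }
      else S.midStep j σ r := by
  have h : (fun c a => if j < 2 * S.H / 2 then σ.cum c a
      else σ.cum c a + lossEstimate S.G S.γ S.ℓ j σ r c a) = (S.midStep j σ r).cum := by
    funext c a
    simp only [midStep, lossInc, Nat.mul_div_cancel_left _ two_pos]
    split_ifs <;> simp
  rw [next, step, h, Nat.mul_div_cancel_left _ two_pos]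
  rfl

theorem next_cum (j : ℕ) (σ : State K M) (r : PairRecord K M) :
    (S.next j σ r).cum = (S.midStep j σ r).cum := by
  rw [next_eq]; split_ifs <;> rfl

theorem next_eq_midStep {e k : ℕ} (hk : k + 1 < S.H) (σ : State K M) (r : PairRecord K M) :
    S.next (e * S.H + k) σ r = S.midStep (e * S.H + k) σ r := by
  rw [next_eq, if_neg]
  rw [add_assoc, Nat.mul_add_mod', Nat.mod_eq_of_lt hk]
  exact Nat.succ_ne_zero k

theorem next_eq_of_last {e k : ℕ} (hk : k + 1 = S.H) (σ : State K M) (r : PairRecord K M) :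
    S.next (e * S.H + k) σ r =
      { cum := (S.midStep (e * S.H + k) σ r).cum, sCur := σ.sNext, sNext := ftrlDist S.η σ,
        wCur := (S.midStep (e * S.H + k) σ r).wNext, wNext := fun _ => 0 } := by
  rw [next_eq, if_pos]
  rw [add_assoc, hk, Nat.mul_add_mod', Nat.mod_self]

theorem chain_next_eq_midStep (e k m : ℕ) (hkm : k + m < S.H) (f : State K M → ℝ)
    (σ : State K M) :
    S.chain S.next (e * S.H + k) m f σ = S.chain S.midStep (e * S.H + k) m f σ := by
  induction m generalizing k σ with
  | zero => rfl
  | succ m ih =>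
    rw [chain_succ, chain_succ]
    congr 1
    funext r
    rw [S.next_eq_midStep (by omega), add_assoc, ih (k + 1) (by omega)]

theorem chain_next_eq_of_last (e k m : ℕ) (hkm : k + (m + 1) = S.H)
    (F : (Fin M → Fin K → ℝ) → (Fin M → stdSimplex ℝ (Fin K)) → (Fin K → ℝ) → ℝ)
    (σ : State K M) :
    S.chain S.next (e * S.H + k) (m + 1) (fun τ => F τ.cum τ.sCur τ.wCur) σ =
      S.chain S.midStep (e * S.H + k) (m + 1) (fun τ => F τ.cum τ.sNext τ.wNext) σ := by
  induction m generalizing k σ with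
  | zero =>
    rw [chain_succ, chain_succ]
    congr 1
    funext r
    rw [S.next_eq_of_last (by omega)]
    rfl
  | succ m ih =>
    rw [chain_succ, chain_succ]
    congr 1
    funext r
    rw [S.next_eq_midStep (by omega), add_assoc, ih (k + 1) (by omega)]

/-- Over a whole epoch, the new snapshot and the new importance estimate are those accumulated
within the epoch. -/
theorem chain_next_epoch (e : ℕ)
    (F : (Fin M → Fin K → ℝ) → (Fin M → stdSimplex ℝ (Fin K)) → (Fin K → ℝ) → ℝ)
    (σ : State K M) :
    S.chain S.next (e * S.H) S.H (fun τ => F τ.cum τ.sCur τ.wCur) σ =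
      S.chain S.midStep (e * S.H) S.H (fun τ => F τ.cum σ.sNext τ.wNext) σ := by
  have h := S.chain_next_eq_of_last e 0 (S.H - 1) (by have := S.H_pos; omega) F σ
  rw [Nat.sub_add_cancel S.H_pos, add_zero] at h
  rw [h]
  apply le_antisymm <;>
  exact S.chain_mono_of_invariant S.midStep (fun _ τ => τ.sNext = σ.sNext)
    (fun _ _ _ h => h) _ _ (fun τ hτ => le_of_eq (by rw [hτ])) σ rfl

/-- Within an epoch the snapshot and the importance estimate in use are constant. -/
theorem chain_midStep_congr (j m : ℕ) (f g : State K M → ℝ) (σ : State K M)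
    (h : ∀ τ : State K M, τ.sCur = σ.sCur → τ.sNext = σ.sNext → τ.wCur = σ.wCur → f τ ≤ g τ) :
    S.chain S.midStep j m f σ ≤ S.chain S.midStep j m g σ :=
  S.chain_mono_of_invariant S.midStep
    (fun _ τ => τ.sCur = σ.sCur ∧ τ.sNext = σ.sNext ∧ τ.wCur = σ.wCur)
    (fun _ _ _ h => h) _ _ (fun τ hτ => h τ hτ.1 hτ.2.1 hτ.2.2) σ ⟨rfl, rfl, rfl⟩

/-! ### Moments and tails within an epoch -/

theorem chain_midStep_cum_eq (j m : ℕ) (g : (Fin M → Fin K → ℝ) → ℝ) (σ : State K M)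
    (w : Fin K → ℝ) :
    S.chain S.midStep j m (fun τ => g τ.cum) { σ with wNext := w } =
      S.chain S.midStep j m (fun τ => g τ.cum) σ := by
  induction m generalizing j σ w with
  | zero => rfl
  | succ m ih =>
    rw [chain_succ, chain_succ]
    change S.pairExp j σ _ = _
    congr 1
    funext r
    exact ih (j + 1) (S.midStep j σ r) fun a => w a + S.freqInc j σ r a

/-- The importance estimate accumulated in an epoch is unbiased and independent of the cumulative
losses. -/
theorem chain_midStep_cum_mul_wNext (j m : ℕ) (g : (Fin M → Fin K → ℝ) → ℝ) (σ : State K M)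
    (a : Fin K) :
    S.chain S.midStep j m (fun τ => g τ.cum * τ.wNext a) σ =
      S.chain S.midStep j m (fun τ => g τ.cum) σ *
        (σ.wNext a + m * (S.importance σ.sNext a / S.H)) := by
  induction m generalizing j σ with
  | zero => simp [chain_zero]
  | succ m ih =>
    rw [chain_succ, chain_succ]
    set ψ : (Fin M → Fin K → ℝ) → ℝ := fun x => S.chain S.midStep (j + 1) m (fun τ => g τ.cum)
      { σ with cum := fun c a => σ.cum c a + x c a } with hψ
    have h1 : ∀ r, S.chain S.midStep (j + 1) m (fun τ => g τ.cum) (S.midStep j σ r) =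
        ψ (S.lossInc j σ r) := fun r => by
      rw [← S.chain_midStep_cum_eq (j + 1) m g (S.midStep j σ r) σ.wNext]
      rfl
    have h2 : ∀ r, S.chain S.midStep (j + 1) m (fun τ => g τ.cum * τ.wNext a) (S.midStep j σ r) =
        ψ (S.lossInc j σ r) * (σ.wNext a + m * (S.importance σ.sNext a / S.H)) +
          S.freqInc j σ r a * ψ (S.lossInc j σ r) := fun r => by
      rw [ih (j + 1) (S.midStep j σ r), h1]
      change ψ (S.lossInc j σ r) * ((σ.wNext a + S.freqInc j σ r a) +
        m * (S.importance σ.sNext a / S.H)) = _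
      ring
    simp only [h1, h2]
    have h3 := S.pairExp_freqInc_mul_lossInc j σ (fun x => x a) ψ
    have h4 := S.pairExp_freqInc j σ a
    unfold pairExp at h3 h4 ⊢
    rw [expect_add, expect_mul_right, h3, h4]
    push_cast
    ring

theorem pairExp_add_sq (j : ℕ) (σ : State K M) (x : ℝ) (f : PairRecord K M → ℝ) :
    S.pairExp j σ (fun r => (x + f r) ^ 2) =
      (x + S.pairExp j σ f) ^ 2 - S.pairExp j σ f ^ 2 + S.pairExp j σ (fun r => f r ^ 2) := by
  have : ∀ r, (x + f r) ^ 2 = x ^ 2 + 2 * x * f r + f r ^ 2 := fun r => by ring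
  simp only [this, pairExp, expect_add, expect_const, expect_mul_left]
  ring

theorem chain_midStep_wNext_sub_sq_le (j m : ℕ) (σ : State K M) (a : Fin K) (b : ℝ) :
    S.chain S.midStep j m (fun τ => (τ.wNext a - b) ^ 2) σ ≤
      (σ.wNext a + m * (S.importance σ.sNext a / S.H) - b) ^ 2 +
        m * (S.importance σ.sNext a / S.H / (2 * S.H)) := by
  induction m generalizing j σ with
  | zero => simp [chain_zero]
  | succ m ih =>
    rw [chain_succ]
    set v := S.importance σ.sNext a / S.H with hv
    have h1 : ∀ r, S.chain S.midStep (j + 1) m (fun τ => (τ.wNext a - b) ^ 2) (S.midStep j σ r) ≤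
        ((σ.wNext a + m * v - b) + S.freqInc j σ r a) ^ 2 + m * (v / (2 * S.H)) := fun r => by
      refine (ih (j + 1) (S.midStep j σ r)).trans (le_of_eq ?_)
      change (σ.wNext a + S.freqInc j σ r a + m * v - b) ^ 2 + m * (v / (2 * S.H)) = _
      ring
    refine (S.pairExp_mono j σ h1).trans ?_
    have h2 : S.pairExp j σ (fun r => S.freqInc j σ r a ^ 2) ≤ v / (2 * S.H) := by
      have h3 : ∀ r, S.freqInc j σ r a ^ 2 ≤ 1 / (2 * S.H) * S.freqInc j σ r a := fun r => by
        rw [sq]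
        exact mul_le_mul_of_nonneg_right (S.freqInc_le j σ r a) (S.freqInc_nonneg j σ r a)
      refine (S.pairExp_mono j σ h3).trans (le_of_eq ?_)
      have h4 := S.pairExp_freqInc j σ a
      unfold pairExp at h4 ⊢
      rw [expect_mul_left, h4]
      ring
    have h5 := S.pairExp_add_sq j σ (σ.wNext a + m * v - b) (fun r => S.freqInc j σ r a)
    rw [S.pairExp_freqInc, ← hv] at h5
    have h6 : S.pairExp j σ (fun r => ((σ.wNext a + m * v - b) + S.freqInc j σ r a) ^ 2 +
        m * (v / (2 * S.H))) = S.pairExp j σ (fun r => ((σ.wNext a + m * v - b) +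
          S.freqInc j σ r a) ^ 2) + m * (v / (2 * S.H)) := by
      unfold pairExp
      rw [expect_add, expect_const]
    rw [h6, h5]
    push_cast
    nlinarith [sq_nonneg v]

/-- The expected increase of the cumulative loss over `m` pairs, up to the bias ratio. -/
def lossSum (j m : ℕ) (c : Fin M) (a : Fin K) : ℝ := ∑ i ∈ Finset.range m, S.pairLoss (j + i) c a

theorem lossSum_nonneg (j m : ℕ) (c : Fin M) (a : Fin K) : 0 ≤ S.lossSum j m c a :=
  Finset.sum_nonneg fun _ _ => S.pairLoss_nonneg _ _ _

theorem lossSum_le (j m : ℕ) (c : Fin M) (a : Fin K) : S.lossSum j m c a ≤ 2 * m := by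
  refine (Finset.sum_le_sum fun i _ => S.pairLoss_le_two (j + i) c a).trans (le_of_eq ?_)
  simp [mul_comm]

theorem chain_midStep_cum_sub_sq_le (j m : ℕ) (hj : S.H ≤ j) (σ : State K M)
    (hw : ∀ a, 0 ≤ σ.wCur a) (c : Fin M) (a : Fin K) (b : ℝ) :
    S.chain S.midStep j m (fun τ => (τ.cum c a - b) ^ 2) σ ≤
      (σ.cum c a + S.lossSum j m c a * S.bias σ a - b) ^ 2 + m * S.lossVar σ a := by
  induction m generalizing j σ with
  | zero => simp [chain_zero, lossSum]
  | succ m ih =>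
    rw [chain_succ]
    set x := σ.cum c a + S.lossSum (j + 1) m c a * S.bias σ a - b with hx
    have h1 : ∀ r, S.chain S.midStep (j + 1) m (fun τ => (τ.cum c a - b) ^ 2) (S.midStep j σ r) ≤
        (x + S.lossInc j σ r c a) ^ 2 + m * S.lossVar σ a := fun r => by
      refine (ih (j + 1) (by omega) (S.midStep j σ r) hw).trans (le_of_eq ?_)
      change (σ.cum c a + S.lossInc j σ r c a + S.lossSum (j + 1) m c a * S.bias σ a - b) ^ 2 +
        m * S.lossVar σ a = _
      rw [hx]
      ring
    refine (S.pairExp_mono j σ h1).trans ?_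
    have h5 := S.pairExp_add_sq j σ x (fun r => S.lossInc j σ r c a)
    rw [S.pairExp_lossInc hj] at h5
    have h6 : S.pairExp j σ (fun r => (x + S.lossInc j σ r c a) ^ 2 + m * S.lossVar σ a) =
        S.pairExp j σ (fun r => (x + S.lossInc j σ r c a) ^ 2) + m * S.lossVar σ a := by
      unfold pairExp
      rw [expect_add, expect_const]
    have h7 := S.pairExp_lossInc_sq_le j σ hw c a
    have h8 : S.lossSum j (m + 1) c a = S.pairLoss j c a + S.lossSum (j + 1) m c a := by
      rw [lossSum, lossSum, Finset.sum_range_succ', add_comm, add_zero]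
      congr 1
      exact Finset.sum_congr rfl fun i _ => by rw [show j + (i + 1) = j + 1 + i by ring]
    rw [h6, h5, h8]
    have h9 : σ.cum c a + (S.pairLoss j c a + S.lossSum (j + 1) m c a) * S.bias σ a - b =
        x + S.pairLoss j c a * S.bias σ a := by rw [hx]; ring
    rw [h9]
    push_cast
    nlinarith [sq_nonneg (S.pairLoss j c a * S.bias σ a)]

/-- The Laplace transform of the importance estimate, for its lower tail. -/
theorem chain_midStep_exp_wNext_le (j m : ℕ) (σ : State K M) (a : Fin K) {θ : ℝ} :
    S.chain S.midStep j m (fun τ => Real.exp (-(θ * (2 * S.H * τ.wNext a)))) σ ≤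
      Real.exp (-(θ * (2 * S.H * σ.wNext a)) -
        m * (2 * S.importance σ.sNext a * (1 - Real.exp (-θ)))) := by
  have hH := S.H_cast_pos
  induction m generalizing j σ with
  | zero => simp [chain_zero]
  | succ m ih =>
    rw [chain_succ]
    set v := S.importance σ.sNext a with hv
    set x := Real.exp (-(θ * (2 * S.H * σ.wNext a)) - m * (2 * v * (1 - Real.exp (-θ)))) with hx
    have h1 : ∀ r, S.chain S.midStep (j + 1) m
        (fun τ => Real.exp (-(θ * (2 * S.H * τ.wNext a)))) (S.midStep j σ r) ≤
        x * (1 + (-(2 * S.H * (1 - Real.exp (-θ)))) * S.freqInc j σ r a) := fun r => by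
      refine (ih (j + 1) (S.midStep j σ r)).trans ?_
      change Real.exp (-(θ * (2 * S.H * (σ.wNext a + S.freqInc j σ r a))) -
        m * (2 * v * (1 - Real.exp (-θ)))) ≤ _
      set y := 2 * S.H * S.freqInc j σ r a with hy
      have hy0 : 0 ≤ y := mul_nonneg (by positivity) (S.freqInc_nonneg j σ r a)
      have hy1 : y ≤ 1 := by
        have := mul_le_mul_of_nonneg_left (S.freqInc_le j σ r a) (by positivity : 0 ≤ 2 * (S.H : ℝ))
        rwa [mul_one_div_cancel (by positivity)] at this
      have hconv := convexOn_exp.2 (Set.mem_univ 0) (Set.mem_univ (-θ))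
        (by linarith : 0 ≤ 1 - y) hy0 (by ring)
      simp only [smul_eq_mul, mul_zero, zero_add, Real.exp_zero, mul_one] at hconv
      have h2 : Real.exp (-(θ * (2 * S.H * (σ.wNext a + S.freqInc j σ r a))) -
          m * (2 * v * (1 - Real.exp (-θ)))) = x * Real.exp (y * -θ) := by
        rw [hx, ← Real.exp_add]; congr 1; rw [hy]; ring
      rw [h2]
      refine mul_le_mul_of_nonneg_left (hconv.trans (le_of_eq ?_)) (Real.exp_pos _).le
      rw [hy]; ring
    refine (S.pairExp_mono j σ h1).trans ?_
    have h4 := S.pairExp_freqInc j σ a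
    unfold pairExp at h4 ⊢
    rw [expect_mul_left, expect_add, expect_const, expect_mul_left, h4, ← hv]
    have h5 : 1 + -(2 * S.H * (1 - Real.exp (-θ))) * (v / S.H) =
        -(2 * v * (1 - Real.exp (-θ))) + 1 := by field_simp; ring
    rw [h5]
    refine (mul_le_mul_of_nonneg_left (Real.add_one_le_exp _) (Real.exp_pos _).le).trans
      (le_of_eq ?_)
    rw [← Real.exp_add]
    congr 1
    push_cast
    ring

/-- The importance estimate `w` is not much smaller than the importance of the snapshot `s`. -/
def Accurate (s : Fin M → stdSimplex ℝ (Fin K)) (w : Fin K → ℝ) : Prop :=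
  ∀ a, 7 / 8 * (S.importance s a + S.γ) ≤ w a + 3 / 2 * S.γ

theorem chain_midStep_not_accurate_le (j : ℕ) (σ : State K M) (hσ : ∀ a, σ.wNext a = 0) :
    S.chain S.midStep j S.H (fun τ => ind (¬S.Accurate σ.sNext τ.wNext)) σ ≤
      K * Real.exp (-S.ι) := by
  have hH := S.H_cast_pos
  have h1 : ∀ τ : State K M, ¬S.Accurate σ.sNext τ.wNext ↔
      ∃ a, ¬(7 / 8 * (S.importance σ.sNext a + S.γ) ≤ τ.wNext a + 3 / 2 * S.γ) := fun τ => by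
    rw [Accurate, not_forall]
  simp only [h1]
  refine S.chain_ind_exists_le _ _ _ _ σ fun a => ?_
  set v := S.importance σ.sNext a with hv
  have hv0 : 0 ≤ v := S.importance_nonneg _ _
  -- the threshold is `θ = 7 v / 8 - 5 γ / 8`, and the Laplace transform is taken at `1 / 4`
  have h2 : ∀ τ : State K M, ind (¬(7 / 8 * (v + S.γ) ≤ τ.wNext a + 3 / 2 * S.γ)) ≤
      Real.exp (1 / 4 * (2 * S.H * (7 / 8 * v - 5 / 8 * S.γ))) *
        Real.exp (-(1 / 4 * (2 * S.H * τ.wNext a))) := fun τ => by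
    by_cases h : 7 / 8 * (v + S.γ) ≤ τ.wNext a + 3 / 2 * S.γ
    · rw [ind_of_not (not_not.2 h)]; positivity
    · rw [ind_of h, ← Real.exp_add, Real.one_le_exp_iff]
      have : τ.wNext a ≤ 7 / 8 * v - 5 / 8 * S.γ := by linarith
      nlinarith
  refine (S.chain_mono _ _ _ h2 σ).trans ?_
  rw [chain_mul_left]
  refine (mul_le_mul_of_nonneg_left (S.chain_midStep_exp_wNext_le j S.H σ a)
    (Real.exp_pos _).le).trans ?_
  rw [← Real.exp_add, Real.exp_le_exp, hσ, ← hv]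
  have h3 : 7 / 32 ≤ 1 - Real.exp (-(1 / 4)) := by
    have h := Real.quadratic_le_exp_of_nonneg (by norm_num : (0 : ℝ) ≤ 1 / 4)
    rw [Real.exp_neg]
    have h' : (Real.exp (1 / 4))⁻¹ ≤ (1 + 1 / 4 + (1 / 4) ^ 2 / 2)⁻¹ :=
      inv_anti₀ (by norm_num) h
    norm_num at h' ⊢
    linarith
  have h4 := S.γ_mul
  have h5 := S.one_le_ι
  have h6 : 0 ≤ S.H * v := by positivity
  have h7 := mul_le_mul_of_nonneg_left h3 h6
  nlinarith

/-- The Laplace transform bound for the upper tail of the loss estimates of one arm, uniformly in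
the contexts: all of them grow by at most `2 / (ŵ + 3γ/2)` at each hit. -/
theorem chain_midStep_exceeds_le (j m : ℕ) (σ : State K M) (hw : ∀ a, 0 ≤ σ.wCur a) (a : Fin K)
    (b : Fin M → ℝ) (n X : ℝ) {θ : ℝ} (hθ : 0 ≤ θ)
    (hb : ∀ c, σ.cum c a ≤ b c + 2 / (σ.wCur a + 3 / 2 * S.γ) * n) :
    S.chain S.midStep j m
        (fun τ => ind (∃ c, b c + 2 / (σ.wCur a + 3 / 2 * S.γ) * X < τ.cum c a)) σ ≤
      Real.exp (θ * (n - X) + m * (S.importance σ.sCur a * (Real.exp θ - 1))) := by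
  have hB : 0 < 2 / (σ.wCur a + 3 / 2 * S.γ) :=
    div_pos two_pos (by have := hw a; have := S.γ_pos; positivity)
  induction m generalizing j σ n with
  | zero =>
    rw [chain_zero]
    by_cases h : ∃ c, b c + 2 / (σ.wCur a + 3 / 2 * S.γ) * X < σ.cum c a
    · rw [ind_of h, Real.one_le_exp_iff]
      obtain ⟨c, hc⟩ := h
      have h1 := lt_of_mul_lt_mul_left (lt_of_add_lt_add_left (hc.trans_le (hb c))) hB.le
      simp only [Nat.cast_zero, zero_mul, add_zero]
      exact mul_nonneg hθ (by linarith)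
    · rw [ind_of_not h]; positivity
  | succ m ih =>
    rw [chain_succ]
    set v := S.importance σ.sCur a with hv
    set x := Real.exp (θ * (n - X) + m * (v * (Real.exp θ - 1))) with hx
    have h1 : ∀ r, S.chain S.midStep (j + 1) m
        (fun τ => ind (∃ c, b c + 2 / (σ.wCur a + 3 / 2 * S.γ) * X < τ.cum c a))
        (S.midStep j σ r) ≤ x * (1 + (Real.exp θ - 1) * S.hit r a) := fun r => by
      refine (ih (j + 1) (S.midStep j σ r) hw (n + S.hit r a) (fun c => ?_) hB).trans
        (le_of_eq ?_)
      · change σ.cum c a + S.lossInc j σ r c a ≤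
          b c + 2 / (σ.wCur a + 3 / 2 * S.γ) * (n + S.hit r a)
        have h2 := S.lossInc_le j σ hw r c a
        have h3 := hb c
        linarith
      · change Real.exp (θ * (n + S.hit r a - X) + m * (v * (Real.exp θ - 1))) = _
        rcases S.hit_eq_zero_or_one r a with h | h <;> rw [h]
        · rw [hx]; simp
        · rw [hx, show (1 : ℝ) + (Real.exp θ - 1) * 1 = Real.exp θ by ring, ← Real.exp_add]
          congr 1; ring
    refine (S.pairExp_mono j σ h1).trans ?_
    have h4 := S.pairExp_hit j σ a
    unfold pairExp at h4 ⊢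
    rw [expect_mul_left, expect_add, expect_const, expect_mul_left, h4, ← hv,
      add_comm (1 : ℝ)]
    refine (mul_le_mul_of_nonneg_left (Real.add_one_le_exp _) (Real.exp_pos _).le).trans
      (le_of_eq ?_)
    rw [← Real.exp_add]
    congr 1
    push_cast
    ring

/-- The loss estimates grow little from `Λ` to `Λ'`, compared to `1 / η`. -/
def SlowGrowth (Λ Λ' : Fin M → Fin K → ℝ) : Prop :=
  ∀ c a, S.η * (Λ' c a - Λ c a) ≤ 8 / 25

theorem chain_midStep_not_slowGrowth_le (j m : ℕ) (hm : m ≤ S.H) (σ : State K M)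
    (hw : ∀ a, 0 ≤ σ.wCur a) (hacc : S.Accurate σ.sCur σ.wCur) :
    S.chain S.midStep j m (fun τ => ind (¬S.SlowGrowth σ.cum τ.cum)) σ ≤
      K * Real.exp (-S.ι) := by
  have hH := S.H_cast_pos
  have hη := S.η_pos
  have h1 : ∀ τ : State K M, ¬S.SlowGrowth σ.cum τ.cum ↔
      ∃ a c, 8 / 25 < S.η * (τ.cum c a - σ.cum c a) := fun τ => by
    simp only [SlowGrowth, not_forall, not_le]
    exact exists_comm
  simp only [h1]
  refine S.chain_ind_exists_le _ _ _ _ σ fun a => ?_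
  set v := S.importance σ.sCur a with hv
  have hv0 : 0 ≤ v := S.importance_nonneg _ _
  set B := 2 / (σ.wCur a + 3 / 2 * S.γ) with hB
  have hden : 0 < σ.wCur a + 3 / 2 * S.γ := by
    have := hw a; have := S.γ_pos; positivity
  -- `X` hits are needed for the losses to grow by `8 / (25 η)`
  set X : ℝ := 8 / 25 / (S.η * B) with hX
  have hBpos : 0 < B := by positivity
  have hBX : B * X = 8 / 25 / S.η := by rw [hX]; field_simp
  have hXlow : 231 / 200 * (S.H * (v + S.γ)) ≤ X := by
    rw [hX, hB, le_div_iff₀ (by positivity)]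
    have h2 := hacc a
    rw [← hv] at h2
    have h3 : S.η * S.H = 4 / 33 := by linarith [S.η_mul]
    calc 231 / 200 * (S.H * (v + S.γ)) * (S.η * (2 / (σ.wCur a + 3 / 2 * S.γ)))
        = 231 / 100 * (S.η * S.H) * ((v + S.γ) / (σ.wCur a + 3 / 2 * S.γ)) := by ring
      _ ≤ 231 / 100 * (4 / 33) * (8 / 7) := by
        rw [h3]
        refine mul_le_mul_of_nonneg_left ?_ (by norm_num)
        rw [div_le_iff₀ hden]; linarith
      _ ≤ 8 / 25 := by norm_num
  have h2 : ∀ τ : State K M, ind (∃ c, 8 / 25 < S.η * (τ.cum c a - σ.cum c a)) ≤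
      ind (∃ c, σ.cum c a + B * X < τ.cum c a) := fun τ => by
    refine ind_mono fun ⟨c, hc⟩ => ⟨c, ?_⟩
    rw [hBX]
    have : 8 / 25 / S.η < τ.cum c a - σ.cum c a := by
      rw [div_lt_iff₀ hη]; linarith
    linarith
  refine (S.chain_mono _ _ _ h2 σ).trans ?_
  refine (S.chain_midStep_exceeds_le j m σ hw a (fun c => σ.cum c a) 0 X
    (by norm_num : (0 : ℝ) ≤ 1 / 4) (fun c => by simp)).trans ?_
  rw [Real.exp_le_exp, ← hv]
  have h3 : Real.exp (1 / 4) - 1 ≤ 231 / 800 := by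
    have h := Real.exp_bound' (x := 1 / 4) (by norm_num) (by norm_num) (n := 3) (by norm_num)
    norm_num [Finset.sum_range_succ, Nat.factorial] at h ⊢
    linarith
  have h4 := S.γ_mul
  have h5 := S.one_le_ι
  have h6 : (m : ℝ) ≤ S.H := by exact_mod_cast hm
  have h7 : (m : ℝ) * (v * (Real.exp (1 / 4) - 1)) ≤ S.H * (v * (231 / 800)) := by
    have : 0 ≤ Real.exp (1 / 4) - 1 := by
      have := Real.add_one_le_exp (1 / 4 : ℝ); linarith
    gcongr
  nlinarith

end Game

namespace Game

variable {K M : ℕ} [NeZero K] (S : Game K M)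

/-! ### The good event -/

/-- Expectation over the state before the `j`-th pair of rounds. -/
noncomputable def mean (j : ℕ) (f : State K M → ℝ) : ℝ := S.chain S.next 0 j f (initState K M)

/-- What holds surely before the `j`-th pair of rounds. At the start of an epoch the next snapshot
was computed from the cumulative losses `Λ` one pair of rounds earlier. -/
structure Reachable (j : ℕ) (σ : State K M) : Prop where
  wCur_nonneg : ∀ a, 0 ≤ σ.wCur a
  wCur_le : ∀ a, σ.wCur a ≤ 1 / 2
  wNext_nonneg : ∀ a, 0 ≤ σ.wNext a
  wNext_le : ∀ a, σ.wNext a ≤ (j % S.H : ℕ) * (1 / (2 * S.H))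
  snapshot : j % S.H = 0 → ∃ Λ : Fin M → Fin K → ℝ, (∀ c, σ.sNext c = expWeights S.η (Λ c)) ∧
    ∀ c a, Λ c a ≤ σ.cum c a ∧ σ.cum c a ≤ Λ c a + 4 / (3 * S.γ)
  cum_eq_zero : j ≤ S.H → σ.cum = 0

theorem reachable_initState : S.Reachable 0 (initState K M) := by
  have hγ := S.γ_pos
  refine ⟨fun _ => le_rfl, fun _ => by simp [initState], fun _ => le_rfl,
    fun _ => by simp [initState], fun _ => ⟨0, fun c => ?_, fun c a => ⟨le_rfl, ?_⟩⟩, fun _ => rfl⟩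
  · exact expWeights_zero.symm
  · simp only [initState, Pi.zero_apply]
    positivity

theorem Reachable.next {j : ℕ} {σ : State K M} (h : S.Reachable j σ) (r : PairRecord K M) :
    S.Reachable (j + 1) (S.next j σ r) := by
  have hH := S.H_cast_pos
  have hγ := S.γ_pos
  have hcum : ∀ c a, (S.midStep j σ r).cum c a = σ.cum c a + S.lossInc j σ r c a := fun _ _ => rfl
  have hwn : ∀ a, (S.midStep j σ r).wNext a = σ.wNext a + S.freqInc j σ r a := fun _ => rfl
  have hwn0 : ∀ a, 0 ≤ (S.midStep j σ r).wNext a := fun a =>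
    add_nonneg (h.wNext_nonneg a) (S.freqInc_nonneg j σ r a)
  have hwn1 : ∀ a, (S.midStep j σ r).wNext a ≤ ((j % S.H : ℕ) + 1) * (1 / (2 * S.H)) := fun a => by
    rw [hwn, add_mul, one_mul]
    exact add_le_add (h.wNext_le a) (S.freqInc_le j σ r a)
  have hzero : j + 1 ≤ S.H → (S.midStep j σ r).cum = 0 := fun hj => by
    funext c a
    rw [hcum, h.cum_eq_zero (by omega), lossInc, if_pos (by omega)]
    simp
  rw [next_eq]
  split_ifs with hmod
  · refine ⟨hwn0, fun a => (hwn1 a).trans ?_, fun _ => le_rfl, fun _ => ?_,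
      fun _ => ⟨σ.cum, fun c => ftrl_eq_expWeights S.η_pos _, fun c a => ⟨?_, ?_⟩⟩, hzero⟩
    · have h1 : ((j % S.H : ℕ) : ℝ) + 1 ≤ S.H := by exact_mod_cast Nat.mod_lt j S.H_pos
      calc (((j % S.H : ℕ) : ℝ) + 1) * (1 / (2 * S.H)) ≤ S.H * (1 / (2 * S.H)) := by gcongr
        _ = 1 / 2 := by field_simp
    · positivity
    · rw [hcum]; linarith [S.lossInc_nonneg j σ h.wCur_nonneg r c a]
    · rw [hcum]
      have h1 := S.lossInc_le j σ h.wCur_nonneg r c a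
      have h2 : 2 / (σ.wCur a + 3 / 2 * S.γ) * S.hit r a ≤ 2 / (3 / 2 * S.γ) * 1 := by
        have := h.wCur_nonneg a
        have h3 := S.hit_le_one r a
        have h4 := S.hit_nonneg r a
        gcongr
        linarith
      have h3 : 2 / (3 / 2 * S.γ) * 1 = 4 / (3 * S.γ) := by field_simp; norm_num
      linarith
  · refine ⟨h.wCur_nonneg, h.wCur_le, hwn0, fun a => (hwn1 a).trans (le_of_eq ?_),
      fun h' => absurd h' hmod, hzero⟩
    have h1 : (j + 1) % S.H = j % S.H + 1 := by
      have h2 := Nat.mod_lt j S.H_pos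
      have h3 : j % S.H + 1 ≠ S.H := fun h4 => hmod (by
        rw [Nat.add_mod_eq_add_mod_right 1 (Nat.mod_mod j S.H).symm, h4, Nat.mod_self])
      rw [Nat.add_mod_eq_add_mod_right 1 (Nat.mod_mod j S.H).symm, Nat.mod_eq_of_lt (by omega)]
    rw [h1]
    push_cast
    ring

theorem mean_mono (j : ℕ) {f g : State K M → ℝ} (h : ∀ σ, S.Reachable j σ → f σ ≤ g σ) :
    S.mean j f ≤ S.mean j g :=
  S.chain_mono_of_invariant S.next S.Reachable (fun _ _ r h => h.next S r) 0 j
    (fun τ hτ => h τ (by rwa [zero_add] at hτ)) _ S.reachable_initState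

theorem mean_const (j : ℕ) (x : ℝ) : S.mean j (fun _ => x) = x := S.chain_const _ _ _ _ _

theorem mean_add (j : ℕ) (f g : State K M → ℝ) :
    S.mean j (fun σ => f σ + g σ) = S.mean j f + S.mean j g := S.chain_add_fun _ _ _ _ _ _

theorem mean_sub (j : ℕ) (f g : State K M → ℝ) :
    S.mean j (fun σ => f σ - g σ) = S.mean j f - S.mean j g := S.chain_sub_fun _ _ _ _ _ _

theorem mean_mul_left (j : ℕ) (x : ℝ) (f : State K M → ℝ) :
    S.mean j (fun σ => x * f σ) = x * S.mean j f := S.chain_mul_left _ _ _ _ _ _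

theorem mean_expect (j : ℕ) (f : Fin M → State K M → ℝ) :
    S.mean j (fun σ => expect S.ν fun c => f c σ) = expect S.ν fun c => S.mean j (f c) :=
  S.chain_expect _ _ _ _ _

theorem mean_succ (j : ℕ) (f : State K M → ℝ) :
    S.mean (j + 1) f = S.mean j fun σ => S.pairExp j σ fun r => f (S.next j σ r) := by
  rw [mean, chain_add, zero_add]
  rfl

/-- The law of a quantity at the start of an epoch, in terms of the state one epoch earlier. -/
theorem mean_epoch (d : ℕ)
    (F : (Fin M → Fin K → ℝ) → (Fin M → stdSimplex ℝ (Fin K)) → (Fin K → ℝ) → ℝ) :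
    S.mean ((d + 1) * S.H) (fun τ => F τ.cum τ.sCur τ.wCur) = S.mean (d * S.H) fun σ =>
      S.chain S.midStep (d * S.H) S.H (fun τ => F τ.cum σ.sNext τ.wNext) σ := by
  rw [mean, show (d + 1) * S.H = d * S.H + S.H by ring, chain_add, zero_add]
  simp only [chain_next_epoch]
  rfl

theorem mean_within_epoch (e m : ℕ) (hm : m < S.H) (f : State K M → ℝ) :
    S.mean (e * S.H + m) f =
      S.mean (e * S.H) fun σ => S.chain S.midStep (e * S.H) m f σ := by
  rw [mean, chain_add, zero_add]
  refine congrArg (S.mean (e * S.H)) (funext fun σ => ?_)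
  exact S.chain_next_eq_midStep e 0 m (by omega) f σ

theorem Reachable.wNext_eq_zero {d : ℕ} {σ : State K M} (h : S.Reachable (d * S.H) σ) (a : Fin K) :
    σ.wNext a = 0 := by
  refine le_antisymm ?_ (h.wNext_nonneg a)
  have := h.wNext_le a
  simpa using this

/-- The probability bound `exp (-ι)` for the deviations of a single arm, times the number of
arms. -/
noncomputable def failure : ℝ := K * Real.exp (-S.ι)

theorem failure_nonneg : 0 ≤ S.failure := by unfold failure; positivity

theorem mean_not_accurate_le (d : ℕ) :
    S.mean ((d + 1) * S.H) (fun σ => ind (¬S.Accurate σ.sCur σ.wCur)) ≤ S.failure := by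
  rw [S.mean_epoch d fun _ s w => ind (¬S.Accurate s w)]
  refine (S.mean_mono _ fun σ hσ => ?_).trans (S.mean_const (d * S.H) S.failure).le
  exact S.chain_midStep_not_accurate_le (d * S.H) σ fun a => hσ.wNext_eq_zero S a

/-- In the first epoch the cumulative losses do not move, so that no accuracy is needed there. -/
theorem chain_midStep_not_slowGrowth_le_add (e m : ℕ) (hm : m ≤ S.H) (σ : State K M)
    (hw : ∀ a, 0 ≤ σ.wCur a) :
    S.chain S.midStep (e * S.H) m (fun τ => ind (¬S.SlowGrowth σ.cum τ.cum)) σ ≤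
      ind (¬(e = 0 ∨ S.Accurate σ.sCur σ.wCur)) + S.failure := by
  by_cases h : e = 0 ∨ S.Accurate σ.sCur σ.wCur
  · rw [ind_of_not (not_not.2 h), zero_add]
    rcases h with rfl | h
    · refine le_trans ?_ S.failure_nonneg
      refine (S.chain_mono_of_invariant S.midStep
        (fun j τ => j ≤ S.H → τ.cum = σ.cum) (fun j τ r hτ hj => ?_) _ _ (g := fun _ => 0)
        (fun τ hτ => ?_) σ fun _ => rfl).trans (S.chain_const _ _ _ _ _).le
      · funext c a
        change τ.cum c a + S.lossInc j τ r c a = σ.cum c a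
        rw [hτ (by omega), lossInc, if_pos (by omega), add_zero]
      · refine (ind_of_not (not_not.2 fun c a => ?_)).le
        rw [hτ (by omega)]
        norm_num
    · exact S.chain_midStep_not_slowGrowth_le _ m hm σ hw h
  · rw [ind_of h]
    have := S.chain_le_of_le S.midStep (e * S.H) m
      (fun τ => ind_le_one (¬S.SlowGrowth σ.cum τ.cum)) σ
    linarith [S.failure_nonneg]

theorem mean_not_slowGrowth_le (e m : ℕ) (hm : m ≤ S.H) :
    S.mean (e * S.H) (fun σ => S.chain S.midStep (e * S.H) m
      (fun τ => ind (¬S.SlowGrowth σ.cum τ.cum)) σ) ≤ 2 * S.failure := by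
  refine (S.mean_mono _ fun σ hσ =>
    S.chain_midStep_not_slowGrowth_le_add e m hm σ hσ.wCur_nonneg).trans ?_
  rw [mean_add, mean_const]
  have : S.mean (e * S.H) (fun σ => ind (¬(e = 0 ∨ S.Accurate σ.sCur σ.wCur))) ≤ S.failure := by
    cases e with
    | zero =>
      refine (S.mean_mono _ fun σ _ => (ind_of_not ?_).le).trans
        ((S.mean_const _ 0).trans_le S.failure_nonneg)
      simp
    | succ d => simpa using S.mean_not_accurate_le d
  linarith

/-- The snapshot `s` comes from cumulative losses slightly smaller than the present ones. -/
def SnapshotNear (Λ : Fin M → Fin K → ℝ) (s : Fin M → stdSimplex ℝ (Fin K)) : Prop :=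
  ∃ Λ₀ : Fin M → Fin K → ℝ, (∀ c, s c = expWeights S.η (Λ₀ c)) ∧
    ∀ c a, 0 ≤ S.η * (Λ c a - Λ₀ c a) ∧ S.η * (Λ c a - Λ₀ c a) ≤ 8 / 25 + 1 / 20

theorem chain_midStep_mono_of_cum_le (j m : ℕ) (f g : State K M → ℝ) (σ : State K M)
    (hw : ∀ a, 0 ≤ σ.wCur a)
    (h : ∀ τ : State K M, τ.sCur = σ.sCur → τ.sNext = σ.sNext → τ.wCur = σ.wCur →
      (∀ c a, σ.cum c a ≤ τ.cum c a) → f τ ≤ g τ) :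
    S.chain S.midStep j m f σ ≤ S.chain S.midStep j m g σ := by
  refine S.chain_mono_of_invariant S.midStep
    (fun _ τ => τ.sCur = σ.sCur ∧ τ.sNext = σ.sNext ∧ τ.wCur = σ.wCur ∧
      ∀ c a, σ.cum c a ≤ τ.cum c a)
    (fun j τ r hτ => ⟨hτ.1, hτ.2.1, hτ.2.2.1, fun c a => ?_⟩) _ _
    (fun τ hτ => h τ hτ.1 hτ.2.1 hτ.2.2.1 hτ.2.2.2) σ ⟨rfl, rfl, rfl, fun _ _ => le_rfl⟩
  change _ ≤ τ.cum c a + S.lossInc j τ r c a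
  linarith [hτ.2.2.2 c a, S.lossInc_nonneg j τ (by rw [hτ.2.2.1]; exact hw) r c a]

theorem η_mul_four_div_le : S.η * (4 / (3 * S.γ)) ≤ 1 / 20 := by
  have hγ := S.γ_pos
  have hH := S.H_cast_pos
  have h1 := S.γ_mul
  have h2 := S.η_mul
  have h3 := S.one_le_ι
  rw [← mul_div_assoc, div_le_iff₀ (by positivity)]
  have h4 : S.η * 4 * (2 * S.H) ≤ 1 / 20 * (3 * S.γ) * (2 * S.H) := by nlinarith
  exact le_of_mul_le_mul_right h4 (by positivity)

theorem mean_not_snapshotNear_le (d : ℕ) :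
    S.mean ((d + 1) * S.H) (fun σ => ind (¬S.SnapshotNear σ.cum σ.sCur)) ≤ 2 * S.failure := by
  rw [S.mean_epoch d fun Λ s _ => ind (¬S.SnapshotNear Λ s)]
  refine (S.mean_mono _ fun σ hσ => ?_).trans (S.mean_not_slowGrowth_le d S.H le_rfl)
  refine S.chain_midStep_mono_of_cum_le _ _ _ _ σ hσ.wCur_nonneg fun τ _ _ _ hle =>
    ind_mono fun h hslow => h ?_
  obtain ⟨Λ, hΛ, hb⟩ := hσ.snapshot (Nat.mul_mod_left _ _)
  have hη := S.η_pos
  refine ⟨Λ, hΛ, fun c a => ⟨mul_nonneg hη.le (by linarith [hle c a, (hb c a).1]), ?_⟩⟩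
  have h1 := hslow c a
  have h2 : S.η * (σ.cum c a - Λ c a) ≤ 1 / 20 :=
    (mul_le_mul_of_nonneg_left (by linarith [(hb c a).2]) hη.le).trans S.η_mul_four_div_le
  have h3 : S.η * (τ.cum c a - Λ c a) =
    S.η * (τ.cum c a - σ.cum c a) + S.η * (σ.cum c a - Λ c a) := by ring
  linarith

/-- The good event: the importance estimate in use is accurate, and the FTRL distribution is within
a factor of two of the snapshot. -/
def Good (σ : State K M) : Prop :=
  S.Accurate σ.sCur σ.wCur ∧ ∀ c a, (σ.sCur c).1 a / 2 ≤ (expWeights S.η (σ.cum c)).1 a ∧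
    (expWeights S.η (σ.cum c)).1 a ≤ 2 * (σ.sCur c).1 a

theorem mean_not_good_le (d m : ℕ) (hm : m < S.H) :
    S.mean ((d + 1) * S.H + m) (fun σ => ind (¬S.Good σ)) ≤ 5 * S.failure := by
  rw [S.mean_within_epoch (d + 1) m hm]
  have h : ∀ σ, S.Reachable ((d + 1) * S.H) σ →
      S.chain S.midStep ((d + 1) * S.H) m (fun τ => ind (¬S.Good τ)) σ ≤
      ind (¬S.Accurate σ.sCur σ.wCur) + ind (¬S.SnapshotNear σ.cum σ.sCur) +
        S.chain S.midStep ((d + 1) * S.H) m (fun τ => ind (¬S.SlowGrowth σ.cum τ.cum)) σ := by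
    intro σ hσ
    rw [← S.chain_const S.midStep ((d + 1) * S.H) m
      (ind (¬S.Accurate σ.sCur σ.wCur) + ind (¬S.SnapshotNear σ.cum σ.sCur)) σ, ← chain_add_fun]
    refine S.chain_midStep_mono_of_cum_le _ _ _ _ σ hσ.wCur_nonneg fun τ hs _ hw hle => ?_
    have i1 := ind_nonneg (¬S.Accurate σ.sCur σ.wCur)
    have i2 := ind_nonneg (¬S.SnapshotNear σ.cum σ.sCur)
    have i3 := ind_nonneg (¬S.SlowGrowth σ.cum τ.cum)
    have i4 := ind_le_one (¬S.Good τ)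
    by_cases h1 : S.Accurate σ.sCur σ.wCur
    swap
    · rw [ind_of h1] at i1 ⊢; linarith
    by_cases h2 : S.SnapshotNear σ.cum σ.sCur
    swap
    · rw [ind_of h2] at i2 ⊢; linarith
    by_cases h3 : S.SlowGrowth σ.cum τ.cum
    swap
    · rw [ind_of h3] at i3 ⊢; linarith
    have hgood : S.Good τ := by
      refine ⟨by rw [hs, hw]; exact h1, fun c => ?_⟩
      obtain ⟨Λ, hΛ, hb⟩ := h2
      rw [hs, hΛ c]
      have hη := S.η_pos
      refine fun a => expWeights_half_le_and_le_two (fun b => ?_) (fun b => ?_) a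
      · have h5 := mul_le_mul_of_nonneg_left (hle c b) hη.le
        have h6 := (hb c b).1
        rw [mul_sub] at h6 ⊢
        linarith
      · have h5 := h3 c b
        have h6 := (hb c b).2
        have h7 := Real.log_two_gt_d9
        rw [mul_sub] at h5 h6 ⊢
        norm_num at h5 h6 h7 ⊢
        linarith
    rw [ind_of_not (not_not.2 hgood)]
    linarith
  refine (S.mean_mono _ h).trans ?_
  rw [mean_add, mean_add]
  have h1 := S.mean_not_accurate_le d
  have h2 := S.mean_not_snapshotNear_le d
  have h3 := S.mean_not_slowGrowth_le (d + 1) m hm.le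
  linarith

end Game

/-! ### Bias of the loss estimates -/

section Scalars

variable {w v g : ℝ}

theorem one_sub_div_le_first_order (hw : 0 ≤ w) (hv : 0 ≤ v) (hg : 0 < g) :
    1 - w / (v + 3 / 2 * g) ≤ 3 / 2 * g / (w + 3 / 2 * g) +
      w / (w + 3 / 2 * g) * ((v - w) / (w + 3 / 2 * g)) := by
  have hy : 0 < w + 3 / 2 * g := by positivity
  have hv' : 0 < v + 3 / 2 * g := by positivity
  have h : 3 / 2 * g / (w + 3 / 2 * g) + w / (w + 3 / 2 * g) * ((v - w) / (w + 3 / 2 * g)) -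
      (1 - w / (v + 3 / 2 * g)) = w * (v - w) ^ 2 / ((w + 3 / 2 * g) ^ 2 * (v + 3 / 2 * g)) := by
    field_simp
    ring
  have : 0 ≤ w * (v - w) ^ 2 / ((w + 3 / 2 * g) ^ 2 * (v + 3 / 2 * g)) := by positivity
  linarith

theorem div_sub_one_le_second_order (hw : 0 ≤ w) (hv : 0 ≤ v) (hg : 0 < g)
    (h : 7 / 8 * (w + g) ≤ v + 3 / 2 * g) :
    w / (v + 3 / 2 * g) - 1 ≤ -(3 / 2 * g / (w + 3 / 2 * g)) -
      w / (w + 3 / 2 * g) ^ 2 * (v - w) + 8 / 7 / (w + 3 / 2 * g) ^ 2 * (v - w) ^ 2 := by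
  have hy : 0 < w + 3 / 2 * g := by positivity
  have hv' : 0 < v + 3 / 2 * g := by positivity
  have h1 : w / (v + 3 / 2 * g) ≤ 8 / 7 := by
    rw [div_le_iff₀ hv']; linarith
  have h2 : w / (v + 3 / 2 * g) - 1 = -(3 / 2 * g / (w + 3 / 2 * g)) -
      w / (w + 3 / 2 * g) ^ 2 * (v - w) +
        w / (v + 3 / 2 * g) * ((v - w) ^ 2 / (w + 3 / 2 * g) ^ 2) := by
    field_simp
    ring
  have h3 := mul_le_mul_of_nonneg_right h1
    (by positivity : 0 ≤ (v - w) ^ 2 / (w + 3 / 2 * g) ^ 2)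
  have h4 : 8 / 7 / (w + 3 / 2 * g) ^ 2 * (v - w) ^ 2 =
    8 / 7 * ((v - w) ^ 2 / (w + 3 / 2 * g) ^ 2) := by ring
  linarith

theorem neg_two_le_second_order (hw : 0 ≤ w) (hg : 0 < g) :
    -2 ≤ -(3 / 2 * g / (w + 3 / 2 * g)) -
      w / (w + 3 / 2 * g) ^ 2 * (v - w) + 8 / 7 / (w + 3 / 2 * g) ^ 2 * (v - w) ^ 2 := by
  have hy : 0 < w + 3 / 2 * g := by positivity
  set t := (v - w) / (w + 3 / 2 * g) with ht
  set q := w / (w + 3 / 2 * g) with hq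
  have hq0 : 0 ≤ q := by positivity
  have hq1 : q ≤ 1 := by rw [hq, div_le_one hy]; linarith
  have h1 : 3 / 2 * g / (w + 3 / 2 * g) = 1 - q := by rw [hq]; field_simp; ring
  have h2 : w / (w + 3 / 2 * g) ^ 2 * (v - w) = q * t := by rw [hq, ht]; field_simp
  have h3 : 8 / 7 / (w + 3 / 2 * g) ^ 2 * (v - w) ^ 2 = 8 / 7 * t ^ 2 := by rw [ht]; field_simp
  rw [h1, h2, h3]
  nlinarith [sq_nonneg (t - q / 2), mul_nonneg hq0 (sub_nonneg.2 hq1)]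

end Scalars

namespace Game

variable {K M : ℕ} [NeZero K] (S : Game K M)

/-- The bound `4α log (1 + 1 / (4αγ))` on `∑_a 𝔼_c s_c(a) / (w(a) + γ)`. -/
noncomputable def capacity : ℝ :=
  4 * independenceNumber S.G * Real.log (1 + 1 / (4 * independenceNumber S.G * S.γ))

theorem expect_sum_div_importance_le (s : Fin M → stdSimplex ℝ (Fin K)) :
    expect S.ν (fun c => ∑ a, (s c).1 a * (1 / (S.importance s a + S.γ))) ≤ S.capacity := by
  classical
  have hγ := S.γ_pos
  set p : Fin K → ℝ := fun a => expect S.ν fun c => (s c).1 a with hp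
  have hp0 : ∀ a, 0 ≤ p a := fun a => expect_nonneg _ fun c => (s c).2.1 a
  have hp1 : ∑ a, p a = 1 := by
    rw [hp, ← expect_sum]
    simp only [(s _).2.2, expect_const]
  have himp : ∀ a, S.importance s a = (∑ b with S.G.Adj b a, p b) / 2 := fun a => by
    rw [importance]
    simp only [inMass, expect_sum, hp]
  have hα : (1 : ℝ) ≤ independenceNumber S.G := by exact_mod_cast one_le_independenceNumber S.G
  have h := sum_div_inMass_le_log S.G S.refl p hp0 (g := 2 * S.γ) (by positivity) Finset.univ
  rw [hp1] at h
  simp only [expect_sum, expect_mul_right]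
  have hterm : ∀ a, p a * (1 / (S.importance s a + S.γ)) =
      2 * (p a / ((∑ b with S.G.Adj b a, p b) + 2 * S.γ)) := fun a => by
    have h0 : 0 ≤ ∑ b with S.G.Adj b a, p b := Finset.sum_nonneg fun b _ => hp0 b
    rw [himp]
    field_simp
  change ∑ a, p a * (1 / (S.importance s a + S.γ)) ≤ _
  rw [Finset.sum_congr rfl fun a _ => hterm a, ← Finset.mul_sum]
  have hlog : (1 + 2 * (independenceNumber S.G : ℝ) * (2 * S.γ)) /
      (2 * independenceNumber S.G * (2 * S.γ)) =
      1 + 1 / (4 * independenceNumber S.G * S.γ) := by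
    field_simp
    ring
  rw [hlog] at h
  unfold capacity
  exact (mul_le_mul_of_nonneg_left h zero_le_two).trans (le_of_eq (by ring))

theorem capacity_nonneg : 0 ≤ S.capacity := by
  have hγ := S.γ_pos
  unfold capacity
  have : 0 ≤ Real.log (1 + 1 / (4 * independenceNumber S.G * S.γ)) :=
    Real.log_nonneg (by
      have : (0 : ℝ) ≤ 1 / (4 * independenceNumber S.G * S.γ) := by positivity
      linarith)
  positivity

/-- The loss of the comparator is overestimated on average by a negligible amount: the margin
`3γ/2` in the denominator outweighs the variance of `ŵ`. -/
theorem mean_bias_sub_one_le (d m : ℕ) (hm : m < S.H) (a : Fin K) :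
    S.mean ((d + 1) * S.H + m) (fun σ => S.bias σ a - 1) ≤ (1 / S.γ + 2) * S.failure := by
  have hγ := S.γ_pos
  have hH := S.H_cast_pos
  rw [S.mean_within_epoch (d + 1) m hm]
  have h0 : ∀ σ, S.Reachable ((d + 1) * S.H) σ →
      S.chain S.midStep ((d + 1) * S.H) m (fun τ => S.bias τ a - 1) σ ≤ S.bias σ a - 1 := by
    intro σ _
    refine (S.chain_midStep_congr _ m _ (fun _ => S.bias σ a - 1) σ fun τ h1 _ h3 => ?_).trans
      (S.chain_const _ _ _ _ _).le
    rw [bias, bias, h1, h3]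
  refine (S.mean_mono _ h0).trans ?_
  unfold bias
  rw [S.mean_epoch d fun _ s w => S.importance s a / (w a + 3 / 2 * S.γ) - 1]
  refine (S.mean_mono _ fun σ hσ => ?_).trans (S.mean_const (d * S.H) _).le
  set w := S.importance σ.sNext a with hw
  have hw0 : 0 ≤ w := S.importance_nonneg _ _
  have hw1 : w ≤ 1 / 2 := S.importance_le_half _ _
  set y := w + 3 / 2 * S.γ with hy
  have hy0 : 0 < y := by positivity
  have h1 : S.chain S.midStep (d * S.H) S.H
      (fun τ => w / (τ.wNext a + 3 / 2 * S.γ) - 1) σ ≤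
      S.chain S.midStep (d * S.H) S.H (fun τ => (-(3 / 2 * S.γ / y) -
        w / y ^ 2 * (τ.wNext a - w) + 8 / 7 / y ^ 2 * (τ.wNext a - w) ^ 2) +
          (1 / S.γ + 2) * ind (¬S.Accurate σ.sNext τ.wNext)) σ := by
    refine S.chain_mono_of_invariant S.midStep (fun _ τ => 0 ≤ τ.wNext a)
      (fun j τ r hτ => add_nonneg hτ (S.freqInc_nonneg j τ r a)) _ _ (fun τ hτ => ?_) σ
      (hσ.wNext_nonneg a)
    by_cases hacc : S.Accurate σ.sNext τ.wNext
    · rw [ind_of_not (not_not.2 hacc), mul_zero, add_zero]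
      exact div_sub_one_le_second_order hw0 hτ hγ (hacc a)
    · rw [ind_of hacc, mul_one]
      have h2 : w / (τ.wNext a + 3 / 2 * S.γ) ≤ 1 / S.γ := by
        rw [div_le_div_iff₀ (by positivity) hγ]
        nlinarith
      have h3 := neg_two_le_second_order (v := τ.wNext a) hw0 hγ
      linarith
  refine h1.trans ?_
  rw [chain_add_fun, chain_add_fun, chain_sub_fun, chain_const, chain_mul_left, chain_mul_left,
    chain_mul_left, chain_sub_fun, chain_const]
  have h2 := S.chain_midStep_cum_mul_wNext (d * S.H) S.H (fun _ => 1) σ a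
  simp only [one_mul, chain_const] at h2
  have h3 := S.chain_midStep_wNext_sub_sq_le (d * S.H) S.H σ a w
  rw [hσ.wNext_eq_zero S a, zero_add, ← hw, mul_div_cancel₀ _ hH.ne'] at h2 h3
  have h4 := S.chain_midStep_not_accurate_le (d * S.H) σ fun a => hσ.wNext_eq_zero S a
  rw [h2, sub_self, mul_zero, sub_zero]
  have h5 : 8 / 7 / y ^ 2 * S.chain S.midStep (d * S.H) S.H (fun τ => (τ.wNext a - w) ^ 2) σ ≤
      3 / 2 * S.γ / y := by
    have h6 : S.chain S.midStep (d * S.H) S.H (fun τ => (τ.wNext a - w) ^ 2) σ ≤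
        w / (2 * S.H) := by
      refine h3.trans (le_of_eq ?_)
      field_simp
      ring
    refine (mul_le_mul_of_nonneg_left h6 (by positivity)).trans ?_
    have h7 : 8 / 7 / y ^ 2 * (w / (2 * S.H)) = 8 / 7 * w / (y * (2 * S.H)) / y := by
      field_simp
    rw [h7]
    refine div_le_div_of_nonneg_right ?_ hy0.le
    rw [div_le_iff₀ (by positivity)]
    have h8 := S.γ_mul
    have h9 := S.one_le_ι
    have h10 : 3 / 2 * S.γ * (y * (2 * S.H)) = 3 / 2 * (S.γ * (2 * S.H)) * y := by ring
    rw [h10, h8]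
    nlinarith
  have h11 := mul_le_mul_of_nonneg_left h4 (by positivity : 0 ≤ 1 / S.γ + 2)
  unfold failure
  linarith

theorem play_eq_of_good {j : ℕ} (hj : S.H ≤ j) {σ : State K M} (h : S.Good σ) (c : Fin M) :
    S.play j σ c = expWeights S.η (σ.cum c) := by
  rw [play, playDist, if_pos]
  · exact ftrl_eq_expWeights S.η_pos _
  · refine ⟨by rwa [Nat.mul_div_cancel_left _ two_pos], fun a => ?_⟩
    rw [ftrlDist, ftrl_eq_expWeights S.η_pos]
    exact (h.2 c a).1

/-- The part of the bias due to the margin in the denominator. -/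
noncomputable def shift (s : Fin M → stdSimplex ℝ (Fin K)) (a : Fin K) : ℝ :=
  3 / 2 * S.γ / (S.importance s a + 3 / 2 * S.γ)

/-- The part of the bias that is linear in the error of the importance estimate `w`. -/
noncomputable def drift (s : Fin M → stdSimplex ℝ (Fin K)) (w : Fin K → ℝ) (a : Fin K) : ℝ :=
  S.importance s a / (S.importance s a + 3 / 2 * S.γ) *
    ((w a - S.importance s a) / (S.importance s a + 3 / 2 * S.γ))

theorem one_sub_bias_le (σ : State K M) (hw : ∀ a, 0 ≤ σ.wCur a) (a : Fin K) :
    1 - S.bias σ a ≤ S.shift σ.sCur a + S.drift σ.sCur σ.wCur a :=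
  one_sub_div_le_first_order (S.importance_nonneg _ _) (hw a) S.γ_pos

theorem shift_nonneg (s : Fin M → stdSimplex ℝ (Fin K)) (a : Fin K) : 0 ≤ S.shift s a := by
  have h1 := S.importance_nonneg s a
  have h2 := S.γ_pos
  unfold shift; positivity

theorem shift_le_one (s : Fin M → stdSimplex ℝ (Fin K)) (a : Fin K) : S.shift s a ≤ 1 := by
  have h1 := S.importance_nonneg s a
  have h2 := S.γ_pos
  unfold shift
  rw [div_le_one (by positivity)]
  linarith

theorem shift_le (s : Fin M → stdSimplex ℝ (Fin K)) (a : Fin K) :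
    S.shift s a ≤ 3 / 2 * S.γ * (1 / (S.importance s a + S.γ)) := by
  have h1 := S.importance_nonneg s a
  have h2 := S.γ_pos
  unfold shift
  rw [← mul_div_assoc, mul_one]
  gcongr
  linarith

theorem abs_drift_le (s : Fin M → stdSimplex ℝ (Fin K)) (w : Fin K → ℝ) (a : Fin K) :
    |S.drift s w a| ≤ |w a - S.importance s a| / (S.importance s a + 3 / 2 * S.γ) := by
  have h1 := S.importance_nonneg s a
  have h2 := S.γ_pos
  have hy : 0 < S.importance s a + 3 / 2 * S.γ := by positivity
  unfold drift
  rw [abs_mul, abs_div, abs_div, abs_of_nonneg h1, abs_of_pos hy]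
  refine mul_le_of_le_one_left (by positivity) ?_
  rw [div_le_one hy]
  linarith

theorem sum_expWeights_mul_le {Λ : Fin K → ℝ} {f : Fin K → ℝ} {x : ℝ} (h : ∀ a, f a ≤ x) :
    ∑ a, (expWeights S.η Λ).1 a * f a ≤ x := by
  calc ∑ a, (expWeights S.η Λ).1 a * f a ≤ ∑ a, (expWeights S.η Λ).1 a * x :=
        Finset.sum_le_sum fun a _ => mul_le_mul_of_nonneg_left (h a) (expWeights_nonneg _ _)
    _ = x := by rw [← Finset.sum_mul, expWeights_sum, one_mul]

/-- Sums against the FTRL distribution are controlled by those against the snapshot. -/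
theorem mean_expect_expWeights_le (d m : ℕ) (hm : m < S.H)
    (f : State K M → Fin M → Fin K → ℝ) {x y : ℝ} (hx : 0 ≤ x) (hy : 0 ≤ y)
    (hf : ∀ σ, S.Reachable ((d + 1) * S.H + m) σ → ∀ c a, f σ c a ≤ y)
    (hfg : ∀ σ, S.Reachable ((d + 1) * S.H + m) σ → S.Good σ → ∀ c a, 0 ≤ f σ c a ∧
      f σ c a ≤ x * (1 / (S.importance σ.sCur a + S.γ))) :
    S.mean ((d + 1) * S.H + m) (fun σ => expect S.ν fun c =>
      ∑ a, (expWeights S.η (σ.cum c)).1 a * f σ c a) ≤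
      2 * x * S.capacity + 5 * y * S.failure := by
  have h : ∀ σ, S.Reachable ((d + 1) * S.H + m) σ → (expect S.ν fun c =>
      ∑ a, (expWeights S.η (σ.cum c)).1 a * f σ c a) ≤
      2 * x * S.capacity + y * ind (¬S.Good σ) := by
    intro σ hσ
    by_cases hg : S.Good σ
    · rw [ind_of_not (not_not.2 hg), mul_zero, add_zero]
      calc (expect S.ν fun c => ∑ a, (expWeights S.η (σ.cum c)).1 a * f σ c a)
          ≤ expect S.ν fun c => 2 * x *
            ∑ a, (σ.sCur c).1 a * (1 / (S.importance σ.sCur a + S.γ)) := by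
            refine expect_mono _ fun c => ?_
            rw [Finset.mul_sum]
            refine Finset.sum_le_sum fun a _ => ?_
            obtain ⟨h1, h2⟩ := hfg σ hσ hg c a
            calc (expWeights S.η (σ.cum c)).1 a * f σ c a
                ≤ (2 * (σ.sCur c).1 a) * (x * (1 / (S.importance σ.sCur a + S.γ))) :=
                  mul_le_mul (hg.2 c a).2 h2 h1 (mul_nonneg zero_le_two ((σ.sCur c).2.1 a))
              _ = _ := by ring
        _ ≤ _ := by
            rw [expect_mul_left]
            exact mul_le_mul_of_nonneg_left (S.expect_sum_div_importance_le _) (by positivity)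
    · rw [ind_of hg, mul_one]
      have h1 : (expect S.ν fun c => ∑ a, (expWeights S.η (σ.cum c)).1 a * f σ c a) ≤ y :=
        expect_le_of_le _ fun c => S.sum_expWeights_mul_le (hf σ hσ c)
      have := S.capacity_nonneg
      have : 0 ≤ 2 * x * S.capacity := by positivity
      linarith
  refine (S.mean_mono _ h).trans ?_
  rw [mean_add, mean_const, mean_mul_left]
  have := mul_le_mul_of_nonneg_left (S.mean_not_good_le d m hm) hy
  linarith

theorem mean_shift_le (d m : ℕ) (hm : m < S.H) (u : Fin M → Fin K → ℝ) (hu0 : ∀ c a, 0 ≤ u c a)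
    (hu : ∀ c a, u c a ≤ 2) :
    S.mean ((d + 1) * S.H + m) (fun σ => expect S.ν fun c =>
      ∑ a, (expWeights S.η (σ.cum c)).1 a * (u c a * S.shift σ.sCur a)) ≤
      6 * S.γ * S.capacity + 10 * S.failure := by
  have hγ := S.γ_pos
  refine (S.mean_expect_expWeights_le d m hm (fun σ c a => u c a * S.shift σ.sCur a)
    (x := 3 * S.γ) (y := 2) (by positivity) zero_le_two (fun σ _ c a => ?_)
    (fun σ _ _ c a => ⟨mul_nonneg (hu0 c a) (S.shift_nonneg _ _), ?_⟩)).trans (le_of_eq (by ring))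
  · calc u c a * S.shift σ.sCur a ≤ 2 * 1 :=
        mul_le_mul (hu c a) (S.shift_le_one _ _) (S.shift_nonneg _ _) zero_le_two
      _ = 2 := by norm_num
  · calc u c a * S.shift σ.sCur a ≤ 2 * (3 / 2 * S.γ * (1 / (S.importance σ.sCur a + S.γ))) :=
        mul_le_mul (hu c a) (S.shift_le _ _) (S.shift_nonneg _ _) zero_le_two
      _ = _ := by ring

theorem mean_lossVar_le (d m : ℕ) (hm : m < S.H) :
    S.mean ((d + 1) * S.H + m) (fun σ => expect S.ν fun c =>
      ∑ a, (expWeights S.η (σ.cum c)).1 a * S.lossVar σ a) ≤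
      16 * S.capacity + 5 / S.γ ^ 2 * S.failure := by
  have hγ := S.γ_pos
  refine (S.mean_expect_expWeights_le d m hm (fun σ _ a => S.lossVar σ a)
    (x := 8) (y := 1 / S.γ ^ 2) (by norm_num) (by positivity) (fun σ hσ c a => ?_)
    (fun σ hσ hg c a => ?_)).trans (le_of_eq (by ring))
  · have h1 := S.importance_nonneg σ.sCur a
    have h2 := S.importance_le_half σ.sCur a
    have h3 := hσ.wCur_nonneg a
    unfold lossVar
    rw [div_le_div_iff₀ (by positivity) (by positivity), one_mul]
    nlinarith [mul_nonneg h3 hγ.le, sq_nonneg (σ.wCur a)]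
  · have h1 := S.importance_nonneg σ.sCur a
    have h3 := hσ.wCur_nonneg a
    have h4 := hg.1 a
    have h5 : 0 < S.importance σ.sCur a + S.γ := by positivity
    unfold lossVar
    refine ⟨by positivity, ?_⟩
    rw [← mul_div_assoc, mul_one, div_le_div_iff₀ (by positivity) h5]
    have h6 : (7 / 8 * (S.importance σ.sCur a + S.γ)) ^ 2 ≤ (σ.wCur a + 3 / 2 * S.γ) ^ 2 :=
      pow_le_pow_left₀ (by positivity) h4 2
    nlinarith

end Game

/-! ### The first-order bias -/

/-- The products `d κ` of the perturbation of the weights with the test function `v` are of second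
order. -/
theorem sum_expWeights_mul_le_add_sq {K : ℕ} [NeZero K] {η : ℝ} {Λ Λ' d κ v s : Fin K → ℝ}
    (hd : ∀ a, |η * (Λ' a - Λ a)| = d a) (hd1 : ∀ a, d a ≤ 8 / 25)
    (hs : ∀ a, (expWeights η Λ').1 a ≤ 2 * s a) (hv : ∀ a, |v a| ≤ 2 * κ a) :
    ∑ a, (expWeights η Λ').1 a * v a ≤
      ∑ a, (expWeights η Λ).1 a * v a + 32 * ∑ a, s a * (d a ^ 2 + κ a ^ 2) := by
  set p := (expWeights η Λ).1 with hp
  have hp0 : ∀ b, 0 ≤ p b := (expWeights η Λ).2.1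
  have hp1 : ∑ b, p b = 1 := (expWeights η Λ).2.2
  have hκ : ∀ a, 0 ≤ κ a := fun a => by have := (abs_nonneg (v a)).trans (hv a); linarith
  have hd0 : ∀ a, 0 ≤ d a := fun a => (hd a) ▸ abs_nonneg _
  set D := ∑ b, p b * d b with hD
  have hD0 : 0 ≤ D := Finset.sum_nonneg fun b _ => mul_nonneg (hp0 b) (hd0 b)
  have hD2 : D ^ 2 ≤ ∑ b, p b * d b ^ 2 := by
    have h := Finset.sum_sq_le_sum_mul_sum_of_sq_le_mul Finset.univ (r := fun b => p b * d b)
      (f := p) (g := fun b => p b * d b ^ 2) (fun b _ => hp0 b)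
      (fun b _ => mul_nonneg (hp0 b) (sq_nonneg _)) (fun b _ => le_of_eq (by ring))
    rwa [hp1, one_mul] at h
  have h1 : ∀ a, (expWeights η Λ').1 a * v a ≤
      p a * v a + 8 * (p a * (d a ^ 2 / 2 + κ a ^ 2 + D ^ 2 / 2)) := fun a => by
    have h2 := (abs_expWeights_sub_le hd hd1 a).1
    rw [← hp, ← hD] at h2
    have h3 : ((expWeights η Λ').1 a - p a) * v a ≤ 4 * p a * (d a + D) * (2 * κ a) := by
      refine (le_abs_self _).trans ?_
      rw [abs_mul]
      exact mul_le_mul h2 (hv a) (abs_nonneg _)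
        (mul_nonneg (mul_nonneg (by norm_num) (hp0 a)) (add_nonneg (hd0 a) hD0))
    have h4 : (d a + D) * κ a ≤ d a ^ 2 / 2 + κ a ^ 2 + D ^ 2 / 2 := by
      nlinarith [sq_nonneg (d a - κ a), sq_nonneg (D - κ a)]
    have h5 := mul_le_mul_of_nonneg_left h4 (hp0 a)
    nlinarith
  have h6 : ∑ a, p a * (d a ^ 2 / 2 + κ a ^ 2 + D ^ 2 / 2) ≤
      ∑ a, p a * (d a ^ 2 + κ a ^ 2) := by
    have e1 : ∑ a, p a * (d a ^ 2 / 2 + κ a ^ 2 + D ^ 2 / 2) =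
        (∑ a, p a * d a ^ 2) / 2 + ∑ a, p a * κ a ^ 2 + D ^ 2 / 2 := by
      have h0 : ∀ a, p a * (d a ^ 2 / 2 + κ a ^ 2 + D ^ 2 / 2) =
          p a * d a ^ 2 * (1 / 2) + p a * κ a ^ 2 + p a * (D ^ 2 / 2) := fun a => by ring
      rw [Finset.sum_congr rfl fun a _ => h0 a, Finset.sum_add_distrib, Finset.sum_add_distrib,
        ← Finset.sum_mul, ← Finset.sum_mul, hp1]
      ring
    have e2 : ∑ a, p a * (d a ^ 2 + κ a ^ 2) = ∑ a, p a * d a ^ 2 + ∑ a, p a * κ a ^ 2 := by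
      rw [← Finset.sum_add_distrib]
      exact Finset.sum_congr rfl fun a _ => by ring
    rw [e1, e2]
    linarith
  have h7 : ∑ a, p a * (d a ^ 2 + κ a ^ 2) ≤ 4 * ∑ a, s a * (d a ^ 2 + κ a ^ 2) := by
    rw [Finset.mul_sum]
    refine Finset.sum_le_sum fun a _ => ?_
    have h8 : p a ≤ 4 * s a := by
      have := (abs_expWeights_sub_le hd hd1 a).2
      rw [← hp] at this
      linarith [hs a]
    calc p a * (d a ^ 2 + κ a ^ 2) ≤ 4 * s a * (d a ^ 2 + κ a ^ 2) :=
          mul_le_mul_of_nonneg_right h8 (by positivity)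
      _ = _ := by ring
  calc ∑ a, (expWeights η Λ').1 a * v a
      ≤ ∑ a, (p a * v a + 8 * (p a * (d a ^ 2 / 2 + κ a ^ 2 + D ^ 2 / 2))) :=
        Finset.sum_le_sum fun a _ => h1 a
    _ = ∑ a, p a * v a + 8 * ∑ a, p a * (d a ^ 2 / 2 + κ a ^ 2 + D ^ 2 / 2) := by
        rw [Finset.sum_add_distrib, Finset.mul_sum]
    _ ≤ _ := by linarith

namespace Game

variable {K M : ℕ} [NeZero K] (S : Game K M)

/-- The cumulative losses that are expected `m` pairs after the `j`-th one if the loss estimates are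
unbiased. They do not depend on the importance estimate of the current epoch. -/
def predicted (j m : ℕ) (Λ : Fin M → Fin K → ℝ) (c : Fin M) (a : Fin K) : ℝ :=
  Λ c a + S.lossSum j m c a

/-- Against the predicted distribution the first-order bias vanishes on average. -/
theorem mean_predicted_drift_eq_zero (d j m : ℕ) (u : Fin M → Fin K → ℝ) :
    S.mean ((d + 1) * S.H) (fun σ => expect S.ν fun c =>
      ∑ a, (expWeights S.η (S.predicted j m σ.cum c)).1 a *
        (u c a * S.drift σ.sCur σ.wCur a)) = 0 := by
  have hH := S.H_cast_pos
  rw [S.mean_epoch d fun Λ s w => expect S.ν fun c =>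
      ∑ a, (expWeights S.η (S.predicted j m Λ c)).1 a * (u c a * S.drift s w a)]
  have h : ∀ σ, S.Reachable (d * S.H) σ → S.chain S.midStep (d * S.H) S.H (fun τ =>
      expect S.ν fun c => ∑ a, (expWeights S.η (S.predicted j m τ.cum c)).1 a *
        (u c a * S.drift σ.sNext τ.wNext a)) σ = 0 := by
    intro σ hσ
    simp only [chain_expect, chain_sum]
    have h0 : ∀ c a, S.chain S.midStep (d * S.H) S.H (fun τ =>
        (expWeights S.η (S.predicted j m τ.cum c)).1 a * (u c a * S.drift σ.sNext τ.wNext a)) σ =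
        0 := by
      intro c a
      set w := S.importance σ.sNext a with hw
      set y := w + 3 / 2 * S.γ with hy
      set g : (Fin M → Fin K → ℝ) → ℝ := fun Λ => (expWeights S.η (S.predicted j m Λ c)).1 a
      have h1 : ∀ τ : State K M, g τ.cum * (u c a * S.drift σ.sNext τ.wNext a) =
          (u c a * (w / y) / y) * (g τ.cum * τ.wNext a) -
            (u c a * (w / y) / y * w) * g τ.cum := fun τ => by
        rw [drift, ← hw, ← hy]; ring
      have h2 := S.chain_midStep_cum_mul_wNext (d * S.H) S.H g σ a
      rw [hσ.wNext_eq_zero S a, zero_add, ← hw, mul_div_cancel₀ _ hH.ne'] at h2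
      change S.chain S.midStep (d * S.H) S.H (fun τ =>
        g τ.cum * (u c a * S.drift σ.sNext τ.wNext a)) σ = 0
      simp only [h1]
      rw [chain_sub_fun, chain_mul_left, chain_mul_left, h2]
      ring
    simp only [h0, Finset.sum_const_zero, expect_const]
  apply le_antisymm
  · exact (S.mean_mono _ fun σ hσ => (h σ hσ).le).trans (S.mean_const _ 0).le
  · exact (S.mean_const _ 0).symm.le.trans (S.mean_mono _ fun σ hσ => (h σ hσ).symm.le)

/-- The squared relative error of the importance estimate, plus a variance term. -/
noncomputable def sqError (s : Fin M → stdSimplex ℝ (Fin K)) (w : Fin K → ℝ) (a : Fin K) : ℝ :=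
  2 / (S.importance s a + S.γ) ^ 2 * (w a - S.importance s a) ^ 2 +
    S.γ * (1 / (S.importance s a + S.γ))

theorem mean_sqError_le (d : ℕ) :
    S.mean ((d + 1) * S.H) (fun σ => expect S.ν fun c =>
      ∑ a, (σ.sCur c).1 a * S.sqError σ.sCur σ.wCur a) ≤ 9 / 8 * S.γ * S.capacity := by
  have hH := S.H_cast_pos
  have hγ := S.γ_pos
  rw [S.mean_epoch d fun _ s w => expect S.ν fun c => ∑ a, (s c).1 a * S.sqError s w a]
  refine (S.mean_mono _ fun σ hσ => ?_).trans (S.mean_const (d * S.H) _).le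
  simp only [chain_expect, chain_sum, chain_mul_left]
  have h1 : ∀ a, S.chain S.midStep (d * S.H) S.H (fun τ => S.sqError σ.sNext τ.wNext a) σ ≤
      9 / 8 * S.γ * (1 / (S.importance σ.sNext a + S.γ)) := by
    intro a
    unfold sqError
    set w := S.importance σ.sNext a with hw
    have hw0 : 0 ≤ w := S.importance_nonneg _ _
    rw [chain_add_fun, chain_mul_left, chain_const]
    have h3 := S.chain_midStep_wNext_sub_sq_le (d * S.H) S.H σ a w
    rw [hσ.wNext_eq_zero S a, zero_add, ← hw, mul_div_cancel₀ _ hH.ne', sub_self] at h3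
    have h4 : S.chain S.midStep (d * S.H) S.H (fun τ => (τ.wNext a - w) ^ 2) σ ≤
        (w + S.γ) * (S.γ / 16) := by
      refine h3.trans ?_
      have h5 : (0 : ℝ) ^ 2 + S.H * (w / S.H / (2 * S.H)) = w / (2 * S.H) := by
        field_simp
        ring
      rw [h5, div_le_iff₀ (by positivity)]
      have h6 : (w + S.γ) * (S.γ / 16) * (2 * S.H) = (w + S.γ) * (S.γ * (2 * S.H)) / 16 := by ring
      rw [h6, S.γ_mul]
      nlinarith [S.one_le_ι]
    have h7 := mul_le_mul_of_nonneg_left h4 (by positivity : 0 ≤ 2 / (w + S.γ) ^ 2)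
    have h8 : 2 / (w + S.γ) ^ 2 * ((w + S.γ) * (S.γ / 16)) = 1 / 8 * S.γ * (1 / (w + S.γ)) := by
      field_simp
      norm_num
    rw [h8] at h7
    linarith
  calc (expect S.ν fun c => ∑ a, (σ.sNext c).1 a *
        S.chain S.midStep (d * S.H) S.H (fun τ => S.sqError σ.sNext τ.wNext a) σ)
      ≤ expect S.ν fun c => 9 / 8 * S.γ *
          ∑ a, (σ.sNext c).1 a * (1 / (S.importance σ.sNext a + S.γ)) := by
        refine expect_mono _ fun c => ?_
        rw [Finset.mul_sum]
        refine Finset.sum_le_sum fun a _ =>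
          (mul_le_mul_of_nonneg_left (h1 a) ((σ.sNext c).2.1 a)).trans (le_of_eq (by ring))
    _ ≤ _ := by
        rw [expect_mul_left]
        exact mul_le_mul_of_nonneg_left (S.expect_sum_div_importance_le _) (by positivity)

/-- The second moment of the deviation of the cumulative losses from the predicted ones. -/
theorem chain_midStep_cum_sub_predicted_sq_le (j m : ℕ) (hj : S.H ≤ j) (hm : m ≤ S.H)
    (σ : State K M) (hw : ∀ a, 0 ≤ σ.wCur a) (hacc : S.Accurate σ.sCur σ.wCur) (c : Fin M)
    (a : Fin K) :
    S.η ^ 2 * S.chain S.midStep j m (fun τ => (τ.cum c a - S.predicted j m σ.cum c a) ^ 2) σ +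
      (|σ.wCur a - S.importance σ.sCur a| / (S.importance σ.sCur a + 3 / 2 * S.γ)) ^ 2 ≤
      S.sqError σ.sCur σ.wCur a := by
  have hγ := S.γ_pos
  have hη := S.η_pos
  have hH := S.H_cast_pos
  have h1 := S.chain_midStep_cum_sub_sq_le j m hj σ hw c a (S.predicted j m σ.cum c a)
  have hacca := hacc a
  unfold sqError
  unfold bias lossVar at h1
  simp only [predicted] at h1 ⊢
  set w := S.importance σ.sCur a with hwdef
  set v := σ.wCur a + 3 / 2 * S.γ with hv
  set z := w + S.γ with hz
  set x := σ.wCur a - w with hx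
  set Ls := S.lossSum j m c a with hLs
  have hw0 : 0 ≤ w := S.importance_nonneg _ _
  have hz0 : 0 < z := by positivity
  have hv0 : 0 < v := by have := hw a; positivity
  have hLs0 : 0 ≤ Ls := S.lossSum_nonneg _ _ _ _
  have hm' : (m : ℝ) ≤ S.H := by exact_mod_cast hm
  have hLs1 : Ls ≤ 2 * S.H := (S.lossSum_le j m c a).trans (by linarith)
  have hηH : S.η * S.H = 4 / 33 := by linarith [S.η_mul]
  have hq : w / v - 1 = -(x + 3 / 2 * S.γ) / v := by
    rw [div_sub_one hv0.ne', hx, hv]; congr 1; ring_nf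
  -- the systematic part of the deviation
  have h2 : S.η ^ 2 * (σ.cum c a + Ls * (w / v) - (σ.cum c a + Ls)) ^ 2 ≤
      (8 / 33) ^ 2 * ((2 * x ^ 2 + 9 / 2 * S.γ ^ 2) / v ^ 2) := by
    have e1 : S.η ^ 2 * (σ.cum c a + Ls * (w / v) - (σ.cum c a + Ls)) ^ 2 =
        (S.η * Ls) ^ 2 * ((x + 3 / 2 * S.γ) ^ 2 / v ^ 2) := by
      have : σ.cum c a + Ls * (w / v) - (σ.cum c a + Ls) = Ls * (w / v - 1) := by ring
      rw [this, hq, mul_pow, div_pow, neg_sq]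
      ring
    rw [e1]
    have e2 : S.η * Ls ≤ 8 / 33 := by
      rw [← S.η_mul]; exact mul_le_mul_of_nonneg_left hLs1 hη.le
    have e3 : (x + 3 / 2 * S.γ) ^ 2 ≤ 2 * x ^ 2 + 9 / 2 * S.γ ^ 2 := by
      nlinarith [sq_nonneg (x - 3 / 2 * S.γ)]
    gcongr
  -- the fluctuations
  have h3 : S.η ^ 2 * (m * (4 * w / v ^ 2)) ≤ 1 / 100 * (S.γ * w / v ^ 2) := by
    have e1 : S.η ^ 2 * m ≤ S.γ / 400 := by
      have e2 : S.η ^ 2 * m * S.H ≤ (4 / 33) ^ 2 := by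
        calc S.η ^ 2 * m * S.H ≤ S.η ^ 2 * S.H * S.H := by gcongr
          _ = (S.η * S.H) ^ 2 := by ring
          _ = _ := by rw [hηH]
      have e3 : 8 ≤ S.γ * S.H := by linarith [S.γ_mul, S.one_le_ι]
      have e4 : S.η ^ 2 * m * S.H ≤ S.γ / 400 * S.H := by
        have : (4 / 33 : ℝ) ^ 2 ≤ 8 / 400 := by norm_num
        linarith
      exact le_of_mul_le_mul_right e4 hH
    calc S.η ^ 2 * (m * (4 * w / v ^ 2)) = S.η ^ 2 * m * (4 * w / v ^ 2) := by ring
      _ ≤ S.γ / 400 * (4 * w / v ^ 2) := mul_le_mul_of_nonneg_right e1 (by positivity)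
      _ = _ := by ring
  have h4 : (|x| / (w + 3 / 2 * S.γ)) ^ 2 ≤ x ^ 2 / z ^ 2 := by
    rw [div_pow, sq_abs]
    gcongr
    rw [hz]; linarith
  have h5 := mul_le_mul_of_nonneg_left h1 (sq_nonneg S.η)
  have hvz : 49 / 64 * z ^ 2 ≤ v ^ 2 := by
    calc 49 / 64 * z ^ 2 = (7 / 8 * z) ^ 2 := by ring
      _ ≤ v ^ 2 := pow_le_pow_left₀ (by positivity) hacca 2
  have h6 : ∀ q : ℝ, 0 ≤ q → q / v ^ 2 ≤ 64 / 49 * (q / z ^ 2) := fun q hq => by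
    calc q / v ^ 2 ≤ q / (49 / 64 * z ^ 2) := by gcongr
      _ = _ := by field_simp
  have h7 := h6 (2 * x ^ 2 + 9 / 2 * S.γ ^ 2) (by positivity)
  have h8 := h6 (S.γ * w) (by positivity)
  have h9 : S.γ * (1 / z) = S.γ * z / z ^ 2 := by field_simp
  have h10 : (8 / 33) ^ 2 * (64 / 49 * ((2 * x ^ 2 + 9 / 2 * S.γ ^ 2) / z ^ 2)) +
      1 / 100 * (64 / 49 * (S.γ * w / z ^ 2)) + x ^ 2 / z ^ 2 ≤
      2 / z ^ 2 * x ^ 2 + S.γ * z / z ^ 2 := by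
    have e1 : (8 / 33) ^ 2 * (64 / 49 * ((2 * x ^ 2 + 9 / 2 * S.γ ^ 2) / z ^ 2)) +
        1 / 100 * (64 / 49 * (S.γ * w / z ^ 2)) + x ^ 2 / z ^ 2 =
        ((8 / 33) ^ 2 * (64 / 49) * (2 * x ^ 2 + 9 / 2 * S.γ ^ 2) +
          1 / 100 * (64 / 49) * (S.γ * w) + x ^ 2) / z ^ 2 := by ring
    have e2 : 2 / z ^ 2 * x ^ 2 + S.γ * z / z ^ 2 = (2 * x ^ 2 + S.γ * z) / z ^ 2 := by ring
    rw [e1, e2]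
    refine div_le_div_of_nonneg_right ?_ (by positivity)
    rw [hz]
    nlinarith [sq_nonneg x, mul_nonneg hγ.le hw0, sq_nonneg S.γ]
  rw [h9]
  rw [mul_add] at h5
  linarith

/-- The first-order bias of the played arms: up to terms of second order, the FTRL distribution
can be replaced by the predicted one, which is independent of the importance estimate. -/
theorem mean_drift_le (d m : ℕ) (hm : m < S.H) (u : Fin M → Fin K → ℝ)
    (hu0 : ∀ c a, 0 ≤ u c a) (hu : ∀ c a, u c a ≤ 2) :
    S.mean ((d + 1) * S.H + m) (fun σ => expect S.ν fun c =>
      ∑ a, (expWeights S.η (σ.cum c)).1 a * (u c a * S.drift σ.sCur σ.wCur a)) ≤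
      36 * S.γ * S.capacity + 10 / S.γ * S.failure := by
  have hγ := S.γ_pos
  have hη := S.η_pos
  have hH := S.H_cast_pos
  have hgood := S.mean_not_good_le d m hm
  have hslow := S.mean_not_slowGrowth_le (d + 1) m hm.le
  rw [S.mean_within_epoch (d + 1) m hm] at hgood ⊢
  set j := (d + 1) * S.H with hj
  have hjH : S.H ≤ j := Nat.le_mul_of_pos_left _ (Nat.succ_pos d)
  have hσ : ∀ σ, S.Reachable j σ → S.chain S.midStep j m (fun τ => expect S.ν fun c =>
      ∑ a, (expWeights S.η (τ.cum c)).1 a * (u c a * S.drift τ.sCur τ.wCur a)) σ ≤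
      (expect S.ν fun c => ∑ a, (expWeights S.η (S.predicted j m σ.cum c)).1 a *
        (u c a * S.drift σ.sCur σ.wCur a)) +
      32 * (expect S.ν fun c => ∑ a, (σ.sCur c).1 a * S.sqError σ.sCur σ.wCur a) +
      4 / (3 * S.γ) * (S.chain S.midStep j m (fun τ => ind (¬S.Good τ)) σ +
        S.chain S.midStep j m (fun τ => ind (¬S.SlowGrowth σ.cum τ.cum)) σ) := by
    intro σ hσ
    set A := expect S.ν fun c => ∑ a, (expWeights S.η (S.predicted j m σ.cum c)).1 a *
        (u c a * S.drift σ.sCur σ.wCur a) with hA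
    set κ : Fin K → ℝ := fun a =>
      |σ.wCur a - S.importance σ.sCur a| / (S.importance σ.sCur a + 3 / 2 * S.γ) with hκ
    have hκ0 : ∀ a, 0 ≤ κ a := fun a =>
      div_nonneg (abs_nonneg _) (by have := S.importance_nonneg σ.sCur a; positivity)
    have hκ1 : ∀ a, κ a ≤ 1 / (3 * S.γ) := fun a => by
      have h1 := S.importance_nonneg σ.sCur a
      have h2 := S.importance_le_half σ.sCur a
      have h3 := hσ.wCur_nonneg a
      have h4 := hσ.wCur_le a
      have h5 : |σ.wCur a - S.importance σ.sCur a| ≤ 1 / 2 := by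
        rw [abs_le]; constructor <;> linarith
      rw [hκ, div_le_div_iff₀ (by positivity) (by positivity)]
      nlinarith
    have hv : ∀ c a, |u c a * S.drift σ.sCur σ.wCur a| ≤ 2 * κ a := fun c a => by
      rw [abs_mul, abs_of_nonneg (hu0 c a)]
      exact mul_le_mul (hu c a) (S.abs_drift_le _ _ _) (abs_nonneg _) zero_le_two
    -- the trivial bound, for the bad event
    have hbad : ∀ τ : State K M, τ.sCur = σ.sCur → τ.wCur = σ.wCur → (expect S.ν fun c =>
        ∑ a, (expWeights S.η (τ.cum c)).1 a * (u c a * S.drift τ.sCur τ.wCur a)) ≤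
        A + 4 / (3 * S.γ) := by
      intro τ hs hw
      rw [hs, hw, hA, ← expect_const S.ν (4 / (3 * S.γ)), ← expect_add]
      refine expect_mono _ fun c => ?_
      have h1 : ∑ a, (expWeights S.η (τ.cum c)).1 a * (u c a * S.drift σ.sCur σ.wCur a) ≤
          2 / (3 * S.γ) := S.sum_expWeights_mul_le fun a => by
        have := (le_abs_self _).trans (hv c a)
        have h2 := hκ1 a
        have h3 : 2 / (3 * S.γ) = 2 * (1 / (3 * S.γ)) := by ring
        linarith
      have h2 : ∑ a, (expWeights S.η (S.predicted j m σ.cum c)).1 a *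
          (-(u c a * S.drift σ.sCur σ.wCur a)) ≤ 2 / (3 * S.γ) :=
        S.sum_expWeights_mul_le fun a => by
          have := (neg_le_abs _).trans (hv c a)
          have h2 := hκ1 a
          have h3 : 2 / (3 * S.γ) = 2 * (1 / (3 * S.γ)) := by ring
          linarith
      simp only [mul_neg, Finset.sum_neg_distrib] at h2
      have h3 : 4 / (3 * S.γ) = 2 / (3 * S.γ) + 2 / (3 * S.γ) := by ring
      linarith
    have hsq0 : 0 ≤ expect S.ν fun c => ∑ a, (σ.sCur c).1 a * S.sqError σ.sCur σ.wCur a := by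
      refine expect_nonneg _ fun c => Finset.sum_nonneg fun a _ =>
        mul_nonneg ((σ.sCur c).2.1 a) ?_
      have := S.importance_nonneg σ.sCur a
      unfold sqError
      positivity
    have h43 : 0 ≤ 4 / (3 * S.γ) := by positivity
    by_cases hacc : S.Accurate σ.sCur σ.wCur
    · have hpt : S.chain S.midStep j m (fun τ => expect S.ν fun c =>
          ∑ a, (expWeights S.η (τ.cum c)).1 a * (u c a * S.drift τ.sCur τ.wCur a)) σ ≤
          S.chain S.midStep j m (fun τ => A + 32 * (expect S.ν fun c => ∑ a, (σ.sCur c).1 a *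
            (S.η ^ 2 * (τ.cum c a - S.predicted j m σ.cum c a) ^ 2 + κ a ^ 2)) +
            4 / (3 * S.γ) * (ind (¬S.Good τ) + ind (¬S.SlowGrowth σ.cum τ.cum))) σ := by
        refine S.chain_midStep_mono_of_cum_le _ _ _ _ σ hσ.wCur_nonneg
          fun τ hs _ hw hle => ?_
        have hnn : 0 ≤ expect S.ν fun c => ∑ a, (σ.sCur c).1 a *
            (S.η ^ 2 * (τ.cum c a - S.predicted j m σ.cum c a) ^ 2 + κ a ^ 2) :=
          expect_nonneg _ fun c => Finset.sum_nonneg fun a _ =>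
            mul_nonneg ((σ.sCur c).2.1 a) (by positivity)
        have i1 := ind_nonneg (¬S.Good τ)
        have i2 := ind_nonneg (¬S.SlowGrowth σ.cum τ.cum)
        by_cases hg : S.Good τ ∧ S.SlowGrowth σ.cum τ.cum
        · obtain ⟨hg, hsl⟩ := hg
          have hind : 0 ≤ 4 / (3 * S.γ) * (ind (¬S.Good τ) + ind (¬S.SlowGrowth σ.cum τ.cum)) := by
            positivity
          refine le_trans ?_ (le_add_of_nonneg_right hind)
          rw [hA, ← expect_mul_left, ← expect_add]
          refine expect_mono _ fun c => ?_
          rw [hs, hw]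
          have hd1 : ∀ a, |S.η * (τ.cum c a - S.predicted j m σ.cum c a)| ≤ 8 / 25 := fun a => by
            have h1 := hsl c a
            have h2 := mul_nonneg hη.le (sub_nonneg.2 (hle c a))
            have h3 := mul_nonneg hη.le (S.lossSum_nonneg j m c a)
            have h4 : S.η * S.lossSum j m c a ≤ 8 / 33 := by
              rw [← S.η_mul]
              have h5 : (m : ℝ) ≤ S.H := by exact_mod_cast hm.le
              exact mul_le_mul_of_nonneg_left ((S.lossSum_le j m c a).trans (by linarith)) hη.le
            have h6 : S.η * (τ.cum c a - S.predicted j m σ.cum c a) =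
                S.η * (τ.cum c a - σ.cum c a) - S.η * S.lossSum j m c a := by
              rw [predicted]; ring
            rw [h6, abs_le]
            constructor <;> linarith
          have hmain := sum_expWeights_mul_le_add_sq (fun a => rfl) hd1
            (s := (σ.sCur c).1) (fun a => by have := (hg.2 c a).2; rwa [hs] at this)
            (hv c)
          refine hmain.trans (le_of_eq ?_)
          simp only [sq_abs, mul_pow]
        · have hone : 1 ≤ ind (¬S.Good τ) + ind (¬S.SlowGrowth σ.cum τ.cum) := by
            by_cases h1 : S.Good τ
            · rw [ind_of (p := ¬S.SlowGrowth σ.cum τ.cum) fun h => hg ⟨h1, h⟩]; linarith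
            · rw [ind_of h1]; linarith
          have h1 := hbad τ hs hw
          have h2 := mul_le_mul_of_nonneg_left hone h43
          linarith
      refine hpt.trans ?_
      rw [chain_add_fun, chain_add_fun, chain_const, chain_mul_left, chain_mul_left,
        chain_add_fun, chain_expect]
      have hfin : (expect S.ν fun c => S.chain S.midStep j m (fun τ => ∑ a, (σ.sCur c).1 a *
            (S.η ^ 2 * (τ.cum c a - S.predicted j m σ.cum c a) ^ 2 + κ a ^ 2)) σ) ≤
          expect S.ν fun c => ∑ a, (σ.sCur c).1 a * S.sqError σ.sCur σ.wCur a := by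
        refine expect_mono _ fun c => ?_
        rw [chain_sum]
        refine Finset.sum_le_sum fun a _ => ?_
        rw [chain_mul_left, chain_add_fun, chain_mul_left, chain_const]
        exact mul_le_mul_of_nonneg_left
          (S.chain_midStep_cum_sub_predicted_sq_le j m hjH hm.le σ hσ.wCur_nonneg hacc c a)
          ((σ.sCur c).2.1 a)
      linarith
    · have h1 : S.chain S.midStep j m (fun τ => expect S.ν fun c =>
          ∑ a, (expWeights S.η (τ.cum c)).1 a * (u c a * S.drift τ.sCur τ.wCur a)) σ ≤
          S.chain S.midStep j m (fun τ => A + 4 / (3 * S.γ) * ind (¬S.Good τ)) σ := by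
        refine S.chain_midStep_congr _ _ _ _ σ fun τ hs _ hw => ?_
        have hng : ¬S.Good τ := fun hg => hacc (by have := hg.1; rwa [hs, hw] at this)
        rw [ind_of hng, mul_one]
        exact hbad τ hs hw
      rw [chain_add_fun, chain_const, chain_mul_left] at h1
      have h2 := mul_nonneg h43 (S.chain_nonneg S.midStep j m
        (fun τ => ind_nonneg (¬S.SlowGrowth σ.cum τ.cum)) σ)
      rw [mul_add]
      linarith
  refine (S.mean_mono _ hσ).trans ?_
  rw [mean_add, mean_add, mean_mul_left, mean_mul_left, mean_add,
    S.mean_predicted_drift_eq_zero d j m u]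
  have h1 := S.mean_sqError_le d
  have h2 := mul_le_mul_of_nonneg_left (add_le_add hgood hslow)
    (by positivity : 0 ≤ 4 / (3 * S.γ))
  have h3 : 4 / (3 * S.γ) * (5 * S.failure + 2 * S.failure) = 28 / 3 * (1 / S.γ * S.failure) := by
    field_simp
    ring
  have h4 : 0 ≤ 1 / S.γ * S.failure := mul_nonneg (by positivity) S.failure_nonneg
  have h5 : 10 / S.γ * S.failure = 10 * (1 / S.γ * S.failure) := by ring
  rw [h3] at h2
  rw [h5]
  linarith

end Game

namespace Game

variable {K M : ℕ} [NeZero K] (S : Game K M)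

/-! ### Regret of the algorithm with losses in `[0, 1]` -/

/-- The expected regret of the `j`-th pair of rounds, given the state before it. -/
noncomputable def pairRegret (π : Fin M → Fin K) (j : ℕ) (σ : State K M) : ℝ :=
  expect S.ν fun c => ∑ a, (S.play j σ c).1 a * S.pairLoss j c a - S.pairLoss j c (π c)

/-- The potential of the exponential weights relative to the policy `π`, averaged over a fresh
context. -/
noncomputable def relPotential (π : Fin M → Fin K) (σ : State K M) : ℝ :=
  expect S.ν fun c => potential S.η (σ.cum c) - σ.cum c (π c)

theorem pairExp_expect (j : ℕ) (σ : State K M) (f : PairRecord K M → Fin M → ℝ) :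
    S.pairExp j σ (fun r => expect S.ν (f r)) = expect S.ν fun c => S.pairExp j σ fun r => f r c :=
  expect_comm _ _ _

/-- The one-step regret inequality for the loss estimates, in expectation. -/
theorem sum_bias_sub_le (π : Fin M → Fin K) {j : ℕ} (hj : S.H ≤ j) (σ : State K M)
    (hw : ∀ a, 0 ≤ σ.wCur a) :
    expect S.ν (fun c => ∑ a, (expWeights S.η (σ.cum c)).1 a * (S.pairLoss j c a * S.bias σ a) -
        S.pairLoss j c (π c) * S.bias σ (π c)) -
      S.η / 2 * expect S.ν (fun c => ∑ a, (expWeights S.η (σ.cum c)).1 a * S.lossVar σ a) ≤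
    S.pairExp j σ (fun r => S.relPotential π (S.next j σ r)) - S.relPotential π σ := by
  have hη := S.η_pos
  have h1 : ∀ r, expect S.ν (fun c =>
      ∑ a, (expWeights S.η (σ.cum c)).1 a * S.lossInc j σ r c a -
        S.η / 2 * ∑ a, (expWeights S.η (σ.cum c)).1 a * S.lossInc j σ r c a ^ 2 -
        S.lossInc j σ r c (π c)) + S.relPotential π σ ≤ S.relPotential π (S.next j σ r) := by
    intro r
    rw [relPotential, relPotential, ← expect_add]
    refine expect_mono _ fun c => ?_
    have h2 := inner_sub_le_potential_sub hη (σ.cum c) (S.lossInc j σ r c)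
      (S.lossInc_nonneg j σ hw r c)
    rw [next_cum]
    change _ ≤ potential S.η (fun a => σ.cum c a + S.lossInc j σ r c a) -
      (σ.cum c (π c) + S.lossInc j σ r c (π c))
    linarith
  have h3 := S.pairExp_mono j σ h1
  have h4 : S.pairExp j σ (fun r => expect S.ν (fun c =>
      ∑ a, (expWeights S.η (σ.cum c)).1 a * S.lossInc j σ r c a -
        S.η / 2 * ∑ a, (expWeights S.η (σ.cum c)).1 a * S.lossInc j σ r c a ^ 2 -
        S.lossInc j σ r c (π c)) + S.relPotential π σ) =
      expect S.ν (fun c => ∑ a, (expWeights S.η (σ.cum c)).1 a * (S.pairLoss j c a * S.bias σ a) -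
        S.pairLoss j c (π c) * S.bias σ (π c)) -
      S.η / 2 * expect S.ν (fun c => ∑ a, (expWeights S.η (σ.cum c)).1 a *
        S.pairExp j σ (fun r => S.lossInc j σ r c a ^ 2)) + S.relPotential π σ := by
    have h5 : ∀ f : PairRecord K M → ℝ, S.pairExp j σ (fun r => f r + S.relPotential π σ) =
        S.pairExp j σ f + S.relPotential π σ := fun f => by
      simp only [pairExp, expect_add, expect_const]
    rw [h5, pairExp_expect, ← expect_mul_left, ← expect_sub]
    congr 2
    funext c
    have h6 : ∀ a, S.pairExp j σ (fun r => S.lossInc j σ r c a) = S.pairLoss j c a * S.bias σ a :=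
      fun a => S.pairExp_lossInc hj σ c a
    unfold pairExp at h6 ⊢
    simp only [expect_sub, expect_mul_left, expect_sum, h6]
    ring
  rw [h4] at h3
  have h7 : expect S.ν (fun c => ∑ a, (expWeights S.η (σ.cum c)).1 a *
        S.pairExp j σ (fun r => S.lossInc j σ r c a ^ 2)) ≤
      expect S.ν (fun c => ∑ a, (expWeights S.η (σ.cum c)).1 a * S.lossVar σ a) :=
    expect_mono _ fun c => Finset.sum_le_sum fun a _ =>
      mul_le_mul_of_nonneg_left (S.pairExp_lossInc_sq_le j σ hw c a) (expWeights_nonneg _ _)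
  have h8 := mul_le_mul_of_nonneg_left h7 (by positivity : 0 ≤ S.η / 2)
  linarith

/-- The regret of a pair splits into the regret for the loss estimates and bias terms. -/
theorem pairRegret_le (π : Fin M → Fin K) {j : ℕ} (hj : S.H ≤ j) (σ : State K M)
    (hw : ∀ a, 0 ≤ σ.wCur a) :
    S.pairRegret π j σ ≤
      (S.pairExp j σ (fun r => S.relPotential π (S.next j σ r)) - S.relPotential π σ) +
      S.η / 2 * expect S.ν (fun c => ∑ a, (expWeights S.η (σ.cum c)).1 a * S.lossVar σ a) +
      expect S.ν (fun c =>
        ∑ a, (expWeights S.η (σ.cum c)).1 a * (S.pairLoss j c a * S.shift σ.sCur a)) +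
      expect S.ν (fun c =>
        ∑ a, (expWeights S.η (σ.cum c)).1 a * (S.pairLoss j c a * S.drift σ.sCur σ.wCur a)) +
      expect S.ν (fun c => S.pairLoss j c (π c) * (S.bias σ (π c) - 1)) +
      2 * ind (¬S.Good σ) := by
  have h1 := S.sum_bias_sub_le π hj σ hw
  have h2 : S.pairRegret π j σ ≤
      expect S.ν (fun c => ∑ a, (expWeights S.η (σ.cum c)).1 a * (S.pairLoss j c a * S.bias σ a) -
        S.pairLoss j c (π c) * S.bias σ (π c)) +
      expect S.ν (fun c =>
        ∑ a, (expWeights S.η (σ.cum c)).1 a * (S.pairLoss j c a * S.shift σ.sCur a)) +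
      expect S.ν (fun c =>
        ∑ a, (expWeights S.η (σ.cum c)).1 a * (S.pairLoss j c a * S.drift σ.sCur σ.wCur a)) +
      expect S.ν (fun c => S.pairLoss j c (π c) * (S.bias σ (π c) - 1)) +
      2 * ind (¬S.Good σ) := by
    rw [pairRegret, ← expect_add, ← expect_add, ← expect_add,
      ← expect_const S.ν (2 * ind (¬S.Good σ)), ← expect_add]
    refine expect_mono _ fun c => ?_
    have h3 : ∑ a, (S.play j σ c).1 a * S.pairLoss j c a ≤
        ∑ a, (expWeights S.η (σ.cum c)).1 a * S.pairLoss j c a + 2 * ind (¬S.Good σ) := by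
      by_cases hg : S.Good σ
      · rw [S.play_eq_of_good hj hg, ind_of_not (not_not.2 hg)]; simp
      · rw [ind_of hg]
        have h4 : ∑ a, (S.play j σ c).1 a * S.pairLoss j c a ≤ 2 := by
          calc ∑ a, (S.play j σ c).1 a * S.pairLoss j c a ≤ ∑ a, (S.play j σ c).1 a * 2 :=
                Finset.sum_le_sum fun a _ => mul_le_mul_of_nonneg_left (S.pairLoss_le_two j c a)
                  ((S.play j σ c).2.1 a)
            _ = 2 := by rw [← Finset.sum_mul, (S.play j σ c).2.2, one_mul]
        have h5 : 0 ≤ ∑ a, (expWeights S.η (σ.cum c)).1 a * S.pairLoss j c a :=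
          Finset.sum_nonneg fun a _ => mul_nonneg (expWeights_nonneg _ _) (S.pairLoss_nonneg j c a)
        linarith
    have h6 : ∑ a, (expWeights S.η (σ.cum c)).1 a * S.pairLoss j c a ≤
        ∑ a, (expWeights S.η (σ.cum c)).1 a * (S.pairLoss j c a * S.bias σ a) +
        ∑ a, (expWeights S.η (σ.cum c)).1 a * (S.pairLoss j c a * S.shift σ.sCur a) +
        ∑ a, (expWeights S.η (σ.cum c)).1 a * (S.pairLoss j c a * S.drift σ.sCur σ.wCur a) := by
      rw [← Finset.sum_add_distrib, ← Finset.sum_add_distrib]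
      refine Finset.sum_le_sum fun a _ => ?_
      have h7 := mul_le_mul_of_nonneg_left
        (mul_le_mul_of_nonneg_left (S.one_sub_bias_le σ hw a) (S.pairLoss_nonneg j c a))
        (expWeights_nonneg (η := S.η) (σ.cum c) a)
      linarith
    linarith
  linarith

/-- The regret of one pair after the first epoch, up to the increase of the potential. -/
noncomputable def pairBound : ℝ :=
  43 * S.γ * S.capacity + (24 + 13 / S.γ) * S.failure

theorem η_le_γ : S.η ≤ S.γ := by
  have h1 := S.γ_mul
  have h2 := S.η_mul
  have h3 := S.one_le_ι
  exact le_of_mul_le_mul_right (by linarith) (mul_pos two_pos S.H_cast_pos)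

theorem mean_pairRegret_le (π : Fin M → Fin K) {j : ℕ} (hj : S.H ≤ j) :
    S.mean j (S.pairRegret π j) ≤
      S.mean (j + 1) (S.relPotential π) - S.mean j (S.relPotential π) + S.pairBound := by
  have hγ := S.γ_pos
  have hη := S.η_pos
  have hηγ := S.η_le_γ
  have hF := S.failure_nonneg
  have hC := S.capacity_nonneg
  refine (S.mean_mono j fun σ hσ => S.pairRegret_le π hj σ hσ.wCur_nonneg).trans ?_
  rw [mean_add, mean_add, mean_add, mean_add, mean_add, mean_sub, ← mean_succ, mean_mul_left,
    mean_mul_left, S.mean_expect j fun c σ => S.pairLoss j c (π c) * (S.bias σ (π c) - 1)]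
  simp only [mean_mul_left]
  obtain ⟨d, m, hm, rfl⟩ : ∃ d m, m < S.H ∧ j = (d + 1) * S.H + m := by
    refine ⟨j / S.H - 1, j % S.H, Nat.mod_lt _ S.H_pos, ?_⟩
    rw [Nat.sub_add_cancel (Nat.div_pos hj S.H_pos), Nat.div_add_mod']
  set j := (d + 1) * S.H + m
  have h1 := S.mean_lossVar_le d m hm
  have h2 := S.mean_shift_le d m hm (S.pairLoss j) (S.pairLoss_nonneg j) (S.pairLoss_le_two j)
  have h3 := S.mean_drift_le d m hm (S.pairLoss j) (S.pairLoss_nonneg j) (S.pairLoss_le_two j)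
  have h4 := S.mean_not_good_le d m hm
  have h5 : (expect S.ν fun c => S.pairLoss j c (π c) * S.mean j fun σ => S.bias σ (π c) - 1) ≤
      2 * ((1 / S.γ + 2) * S.failure) := by
    refine expect_le_of_le _ fun c => ?_
    refine (mul_le_mul_of_nonneg_left (S.mean_bias_sub_one_le d m hm (π c))
      (S.pairLoss_nonneg _ _ _)).trans ?_
    exact mul_le_mul_of_nonneg_right (S.pairLoss_le_two _ _ _) (by positivity)
  have h6 : S.η / 2 * S.mean j (fun σ => expect S.ν fun c =>
      ∑ a, (expWeights S.η (σ.cum c)).1 a * S.lossVar σ a) ≤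
      S.γ * S.capacity + 1 / S.γ * S.failure := by
    refine (mul_le_mul_of_nonneg_left h1 (by positivity)).trans ?_
    have h66 : S.η ≤ S.γ / 66 := by
      have h1 := S.γ_mul
      have h2 := S.η_mul
      have h3 := S.one_le_ι
      refine le_of_mul_le_mul_right ?_ (mul_pos two_pos S.H_cast_pos)
      linarith
    have e1 : S.η / 2 * (16 * S.capacity + 5 / S.γ ^ 2 * S.failure) =
        S.η * (8 * S.capacity + 5 / 2 / S.γ ^ 2 * S.failure) := by ring
    rw [e1]
    refine (mul_le_mul_of_nonneg_right h66 (by positivity)).trans ?_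
    have e2 : S.γ / 66 * (8 * S.capacity + 5 / 2 / S.γ ^ 2 * S.failure) =
        4 / 33 * (S.γ * S.capacity) + 5 / 132 * (1 / S.γ * S.failure) := by
      field_simp
      ring
    have e3 : 0 ≤ S.γ * S.capacity := by positivity
    have e4 : 0 ≤ 1 / S.γ * S.failure := by positivity
    rw [e2]
    linarith
  have h7 : S.pairBound = S.γ * S.capacity + 1 / S.γ * S.failure +
      (6 * S.γ * S.capacity + 10 * S.failure) +
      (36 * S.γ * S.capacity + 10 / S.γ * S.failure) +
      2 * ((1 / S.γ + 2) * S.failure) + 2 * (5 * S.failure) := by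
    rw [pairBound]
    ring
  rw [h7]
  linarith

theorem mean_pairRegret_le_two (π : Fin M → Fin K) (j : ℕ) :
    S.mean j (S.pairRegret π j) ≤ 2 := by
  refine (S.mean_mono j fun σ _ => ?_).trans (S.mean_const j 2).le
  refine expect_le_of_le _ fun c => ?_
  have h4 : ∑ a, (S.play j σ c).1 a * S.pairLoss j c a ≤ 2 := by
    calc ∑ a, (S.play j σ c).1 a * S.pairLoss j c a ≤ ∑ a, (S.play j σ c).1 a * 2 :=
          Finset.sum_le_sum fun a _ => mul_le_mul_of_nonneg_left (S.pairLoss_le_two j c a)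
            ((S.play j σ c).2.1 a)
      _ = 2 := by rw [← Finset.sum_mul, (S.play j σ c).2.2, one_mul]
  linarith [S.pairLoss_nonneg j c (π c)]

theorem mean_relPotential_nonpos (π : Fin M → Fin K) (j : ℕ) :
    S.mean j (S.relPotential π) ≤ 0 := by
  refine (S.mean_mono j fun σ _ => ?_).trans (S.mean_const j 0).le
  exact expect_le_of_le _ fun c => by linarith [potential_le S.η_pos (σ.cum c) (π c)]

theorem mean_relPotential_first_epoch (π : Fin M → Fin K) :
    -(S.η⁻¹ * Real.log K) ≤ S.mean S.H (S.relPotential π) := by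
  refine (S.mean_const S.H _).symm.le.trans (S.mean_mono S.H fun σ hσ => ?_)
  have h : ∀ c, potential S.η (σ.cum c) - σ.cum c (π c) = -(S.η⁻¹ * Real.log K) := fun c => by
    rw [hσ.cum_eq_zero le_rfl, Pi.zero_apply, potential_zero, Pi.zero_apply, sub_zero]
  rw [relPotential]
  simp only [h, expect_const]
  exact le_rfl

theorem pairBound_nonneg : 0 ≤ S.pairBound := by
  have := S.γ_pos
  have := S.failure_nonneg
  have := S.capacity_nonneg
  unfold pairBound
  positivity

/-- The total regret over `n` pairs of rounds. -/
theorem sum_mean_pairRegret_le (hK : 1 ≤ K) (π : Fin M → Fin K) (n : ℕ) :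
    ∑ j ∈ Finset.range n, S.mean j (S.pairRegret π j) ≤
      2 * S.H + S.η⁻¹ * Real.log K + n * S.pairBound := by
  have hη := S.η_pos
  have hlog : 0 ≤ S.η⁻¹ * Real.log K :=
    mul_nonneg (inv_pos.2 hη).le (Real.log_nonneg (by exact_mod_cast hK))
  have hX := S.pairBound_nonneg
  have hsmall : ∀ n, ∑ j ∈ Finset.range n, S.mean j (S.pairRegret π j) ≤ 2 * n := fun n => by
    refine (Finset.sum_le_sum fun j _ => S.mean_pairRegret_le_two π j).trans (le_of_eq ?_)
    simp [mul_comm]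
  rcases le_total n S.H with hn | hn
  · have h1 : (n : ℝ) ≤ S.H := by exact_mod_cast hn
    have := hsmall n
    have : 0 ≤ n * S.pairBound := by positivity
    linarith
  · have hind : ∀ k, ∑ j ∈ Finset.range (S.H + k), S.mean j (S.pairRegret π j) ≤
        2 * S.H + (S.mean (S.H + k) (S.relPotential π) - S.mean S.H (S.relPotential π)) +
          k * S.pairBound := by
      intro k
      induction k with
      | zero => simpa using hsmall S.H
      | succ k ih =>
        rw [← add_assoc, Finset.sum_range_succ]
        have := S.mean_pairRegret_le π (Nat.le_add_right S.H k)
        push_cast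
        linarith
    obtain ⟨k, rfl⟩ := Nat.exists_eq_add_of_le hn
    have h1 := hind k
    have h2 := S.mean_relPotential_nonpos π (S.H + k)
    have h3 := S.mean_relPotential_first_epoch π
    push_cast
    have : 0 ≤ S.H * S.pairBound := by positivity
    linarith

/-! ### The law of the history -/

theorem expect_historyLaw_succ (n : ℕ) (F : (Fin (n + 1) → PairRecord K M) → ℝ) :
    expect (historyLaw S.G (2 * S.H) S.γ S.η S.ν S.ℓ (n + 1)) F =
      expect (historyLaw S.G (2 * S.H) S.γ S.η S.ν S.ℓ n) fun h =>
        S.pairExp n (stateAfter S.G (2 * S.H) S.γ S.η S.ℓ n h) fun r =>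
          F (Fin.snoc (α := fun _ => PairRecord K M) h r) := by
  rw [historyLaw, expect_bind]
  simp only [expect_map]
  rfl

theorem expect_historyLaw_stateAfter (n : ℕ) (f : State K M → ℝ) :
    expect (historyLaw S.G (2 * S.H) S.γ S.η S.ν S.ℓ n)
      (fun h => f (stateAfter S.G (2 * S.H) S.γ S.η S.ℓ n h)) = S.mean n f := by
  induction n generalizing f with
  | zero => rw [historyLaw, expect_pure]; rfl
  | succ n ih =>
    rw [expect_historyLaw_succ, mean_succ, ← ih]
    simp only [stateAfter, Fin.snoc_castSucc, Fin.snoc_last]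
    rfl

theorem expect_historyLaw_sum (n : ℕ) (g : ℕ → PairRecord K M → ℝ) :
    expect (historyLaw S.G (2 * S.H) S.γ S.η S.ν S.ℓ n) (fun h => ∑ j : Fin n, g j (h j)) =
      ∑ j ∈ Finset.range n, S.mean j fun σ => S.pairExp j σ (g j) := by
  induction n with
  | zero => simp [expect]
  | succ n ih =>
    rw [expect_historyLaw_succ, Finset.sum_range_succ, ← ih, ← expect_historyLaw_stateAfter,
      ← expect_add]
    congr 1
    funext h
    simp only [Fin.sum_univ_castSucc, Fin.snoc_castSucc, Fin.snoc_last, Fin.val_castSucc,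
      Fin.val_last, pairExp, expect_add, expect_const]

theorem pairExp_pairRegret (π : Fin M → Fin K) (j : ℕ) (σ : State K M) :
    S.pairExp j σ (fun r => ∑ i : Fin 2, (S.ℓ (2 * j + i) (r.ctx i) (r.arm i) -
      S.ℓ (2 * j + i) (r.ctx i) (π (r.ctx i)))) = S.pairRegret π j σ := by
  rw [S.pairExp_ctx_arm j σ fun i c a => S.ℓ (2 * j + i) c a - S.ℓ (2 * j + i) c (π c)]
  have h1 : ∀ c, ∑ a, (S.play j σ c).1 a = 1 := fun c => (S.play j σ c).2.2
  simp only [mul_sub, Finset.sum_sub_distrib, ← Finset.sum_mul, h1, one_mul, Fin.sum_univ_two,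
    pairRegret, pairLoss, mul_add, Finset.sum_add_distrib, Fin.val_zero, Fin.val_one, add_zero]
  rw [← expect_add]
  congr 1
  funext c
  ring

end Game

/-! ### Reduction to whole pairs of rounds -/

theorem sum_range_two_mul (ψ : ℕ → ℝ) (n : ℕ) :
    ∑ t ∈ Finset.range (2 * n), ψ t = ∑ j ∈ Finset.range n, (ψ (2 * j) + ψ (2 * j + 1)) := by
  induction n with
  | zero => simp
  | succ n ih =>
    rw [show 2 * (n + 1) = 2 * n + 1 + 1 by ring, Finset.sum_range_succ, Finset.sum_range_succ, ih,
      Finset.sum_range_succ]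
    ring

section Reduction

variable {K M : ℕ}

/-- If the losses vanish from round `T` on, the realized regret is a sum over pairs of rounds. -/
theorem realizedRegret_eq_sum_pairs (ℓ : ℕ → Fin M → Fin K → ℝ) (π : Fin M → Fin K) (T : ℕ)
    (hℓ : ∀ t, T ≤ t → ∀ c a, ℓ t c a = 0) (h : Fin ((T + 1) / 2) → PairRecord K M) :
    realizedRegret ℓ π T h = ∑ j : Fin ((T + 1) / 2), ∑ i : Fin 2,
      (ℓ (2 * j + i) ((h j).ctx i) ((h j).arm i) -
        ℓ (2 * j + i) ((h j).ctx i) (π ((h j).ctx i))) := by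
  set φ : ℕ → Fin 2 → PairRecord K M → ℝ := fun t i r =>
    ℓ t (r.ctx i) (r.arm i) - ℓ t (r.ctx i) (π (r.ctx i)) with hφ
  set ψ : ℕ → ℝ := fun t => if ht : t / 2 < (T + 1) / 2 then
    φ t ⟨t % 2, Nat.mod_lt _ two_pos⟩ (h ⟨t / 2, ht⟩) else 0 with hψ
  have h1 : realizedRegret ℓ π T h = ∑ t ∈ Finset.range T, ψ t := by
    rw [Finset.sum_range]
    refine Finset.sum_congr rfl fun t _ => ?_
    have ht : (t : ℕ) / 2 < (T + 1) / 2 := by omega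
    simp only [hψ, dif_pos ht, hφ]
  have h2 : ∑ t ∈ Finset.range T, ψ t = ∑ t ∈ Finset.range (2 * ((T + 1) / 2)), ψ t := by
    refine Finset.sum_subset (Finset.range_subset_range.2 (by omega)) fun t _ ht => ?_
    have ht' : T ≤ t := by simpa using ht
    simp only [hψ, hφ, hℓ t ht', sub_self]
    split_ifs <;> rfl
  rw [h1, h2, sum_range_two_mul, Finset.sum_range]
  refine Finset.sum_congr rfl fun j _ => ?_
  have hj := j.2
  have e0 : (2 * (j : ℕ)) / 2 = j := by omega
  have e1 : (2 * (j : ℕ) + 1) / 2 = j := by omega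
  have f0 : (2 * (j : ℕ)) % 2 = 0 := by omega
  have f1 : (2 * (j : ℕ) + 1) % 2 = 1 := by omega
  simp only [hψ, hφ, e0, e1, f0, f1, hj, dif_pos, Fin.sum_univ_two, Fin.val_zero, Fin.val_one,
    add_zero]
  rfl

variable [NeZero K]

theorem stateAfter_congr (G : Digraph (Fin K)) (L : ℕ) (γ η : ℝ) {ℓ ℓ' : ℕ → Fin M → Fin K → ℝ}
    (n : ℕ) (hℓ : ∀ t < 2 * n, ℓ t = ℓ' t) (h : Fin n → PairRecord K M) :
    stateAfter G L γ η ℓ n h = stateAfter G L γ η ℓ' n h := by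
  induction n with
  | zero => rfl
  | succ n ih =>
    have hstep : ∀ σ r, step G L γ η ℓ n σ r = step G L γ η ℓ' n σ r := fun σ r => by
      have : ∀ c a, lossEstimate G γ ℓ n σ r c a = lossEstimate G γ ℓ' n σ r c a := fun c a => by
        rw [lossEstimate, lossEstimate, hℓ (2 * n + r.lossIdx) (by have := r.lossIdx.2; omega)]
      simp only [step, this]
    rw [stateAfter, stateAfter, ih fun t ht => hℓ t (by omega), hstep]

theorem historyLaw_congr (G : Digraph (Fin K)) (L : ℕ) (γ η : ℝ) (ν : PMF (Fin M))
    {ℓ ℓ' : ℕ → Fin M → Fin K → ℝ} (n : ℕ) (hℓ : ∀ t, t + 2 < 2 * n → ℓ t = ℓ' t) :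
    historyLaw G L γ η ν ℓ n = historyLaw G L γ η ν ℓ' n := by
  induction n with
  | zero => rfl
  | succ n ih =>
    rw [historyLaw, historyLaw, ih fun t ht => hℓ t (by omega)]
    congr 1
    funext h
    rw [stateAfter_congr G L γ η n fun t ht => hℓ t (by omega)]

/-- Losses from round `T` on are irrelevant. -/
theorem expectedRegret_congr (G : Digraph (Fin K)) (L : ℕ) (γ η : ℝ) (ν : PMF (Fin M))
    {ℓ ℓ' : ℕ → Fin M → Fin K → ℝ} (π : Fin M → Fin K) (T : ℕ) (hℓ : ∀ t < T, ℓ t = ℓ' t) :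
    expectedRegret G L γ η ν ℓ π T = expectedRegret G L γ η ν ℓ' π T := by
  unfold expectedRegret
  rw [historyLaw_congr G L γ η ν ((T + 1) / 2) fun t ht => hℓ t (by omega)]
  refine Finset.sum_congr rfl fun h _ => ?_
  congr 1
  unfold realizedRegret
  refine Finset.sum_congr rfl fun t _ => ?_
  simp only [hℓ t t.2]

theorem expectedRegret_le (G : Digraph (Fin K)) (L : ℕ) (γ η : ℝ) (ν : PMF (Fin M))
    (ℓ : ℕ → Fin M → Fin K → ℝ) (π : Fin M → Fin K) (T : ℕ)
    (hℓ : ∀ t < T, ∀ c a, ℓ t c a ∈ Set.Icc (0 : ℝ) 1) :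
    expectedRegret G L γ η ν ℓ π T ≤ T := by
  refine expect_le_of_le (historyLaw G L γ η ν ℓ ((T + 1) / 2)) fun h => ?_
  unfold realizedRegret
  calc _ ≤ ∑ _t : Fin T, (1 : ℝ) := Finset.sum_le_sum fun t _ => by
        have h1 := (hℓ t t.2)
        exact (sub_le_sub (h1 _ _).2 (h1 _ _).1).trans (sub_zero 1).le
    _ = T := by simp

end Reduction

theorem Game.expectedRegret_eq {K M : ℕ} [NeZero K] (S : Game K M) (π : Fin M → Fin K) (T : ℕ)
    (hℓ : ∀ t, T ≤ t → ∀ c a, S.ℓ t c a = 0) :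
    expectedRegret S.G (2 * S.H) S.γ S.η S.ν S.ℓ π T =
      ∑ j ∈ Finset.range ((T + 1) / 2), S.mean j (S.pairRegret π j) := by
  have h := S.expect_historyLaw_sum ((T + 1) / 2) fun j r => ∑ i : Fin 2,
    (S.ℓ (2 * j + i) (r.ctx i) (r.arm i) - S.ℓ (2 * j + i) (r.ctx i) (π (r.ctx i)))
  simp only [S.pairExp_pairRegret] at h
  unfold expectedRegret
  simp only [realizedRegret_eq_sum_pairs S.ℓ π T hℓ]
  exact h

/-! ### Size of the parameters -/

section Parameters

variable {K T : ℕ}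

theorem log_two_le_log_mul (hK : 2 ≤ K) (hT : 1 ≤ T) : Real.log 2 ≤ Real.log (K * T) := by
  have hK' : (2 : ℝ) ≤ K := by exact_mod_cast hK
  have hT' : (1 : ℝ) ≤ T := by exact_mod_cast hT
  exact Real.log_le_log two_pos (by nlinarith)

theorem iota_eq (hK : 2 ≤ K) (hT : 1 ≤ T) :
    iota K T = 6 * Real.log 2 + 2 * Real.log K + 4 * Real.log T := by
  have hK' : (2 : ℝ) ≤ K := by exact_mod_cast hK
  have hT' : (1 : ℝ) ≤ T := by exact_mod_cast hT
  rw [iota, Real.log_mul (by positivity) (by positivity), Real.log_mul (by norm_num)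
    (by positivity), Real.log_pow, show (8 : ℝ) = 2 ^ 3 by norm_num, Real.log_pow]
  push_cast
  ring

theorem one_le_iota (hK : 2 ≤ K) (hT : 1 ≤ T) : 1 ≤ iota K T := by
  have hK' : (2 : ℝ) ≤ K := by exact_mod_cast hK
  have hT' : (1 : ℝ) ≤ T := by exact_mod_cast hT
  have h1 := Real.log_two_gt_d9
  have h2 := Real.log_nonneg hT'
  have h3 := Real.log_nonneg (by linarith : (1 : ℝ) ≤ K)
  rw [iota_eq hK hT]
  linarith

theorem log_le_iota (hK : 2 ≤ K) (hT : 1 ≤ T) : Real.log K ≤ iota K T := by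
  have hK' : (2 : ℝ) ≤ K := by exact_mod_cast hK
  have hT' : (1 : ℝ) ≤ T := by exact_mod_cast hT
  have h1 := Real.log_two_gt_d9
  have h2 := Real.log_nonneg hT'
  have h3 := Real.log_nonneg (by linarith : (1 : ℝ) ≤ K)
  rw [iota_eq hK hT]
  linarith

theorem iota_le (hK : 2 ≤ K) (hT : 1 ≤ T) : iota K T ≤ 10 * Real.log (K * T) := by
  have hK' : (2 : ℝ) ≤ K := by exact_mod_cast hK
  have hT' : (1 : ℝ) ≤ T := by exact_mod_cast hT
  have h0 := log_two_le_log_mul hK hT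
  have h3 := Real.log_nonneg (by linarith : (1 : ℝ) ≤ K)
  have h4 : Real.log (K * T) = Real.log K + Real.log T :=
    Real.log_mul (by positivity) (by positivity)
  rw [iota_eq hK hT]
  linarith

theorem card_mul_exp_neg_iota_le (hK : 2 ≤ K) (hT : 1 ≤ T) :
    K * Real.exp (-iota K T) ≤ 1 / (T : ℝ) ^ 2 := by
  have hK' : (2 : ℝ) ≤ K := by exact_mod_cast hK
  have hT' : (1 : ℝ) ≤ T := by exact_mod_cast hT
  have h1 : Real.exp (iota K T) = (8 * K * (T : ℝ) ^ 2) ^ 2 := by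
    rw [iota, mul_comm, Real.exp_mul, Real.exp_log (by positivity)]
    norm_num
  rw [Real.exp_neg, h1, ← div_eq_mul_inv, div_le_div_iff₀ (by positivity) (by positivity)]
  have h2 : (T : ℝ) ^ 2 ≤ (T : ℝ) ^ 4 := pow_le_pow_right₀ hT' (by norm_num)
  have h3 : (K : ℝ) ≤ K ^ 2 := by nlinarith
  have h4 : (K : ℝ) * (T : ℝ) ^ 2 ≤ K ^ 2 * (T : ℝ) ^ 4 := by gcongr
  nlinarith [sq_nonneg ((K : ℝ) * (T : ℝ) ^ 2)]

variable [NeZero K]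

theorem epochLength_bounds (hK : 2 ≤ K) (hT : 1 ≤ T) (G : Digraph (Fin K)) {L : ℕ} (hL : 2 ≤ L)
    (hLi : |(L : ℝ) - idealEpochLength G T| < 2) :
    1 ≤ Real.sqrt (independenceNumber G * T) ∧ Real.sqrt (independenceNumber G * T) ≤ 2 * L ∧
      (L : ℝ) ≤ 20 * Real.log (K * T) * Real.sqrt (independenceNumber G * T) := by
  have hK' : (2 : ℝ) ≤ K := by exact_mod_cast hK
  have hT' : (1 : ℝ) ≤ T := by exact_mod_cast hT
  have hL' : (2 : ℝ) ≤ L := by exact_mod_cast hL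
  have hα : (1 : ℝ) ≤ independenceNumber G := by exact_mod_cast one_le_independenceNumber G
  have hl2 := Real.log_two_gt_d9
  have hl := log_two_le_log_mul hK hT
  have hlK : Real.log 2 ≤ Real.log K := Real.log_le_log two_pos hK'
  set l := Real.log (K * T)
  set R := Real.sqrt (independenceNumber G * T) with hR
  have hR1 : 1 ≤ R := Real.one_le_sqrt.2 (by nlinarith)
  have hideal : idealEpochLength G T = Real.sqrt (iota K T / Real.log K) * R := by
    rw [hR, ← Real.sqrt_mul (div_nonneg (by linarith [one_le_iota hK hT]) (by linarith)),
      idealEpochLength]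
    congr 1
    ring
  have h1 : 1 ≤ Real.sqrt (iota K T / Real.log K) := by
    rw [Real.one_le_sqrt, one_le_div (by linarith)]
    exact log_le_iota hK hT
  have h2 : Real.sqrt (iota K T / Real.log K) ≤ 16 * l := by
    rw [Real.sqrt_le_left (by linarith), div_le_iff₀ (by linarith)]
    have h3 := iota_le hK hT
    nlinarith
  rw [abs_lt] at hLi
  have h4 : R ≤ idealEpochLength G T := by rw [hideal]; nlinarith
  have h5 : idealEpochLength G T ≤ 16 * l * R := by
    rw [hideal]; exact mul_le_mul_of_nonneg_right h2 (by linarith)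
  refine ⟨hR1, by linarith [hLi.1], ?_⟩
  have h6 : 2 ≤ 4 * l * R := by nlinarith
  linarith [hLi.2]

end Parameters

/-- The run of the algorithm with the prescribed parameters. -/
noncomputable def gameOfParams {K M T H : ℕ} (hK : 2 ≤ K) (hT : 1 ≤ T)
    (G : Digraph (Fin K)) (hG : ∀ a, G.Adj a a) (hH : 0 < H) (ν : PMF (Fin M))
    (ℓ : ℕ → Fin M → Fin K → ℝ) (hℓ : ∀ t c a, ℓ t c a ∈ Set.Icc (0 : ℝ) 1) : Game K M where
  G := G
  refl := hG
  H := H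
  H_pos := hH
  γ := gammaParam K T (2 * H)
  η := etaParam K T (2 * H)
  ι := iota K T
  one_le_ι := one_le_iota hK hT
  γ_mul := by
    have : (0 : ℝ) < H := Nat.cast_pos.2 hH
    rw [gammaParam]
    push_cast
    field_simp
  η_mul := by
    have h1 : (0 : ℝ) < H := Nat.cast_pos.2 hH
    have h2 : 0 < iota K T := zero_lt_one.trans_le (one_le_iota hK hT)
    rw [etaParam, gammaParam]
    push_cast
    field_simp
    norm_num
  ν := ν
  ℓ := ℓ
  ℓ_mem := hℓ

/-- The regret bound in terms of the epoch length, when there is at least one whole epoch. -/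
theorem expectedRegret_le_of_le {K M T H : ℕ} [NeZero K] (hK : 2 ≤ K) (hT : 1 ≤ T)
    (G : Digraph (Fin K)) (hG : ∀ a, G.Adj a a) (hH : 0 < H) (hHT : 2 * H ≤ T) (ν : PMF (Fin M))
    (ℓ : ℕ → Fin M → Fin K → ℝ) (hℓ : ∀ t < T, ∀ c a, ℓ t c a ∈ Set.Icc (0 : ℝ) 1)
    (π : Fin M → Fin K) :
    expectedRegret G (2 * H) (gammaParam K T (2 * H)) (etaParam K T (2 * H)) ν ℓ π T ≤
      2 * H + 33 / 8 * (2 * H) * Real.log K +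
        T * (43 * (16 * iota K T / (2 * H)) *
          (4 * independenceNumber G * Real.log (K * T))) + 37 := by
  have hK' : (2 : ℝ) ≤ K := by exact_mod_cast hK
  have hT' : (1 : ℝ) ≤ T := by exact_mod_cast hT
  have hH' : (1 : ℝ) ≤ H := by exact_mod_cast hH
  have hHT' : 2 * (H : ℝ) ≤ T := by exact_mod_cast hHT
  have hα : (1 : ℝ) ≤ independenceNumber G := by exact_mod_cast one_le_independenceNumber G
  -- losses after the last round are set to zero, so that only whole pairs of rounds occur
  set ℓ' : ℕ → Fin M → Fin K → ℝ := fun t => if t < T then ℓ t else 0 with hℓ'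
  have hmem : ∀ t c a, ℓ' t c a ∈ Set.Icc (0 : ℝ) 1 := fun t c a => by
    simp only [hℓ']
    split_ifs with h
    · exact hℓ t h c a
    · simp
  set S := gameOfParams hK hT G hG hH ν ℓ' hmem with hS
  have hγ := S.γ_pos
  have hι := S.one_le_ι
  have h1 : expectedRegret G (2 * H) (gammaParam K T (2 * H)) (etaParam K T (2 * H)) ν ℓ π T =
      expectedRegret S.G (2 * S.H) S.γ S.η S.ν S.ℓ π T :=
    expectedRegret_congr (ℓ' := ℓ') G _ _ _ ν π T fun t ht => (if_pos ht).symm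
  rw [h1, S.expectedRegret_eq π T fun t ht c a => by
    change ℓ' t c a = 0
    simp only [hℓ', if_neg (not_lt.2 ht), Pi.zero_apply]]
  refine (S.sum_mean_pairRegret_le (by omega) π _).trans ?_
  have hSH : (S.H : ℝ) = H := rfl
  have hηinv : S.η⁻¹ = 33 / 8 * (2 * H) := by
    have h2 := S.η_mul
    rw [hSH] at h2
    refine inv_eq_of_mul_eq_one_right ?_
    linarith
  have hn : (((T + 1) / 2 : ℕ) : ℝ) ≤ T := by exact_mod_cast (by omega : (T + 1) / 2 ≤ T)
  have hγeq : S.γ = 16 * iota K T / (2 * H) := by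
    change gammaParam K T (2 * H) = _
    rw [gammaParam]
    push_cast
    rfl
  have hγinv : 1 / S.γ ≤ T := by
    have h2 := S.γ_mul
    rw [hSH] at h2
    rw [div_le_iff₀ hγ]
    nlinarith
  have hcap : S.capacity ≤ 4 * independenceNumber G * Real.log (K * T) := by
    refine mul_le_mul_of_nonneg_left ?_ (by positivity)
    have h0 : 0 ≤ 1 / (4 * (independenceNumber G : ℝ) * S.γ) := by positivity
    refine Real.log_le_log (by change 0 < 1 + 1 / (4 * (independenceNumber G : ℝ) * S.γ); linarith) ?_
    change 1 + 1 / (4 * (independenceNumber G : ℝ) * S.γ) ≤ K * T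
    have h2 : 1 / (4 * (independenceNumber G : ℝ) * S.γ) ≤ 1 / S.γ := by
      gcongr
      nlinarith
    nlinarith
  have hfail : S.failure ≤ 1 / (T : ℝ) ^ 2 := card_mul_exp_neg_iota_le hK hT
  have hbound : S.pairBound ≤ 43 * S.γ * (4 * independenceNumber G * Real.log (K * T)) +
      37 / T := by
    have h2 : (24 + 13 / S.γ) * S.failure ≤ (37 * T) * (1 / (T : ℝ) ^ 2) := by
      refine mul_le_mul ?_ hfail S.failure_nonneg (by positivity)
      have : 13 / S.γ = 13 * (1 / S.γ) := by ring
      linarith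
    have h3 : (37 * T) * (1 / (T : ℝ) ^ 2) = 37 / T := by field_simp
    have h4 := mul_le_mul_of_nonneg_left hcap (by positivity : 0 ≤ 43 * S.γ)
    unfold Game.pairBound
    linarith
  have hfin : (((T + 1) / 2 : ℕ) : ℝ) * S.pairBound ≤
      T * (43 * (16 * iota K T / (2 * H)) * (4 * independenceNumber G * Real.log (K * T))) +
        37 := by
    calc (((T + 1) / 2 : ℕ) : ℝ) * S.pairBound
        ≤ T * (43 * S.γ * (4 * independenceNumber G * Real.log (K * T)) + 37 / T) :=
          mul_le_mul hn hbound S.pairBound_nonneg (by positivity)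
      _ = T * (43 * S.γ * (4 * independenceNumber G * Real.log (K * T))) + 37 := by
          rw [mul_add, mul_div_cancel₀ _ (by positivity)]
      _ = _ := by rw [hγeq]
  rw [hηinv, hSH]
  linarith

/-- The bound on the regret in terms of `R = √(αT)` and `l = log (KT)`. -/
theorem regret_bound_le {L R l ι k α T : ℝ} (hL : 0 < L) (hR1 : 1 ≤ R) (hRL : R ≤ 2 * L)
    (hLR : L ≤ 20 * l * R) (hl : 1 / 2 ≤ l) (hι2 : ι ≤ 10 * l) (hk0 : 0 ≤ k)
    (hk : k ≤ l) (hR2 : R ^ 2 = α * T) :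
    L + 33 / 8 * L * k + T * (43 * (16 * ι / L) * (4 * α * l)) + 37 ≤
      60000 * l ^ 2 * R := by
  have hl2 : l ≤ 2 * l ^ 2 := by nlinarith
  have hlR : l * R ≤ 2 * l ^ 2 * R := mul_le_mul_of_nonneg_right hl2 (by linarith)
  have h2 : L * k ≤ 20 * (l ^ 2 * R) := by
    calc L * k ≤ (20 * l * R) * l := mul_le_mul hLR hk hk0 (by positivity)
      _ = _ := by ring
  have h4 : T * (43 * (16 * ι / L) * (4 * α * l)) ≤ 55040 * (l ^ 2 * R) := by
    have e1 : T * (43 * (16 * ι / L) * (4 * α * l)) = 2752 * ((ι * l) * R ^ 2) / L := by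
      rw [hR2]; ring
    rw [e1, div_le_iff₀ hL]
    have e2 : ι * l ≤ 10 * l ^ 2 := by
      calc ι * l ≤ 10 * l * l := mul_le_mul_of_nonneg_right hι2 (by linarith)
        _ = _ := by ring
    have e3 : R ^ 2 ≤ 2 * L * R := by
      rw [sq]; exact mul_le_mul_of_nonneg_right hRL (by linarith)
    have e4 : (ι * l) * R ^ 2 ≤ (10 * l ^ 2) * (2 * L * R) :=
      mul_le_mul e2 e3 (by positivity) (by positivity)
    linarith
  have h6 : 1 / 4 ≤ l ^ 2 * R := by
    have : 1 / 4 ≤ l ^ 2 := by nlinarith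
    nlinarith
  linarith

end CrossLearning

theorem theorem1 :
    ∃ (C : ℝ) (k : ℕ), 0 < C ∧
      ∀ (K T : ℕ) [NeZero K], 2 ≤ K → 1 ≤ T →
      ∀ G : Digraph (Fin K), (∀ a, G.Adj a a) →
      ∀ L : ℕ, 0 < L → Even L → |(L : ℝ) - CrossLearning.idealEpochLength G T| < 2 →
        let R : ℝ := Real.sqrt (CrossLearning.independenceNumber G * T)
        let B : ℝ := C * Real.log (K * T) ^ k
        let γ : ℝ := CrossLearning.gammaParam K T L
        let η : ℝ := CrossLearning.etaParam K T L
        (R / B ≤ L ∧ (L : ℝ) ≤ B * R) ∧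
        (1 / (B * R) ≤ γ ∧ γ ≤ B / R) ∧
        (1 / (B * R) ≤ η ∧ η ≤ B / R) ∧
        ∀ (M : ℕ) (ν : PMF (Fin M)) (ℓ : ℕ → Fin M → Fin K → ℝ),
          (∀ t < T, ∀ c a, ℓ t c a ∈ Set.Icc (0 : ℝ) 1) →
          ∀ π : Fin M → Fin K,
            CrossLearning.expectedRegret G L γ η ν ℓ π T ≤ B * R := by
  refine ⟨60000, 2, by norm_num, ?_⟩
  intro K T _ hK hT G hG L hL0 hLe hLi R B γ η
  obtain ⟨H, hH⟩ := hLe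
  have hLH : L = 2 * H := by omega
  have hHpos : 0 < H := by omega
  have hK' : (2 : ℝ) ≤ K := by exact_mod_cast hK
  have hT' : (1 : ℝ) ≤ T := by exact_mod_cast hT
  have hL2 : (2 : ℝ) ≤ L := by exact_mod_cast (by omega : 2 ≤ L)
  obtain ⟨hR1, hRL, hLR⟩ := CrossLearning.epochLength_bounds hK hT G (by omega) hLi
  have hl : 1 / 2 ≤ Real.log (K * T) := by
    have := CrossLearning.log_two_le_log_mul hK hT
    have := Real.log_two_gt_d9
    linarith
  have hι1 := CrossLearning.one_le_iota hK hT
  have hι2 := CrossLearning.iota_le hK hT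
  have hlK : Real.log K ≤ Real.log (K * T) :=
    Real.log_le_log (by positivity) (by nlinarith)
  have hlK0 : 0 ≤ Real.log K := Real.log_nonneg (by linarith)
  have hR2 : R ^ 2 = CrossLearning.independenceNumber G * T := Real.sq_sqrt (by positivity)
  change 1 ≤ R at hR1
  change R ≤ 2 * L at hRL
  change (L : ℝ) ≤ 20 * Real.log (K * T) * R at hLR
  have hγ : γ = 16 * CrossLearning.iota K T / L := rfl
  have hη : η = 8 / 33 / L := by
    change CrossLearning.etaParam K T L = _
    rw [CrossLearning.etaParam, CrossLearning.gammaParam]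
    have : 0 < CrossLearning.iota K T := by linarith
    field_simp
    norm_num
  have hB : B = 60000 * Real.log (K * T) ^ 2 := rfl
  set l := Real.log (K * T)
  set ι := CrossLearning.iota K T
  have hl2 : l ≤ 2 * l ^ 2 := by nlinarith
  have hB1 : 30000 * l ≤ B := by rw [hB]; linarith
  have hB0 : 0 < B := by linarith
  have hR0 : 0 < R := by linarith
  have hL0' : (0 : ℝ) < L := by linarith
  have hlR : 0 ≤ l * R := by positivity
  refine ⟨⟨?_, ?_⟩, ⟨?_, ?_⟩, ⟨?_, ?_⟩, ?_⟩
  · rw [div_le_iff₀ hB0]; nlinarith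
  · nlinarith
  · rw [hγ, div_le_div_iff₀ (by positivity) hL0', one_mul]
    have : 20 * l * R ≤ B * R := by nlinarith
    nlinarith
  · rw [hγ, div_le_div_iff₀ hL0' hR0]
    nlinarith
  · rw [hη, div_le_div_iff₀ (by positivity) hL0']
    nlinarith
  · rw [hη, div_le_div_iff₀ hL0' hR0]
    nlinarith
  · intro M ν ℓ hℓ π
    rcases le_or_gt L T with hLT | hLT
    · have h1 := CrossLearning.expectedRegret_le_of_le hK hT G hG hHpos (hLH ▸ hLT) ν ℓ hℓ π
      have hL2H : 2 * (H : ℝ) = L := by rw [hLH]; push_cast; ring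
      rw [← hLH, hL2H] at h1
      refine h1.trans ?_
      rw [hB]
      exact CrossLearning.regret_bound_le hL0' hR1 hRL hLR hl hι2 hlK0 hlK hR2
    · have h1 := CrossLearning.expectedRegret_le G L γ η ν ℓ π T hℓ
      have h2 : (T : ℝ) ≤ L := by exact_mod_cast hLT.le
      nlinarith
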